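/- **Proposition 6.2.** Let $\nu$ be a measure on $(0,\infty)$ with $\int \min(1,y)\,\nu(dy)<\infty$, let $(S_t)_{t\ge 0}$ be a subordinator (without drift and without killing) with Lévy measure $\nu$, and put $\Phi(s)=\int_0^\infty(1-e^{-sy})\,\nu(dy)$, so that $\mathbb E e^{-sS_t}=e^{-t\Phi(s)}$. Assume that, for some $0<\alpha\le 1$ and some function $\ell$ slowly varying at $\infty$, $$\nu[y,\infty)\sim \ell(1/y)\,y^{-\alpha}\qquad (y\downarrow 0).\tag{1}$$ Let $\tilde{\mathcal R}\subset[0,1]$ be the closed range of the process $1-e^{-S_t}$, $t\ge 0$. For $\rho>0$ let a Poisson point process on $[0,1]$ with intensity $\rho\,dx$, independent of $(S_t)$, be partitioned into blocks by letting two points $u<v$ belong to the same block if and only if $[u,v]\cap\tilde{\mathcal R}=\emptyset$; let $\widehat K_\rho$ be the number of blocks, and let $$f^{(m)}(\rho)=\mathbb E\,\widehat K_\rho(\widehat K_\rho-1)\cdots(\widehat K_\rho-m+1),\qquad f^{(0)}(\rho)=1.$$ Then for every $m=0,1,2,\dots$ these factorial moments are finite for all $\rho>0$, and, as $\rho\to\infty$: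 * if $0<\alpha<1$, then $$f^{(m)}(\rho)\sim c^{(m)}\,(\rho^\alpha\ell(\rho))^m,\qquad c^{(m)}=\prod_{j=1}^m\frac{j\,\Gamma(1-\alpha)}{\Phi(\alpha j)};$$ * if $\alpha=1$, then $$f^{(m)}(\rho)\sim \Big(\prod_{j=1}^m\frac{j}{\Phi(j)}\Big)(\rho\,\ell^*(\rho))^m,\qquad \ell^*(t)=\int_0^\infty\frac{e^{-1/y}}{y}\,\ell(ty)\,dy .$$ Here it is assumed that for each $t>0$ the integrand is absolutely integrable over $y\in(0,1]$; this concerns only the values of $\ell$ on bounded sets, which (1) leaves arbitrary, and it holds automatically when (1) is an identity for all $y>0$, or when $\ell$ is bounded on bounded subsets of $(0,\infty)$. The integral over $(0,\infty)$ then converges for every $t>0$. -/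

import Mathlib

open MeasureTheory ProbabilityTheory Filter Topology Asymptotics
open scoped NNReal ENNReal

noncomputable section

namespace RegenerativeComposition

/-- Slow variation at `∞`: `ℓ` is measurable, positive near `∞`, and `ℓ (c u) / ℓ u → 1` as
`u → ∞` for every `c > 0`. -/
structure IsSlowlyVarying (ℓ : ℝ → ℝ) : Prop where
  measurable : Measurable ℓ
  eventually_pos : ∀ᶠ u in atTop, 0 < ℓ u
  tendsto_ratio : ∀ c : ℝ, 0 < c → Tendsto (fun u => ℓ (c * u) / ℓ u) atTop (𝓝 1)

/-- `ν` is the Lévy measure of a subordinator: it lives on `(0, ∞)` and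
`∫ min (1, y) ν(dy) < ∞`. As a measure on `ℝ` it has no mass at `∞`. -/
structure IsLevyMeasure (ν : Measure ℝ) : Prop where
  nonpos_null : ν (Set.Iic 0) = 0
  lintegral_min_lt_top : ∫⁻ y, ENNReal.ofReal (min 1 y) ∂ν < ∞

/-- The Laplace exponent `Φ(s) = ∫ (1 - e^{-s y}) ν(dy)` of the drift-free subordinator with
Lévy measure `ν`. -/
def laplaceExponent (ν : Measure ℝ) (s : ℝ) : ℝ :=
  ∫ y, (1 - Real.exp (-(s * y))) ∂ν

/-- `(S t)_{t ≥ 0}` is, under `P`, a subordinator with Lévy measure `ν`, without drift and without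
killing: it starts at `0`, has nondecreasing right-continuous paths (almost surely) and stationary
independent increments, and `E e^{-s S_t} = e^{-t Φ(s)}`. -/
structure IsSubordinator {Ω : Type*} [MeasurableSpace Ω] (S : ℝ≥0 → Ω → ℝ) (ν : Measure ℝ)
    (P : Measure Ω) : Prop where
  levy : IsLevyMeasure ν
  measurable : ∀ t, Measurable (S t)
  zero : ∀ᵐ ω ∂P, S 0 ω = 0
  monotone : ∀ᵐ ω ∂P, Monotone fun t => S t ω
  right_continuous : ∀ᵐ ω ∂P, ∀ t, ContinuousWithinAt (fun u => S u ω) (Set.Ici t) t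
  indep_increments : HasIndepIncrements S P
  stationary_increments : ∀ t h : ℝ≥0,
    IdentDistrib (fun ω => S (t + h) ω - S t ω) (S h) P P
  laplace : ∀ (t : ℝ≥0) (s : ℝ), 0 ≤ s →
    ∫ ω, Real.exp (-(s * S t ω)) ∂P = Real.exp (-(t * laplaceExponent ν s))

/-- `X` is, under `P`, a Poisson point process on `ℝ` with intensity measure `μ`: a random countable
set such that the number of points in a measurable set `A` has the Poisson law with mean `μ A`
(is a.s. infinite if `μ A = ∞`), and the numbers of points in disjoint measurable sets are
independent. -/
structure IsPoissonProcess {Ω : Type*} [MeasurableSpace Ω] (X : Ω → Set ℝ) (μ : Measure ℝ)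
    (P : Measure Ω) : Prop where
  countable : ∀ᵐ ω ∂P, (X ω).Countable
  measurable_count : ∀ A : Set ℝ, MeasurableSet A → Measurable fun ω => (X ω ∩ A).encard
  count_law : ∀ A : Set ℝ, MeasurableSet A → μ A ≠ ∞ →
    HasLaw (fun ω => (X ω ∩ A).encard)
      ((poissonMeasure (μ A).toNNReal).map ((↑) : ℕ → ℕ∞)) P
  count_top : ∀ A : Set ℝ, MeasurableSet A → μ A = ∞ → ∀ᵐ ω ∂P, (X ω ∩ A).encard = ⊤
  indep_counts : ∀ (n : ℕ) (A : Fin n → Set ℝ), (∀ i, MeasurableSet (A i)) →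
    (Pairwise fun i j => Disjoint (A i) (A j)) →
    iIndepFun (fun i ω => (X ω ∩ A i).encard) P

/-- The processes `S` and the random set `X` (through its counts) are independent. -/
def IndepOfProcess {Ω : Type*} [MeasurableSpace Ω] (S : ℝ≥0 → Ω → ℝ) (X : Ω → Set ℝ)
    (P : Measure Ω) : Prop :=
  IndepFun (fun ω (t : ℝ≥0) => S t ω)
    (fun ω (A : {A : Set ℝ // MeasurableSet A}) => (X ω ∩ A.1).encard) P

/-- The closed range in `[0, 1]` of the multiplicative subordinator `1 - exp (-S_t)`. -/
def multiplicativeRange {Ω : Type*} (S : ℝ≥0 → Ω → ℝ) (ω : Ω) : Set ℝ :=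
  closure (Set.range fun t : ℝ≥0 => 1 - Real.exp (-S t ω))

/-- Two sample points belong to the same block iff they coincide or are not separated by `R`,
that is, no point of `R` lies in the closed interval between them. -/
def blockSetoid (R : Set ℝ) : Setoid ℝ where
  r x y := x = y ∨ Disjoint (Set.uIcc x y) R
  iseqv :=
    { refl := fun _ => Or.inl rfl
      symm := by
        rintro x y (h | h)
        · exact Or.inl h.symm
        · exact Or.inr (by rwa [Set.uIcc_comm])
      trans := by
        rintro x y z (rfl | h) (rfl | h')
        · exact Or.inl rfl
        · exact Or.inr h'
        · exact Or.inr h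
        · exact Or.inr ((h.union_left h').mono_left Set.uIcc_subset_uIcc_union_uIcc) }

/-- The number of blocks into which the sample `X` is separated by `R`. -/
def blockCount (R X : Set ℝ) : ℕ :=
  ((Quotient.mk (blockSetoid R)) '' X).ncard

/-- The length of the composition derived from the sample `X` by separating its points by the
range of the multiplicative subordinator. -/
def compositionLength {Ω : Type*} (S : ℝ≥0 → Ω → ℝ) (X : Ω → Set ℝ) (ω : Ω) : ℕ :=
  blockCount (multiplicativeRange S ω) (X ω)

/-- The `m`-th factorial moment `E K (K - 1) ⋯ (K - m + 1)` of an `ℕ`-valued random variable. -/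
def factorialMoment {Ω : Type*} [MeasurableSpace Ω] (K : Ω → ℕ) (m : ℕ) (P : Measure Ω) : ℝ :=
  ∫ ω, ((K ω).descFactorial m : ℝ) ∂P

/-- The integrand of `ℓ*`. -/
def starIntegrand (ℓ : ℝ → ℝ) (t y : ℝ) : ℝ := Real.exp (-1 / y) / y * ℓ (t * y)

/-- `ℓ*(t) = ∫₀^∞ e^{-1/y} y⁻¹ ℓ(t y) dy`. -/
def slowStar (ℓ : ℝ → ℝ) (t : ℝ) : ℝ := ∫ y in Set.Ioi (0 : ℝ), starIntegrand ℓ t y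

end RegenerativeComposition

end

open RegenerativeComposition

noncomputable section

/-! The mechanism is self-similar renewal. Once `S` has moved by `y`, the rest of the range is a
copy of the whole range shrunk by `e^{-y}`, so the rest of the sample looks like a sample of
intensity `ρ e^{-y}`. Let `F_m(ρ) = f^{(m)}(ρ) / m!` be the binomial moments, `ψ(ρ) = ∫ (1 - e^{-ρ(1
- e^{-y})}) ν(dy)` the rate at which occupied gaps appear, and `U G (ρ) = ∫₀^∞ E G(ρ e^{-S_t}) dt`
the potential operator. Splitting according to the leftmost of `m + 1` chosen occupied gaps shows
that `F_{m+1}` is asymptotically `U(ψ F_m)`. Powers are eigenfunctions, `U z^β = z^β / Φ(β)`, and a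
regularly varying function of index `β` behaves like a power under `U`. Hence `F_{m+1} ~ ψ F_m /
Φ(α(m+1))`, and `F_m ~ ψ^m ∏ 1 / Φ(αj)`. It remains to know that `ψ(ρ) ~ Γ(1-α) ρ^α ℓ(ρ)` for `α <
1` and `ψ(ρ) ~ ρ ℓ*(ρ)` for `α = 1`.

The splitting is done in discrete time, which needs neither the jump structure of the paths nor a
compensation formula. At the times `kh` the subordinator is a random walk; the binomial moments of
the number of its intervals hit by the sample satisfy an exact renewal equation (`walkMoment_succ`),
solved by a series (`IsSubordinator.walkMoment_eq_tsum`). As `h → 0` the series is squeezed between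
two potentials (`IsSubordinator.walkMoment_le_potential`, `IsSubordinator.potential_le_walkMoment`),
and the discrete counts converge to the number of blocks (`IsSubordinator.tendsto_walkMoment`). That
convergence requires that no sample point lies in the closed range (`IsSubordinator.ae_disjoint`),
which rests on `ψ(r)/r → 0`, the absence of drift.

The asymptotics of `U` come from dominated convergence with a Potter bound
(`IsSubordinator.tendsto_potential_div`). Those of `ψ` come from writing it as `r` times the Laplace
transform of a tail: an Abelian comparison (`tendsto_laplaceOn_div`) gives regular variation for
every `α` and the case `α = 1`, and a rescaling gives the Gamma constant for `α < 1`. -/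

namespace RegenerativeComposition

/-! ### Hit probabilities and the rate `ψ`. -/

/-- The probability that a Poisson variable with mean `x` does not vanish. -/
def hitProb (x : ℝ) : ℝ≥0∞ := ENNReal.ofReal (1 - Real.exp (-x))

theorem measurable_hitProb : Measurable hitProb := by
  unfold hitProb; fun_prop

theorem hitProb_le (x : ℝ) : hitProb x ≤ ENNReal.ofReal x :=
  ENNReal.ofReal_le_ofReal (by linarith [Real.add_one_le_exp (-x)])

theorem hitProb_le_one (x : ℝ) : hitProb x ≤ 1 := by
  rw [hitProb, ← ENNReal.ofReal_one]
  exact ENNReal.ofReal_le_ofReal (by linarith [Real.exp_pos (-x)])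

theorem hitProb_mono : Monotone hitProb := fun x y h =>
  ENNReal.ofReal_le_ofReal (by linarith [Real.exp_le_exp.2 (neg_le_neg h)])

/-- For negative `c` the truncation in `ENNReal.ofReal` makes the function vanish, so monotonicity
of `psi` needs no sign condition on the measure. -/
theorem hitProb_mul_mono (c : ℝ) : MonotoneOn (fun r => hitProb (r * c)) (Set.Ici 0) := by
  intro r hr s hs hrs
  rcases le_total 0 c with hc | hc
  · exact hitProb_mono (by gcongr)
  · have : hitProb (r * c) = 0 := by
      rw [hitProb, ENNReal.ofReal_eq_zero]
      have : 0 ≤ -(r * c) := by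
        have := mul_nonneg hr (neg_nonneg.2 hc)
        linarith
      linarith [Real.one_le_exp this]
    simp [this]

/-- The expected number of blocks per unit of local time, `∫ (1 - e^{-r (1 - e^{-y})}) κ(dy)`. -/
def psi (κ : Measure ℝ) (r : ℝ) : ℝ≥0∞ := ∫⁻ y, hitProb (r * (1 - Real.exp (-y))) ∂κ

theorem psi_monotoneOn (κ : Measure ℝ) : MonotoneOn (psi κ) (Set.Ici 0) := by
  intro r hr s hs hrs
  exact lintegral_mono fun y => hitProb_mul_mono _ hr hs hrs

/-- If `N` is Poisson with mean `r`, then `e^{-r(1 - e^{-y})} = E e^{-N y}`. Averaging over `N`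
reduces `psi` to the Laplace exponent at integers: `ψ(r) = E Φ(N)`. -/
theorem hitProb_eq_tsum {r y : ℝ} (hr : 0 ≤ r) (hy : 0 ≤ y) :
    hitProb (r * (1 - Real.exp (-y))) =
      ∑' n : ℕ, ENNReal.ofReal (Real.exp (-r) * r ^ n / n.factorial) *
        ENNReal.ofReal (1 - Real.exp (-(n * y))) := by
  have h1 : ∀ x : ℝ, HasSum (fun n : ℕ => x ^ n / n.factorial) (Real.exp x) := by
    intro x
    rw [Real.exp_eq_exp_ℝ]
    exact NormedSpace.expSeries_div_hasSum_exp x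
  have h2 : HasSum (fun n : ℕ => Real.exp (-r) * r ^ n / n.factorial *
      (1 - Real.exp (-(n * y)))) (1 - Real.exp (-(r * (1 - Real.exp (-y))))) := by
    have := (((h1 r).sub (h1 (r * Real.exp (-y)))).mul_left (Real.exp (-r)))
    convert! this using 1
    · ext n
      rw [mul_pow, ← Real.exp_nat_mul]
      ring_nf
    · rw [mul_sub (Real.exp (-r)), ← Real.exp_add, ← Real.exp_add]
      simp only [neg_add_cancel, Real.exp_zero]
      ring_nf
  have hnn : ∀ n : ℕ, 0 ≤ Real.exp (-r) * r ^ n / n.factorial := fun n => by positivity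
  have hnn' : ∀ n : ℕ, 0 ≤ 1 - Real.exp (-(n * y)) := fun n => by
    have : Real.exp (-(n * y)) ≤ 1 := Real.exp_le_one_iff.2 (by
      have : 0 ≤ (n : ℝ) * y := by positivity
      linarith)
    linarith
  rw [hitProb, ← h2.tsum_eq, ENNReal.ofReal_tsum_of_nonneg
    (fun n => mul_nonneg (hnn n) (hnn' n)) h2.summable]
  exact tsum_congr fun n => ENNReal.ofReal_mul (hnn n)

theorem psi_eq_tsum {κ : Measure ℝ} (hκ : ∀ᵐ y ∂κ, 0 ≤ y) {r : ℝ} (hr : 0 ≤ r) :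
    psi κ r = ∑' n : ℕ, ENNReal.ofReal (Real.exp (-r) * r ^ n / n.factorial) *
      ∫⁻ y, ENNReal.ofReal (1 - Real.exp (-(n * y))) ∂κ := by
  rw [psi, lintegral_congr_ae (hκ.mono fun y hy => hitProb_eq_tsum hr hy),
    lintegral_tsum (fun n => by fun_prop)]
  exact tsum_congr fun n => lintegral_const_mul _ (by fun_prop)

/-! ### The Laplace exponent and `ψ` of a Lévy measure. -/

section Levy

variable {ν : Measure ℝ}

theorem IsLevyMeasure.ae_pos (hν : IsLevyMeasure ν) : ∀ᵐ y ∂ν, 0 < y := by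
  have := hν.nonpos_null
  rw [ae_iff]
  simpa [Set.Iic] using this

theorem IsLevyMeasure.integrable_min (hν : IsLevyMeasure ν) :
    Integrable (fun y => min 1 y) ν := by
  refine ⟨by fun_prop, ?_⟩
  rw [hasFiniteIntegral_iff_ofReal (hν.ae_pos.mono fun y hy => by
    simp only [Pi.zero_apply]; positivity)]
  exact hν.lintegral_min_lt_top

theorem one_sub_exp_nonneg {x : ℝ} (hx : 0 ≤ x) : 0 ≤ 1 - Real.exp (-x) := by
  have : Real.exp (-x) ≤ 1 := Real.exp_le_one_iff.2 (by linarith)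
  linarith

theorem IsLevyMeasure.integrable_one_sub_exp (hν : IsLevyMeasure ν) {s : ℝ} (hs : 0 ≤ s) :
    Integrable (fun y => 1 - Real.exp (-(s * y))) ν := by
  refine (hν.integrable_min.const_mul (max 1 s)).mono' (by fun_prop) ?_
  filter_upwards [hν.ae_pos] with y hy
  rw [Real.norm_of_nonneg (one_sub_exp_nonneg (by positivity))]
  rcases le_total 1 y with h | h
  · rw [min_eq_left h]
    nlinarith [Real.exp_pos (-(s * y)), le_max_left 1 s]
  · rw [min_eq_right h]
    have := Real.add_one_le_exp (-(s * y))
    nlinarith [le_max_right 1 s]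

theorem IsLevyMeasure.laplaceExponent_nonneg (hν : IsLevyMeasure ν) {s : ℝ} (hs : 0 ≤ s) :
    0 ≤ laplaceExponent ν s :=
  integral_nonneg_of_ae (hν.ae_pos.mono fun _ hy => one_sub_exp_nonneg (mul_nonneg hs hy.le))

theorem IsLevyMeasure.lintegral_one_sub_exp (hν : IsLevyMeasure ν) {s : ℝ} (hs : 0 ≤ s) :
    ∫⁻ y, ENNReal.ofReal (1 - Real.exp (-(s * y))) ∂ν = ENNReal.ofReal (laplaceExponent ν s) :=
  (ofReal_integral_eq_lintegral_ofReal (hν.integrable_one_sub_exp hs)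
    (hν.ae_pos.mono fun _ hy => one_sub_exp_nonneg (mul_nonneg hs hy.le))).symm

theorem IsLevyMeasure.laplaceExponent_pos (hν : IsLevyMeasure ν) (h0 : ν ≠ 0) {s : ℝ}
    (hs : 0 < s) : 0 < laplaceExponent ν s := by
  have hnn : 0 ≤ᵐ[ν] fun y => 1 - Real.exp (-(s * y)) :=
    hν.ae_pos.mono fun _ hy => one_sub_exp_nonneg (mul_nonneg hs.le hy.le)
  refine lt_of_le_of_ne (hν.laplaceExponent_nonneg hs.le) fun h => h0 ?_
  have h1 := (integral_eq_zero_iff_of_nonneg_ae hnn (hν.integrable_one_sub_exp hs.le)).1 h.symm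
  have : ∀ᵐ y ∂ν, False := by
    filter_upwards [h1, hν.ae_pos] with y hy hy0
    have : Real.exp (-(s * y)) < 1 := Real.exp_lt_one_iff.2 (by
      have := mul_pos hs hy0
      linarith)
    simp only [Pi.zero_apply] at hy
    linarith
  simpa using this

theorem IsLevyMeasure.psi_le (hν : IsLevyMeasure ν) {r : ℝ} (hr : 0 ≤ r) :
    psi ν r ≤ ENNReal.ofReal (r * laplaceExponent ν 1) := by
  rw [ENNReal.ofReal_mul hr, ← hν.lintegral_one_sub_exp zero_le_one,
    ← lintegral_const_mul _ (by fun_prop)]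
  refine lintegral_mono fun y => (hitProb_le _).trans_eq ?_
  rw [ENNReal.ofReal_mul hr, one_mul]

theorem IsLevyMeasure.psi_ne_top (hν : IsLevyMeasure ν) {r : ℝ} (hr : 0 ≤ r) : psi ν r ≠ ∞ :=
  ((hν.psi_le hr).trans_lt ENNReal.ofReal_lt_top).ne

/-- The integrand divided by `r` is at most `1 / r`, and it is dominated by the `ν`-integrable `1 -
e^{-y}`. A drift would have contributed a linear term. -/
theorem IsLevyMeasure.tendsto_psi_div (hν : IsLevyMeasure ν) :
    Tendsto (fun r => psi ν r / ENNReal.ofReal r) atTop (𝓝 0) := by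
  have : ∀ᶠ r : ℝ in atTop, ∫⁻ y, hitProb (r * (1 - Real.exp (-y))) / ENNReal.ofReal r ∂ν =
      psi ν r / ENNReal.ofReal r := by
    refine Eventually.of_forall fun r => ?_
    simp_rw [psi, div_eq_mul_inv]
    exact lintegral_mul_const _ (measurable_hitProb.comp (by fun_prop))
  refine Tendsto.congr' this ?_
  rw [← lintegral_zero (μ := ν)]
  refine tendsto_lintegral_filter_of_dominated_convergence
    (fun y => ENNReal.ofReal (1 - Real.exp (-(1 * y)))) ?_ ?_ ?_ ?_
  · refine Eventually.of_forall fun r => ?_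
    exact (measurable_hitProb.comp (by fun_prop)).div_const _
  · filter_upwards [eventually_gt_atTop 0] with r hr
    refine Eventually.of_forall fun y => ?_
    rw [ENNReal.div_le_iff (by simpa using hr) ENNReal.ofReal_ne_top, one_mul,
      mul_comm (ENNReal.ofReal _), ← ENNReal.ofReal_mul hr.le]
    exact hitProb_le _
  · rw [hν.lintegral_one_sub_exp zero_le_one]
    exact ENNReal.ofReal_ne_top
  · refine Eventually.of_forall fun y => ?_
    have h0 : Tendsto (fun r : ℝ => (1 : ℝ≥0∞) / ENNReal.ofReal r) atTop (𝓝 0) := by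
      simpa using tendsto_inv_iff.2 ENNReal.tendsto_ofReal_atTop
    refine tendsto_of_tendsto_of_tendsto_of_le_of_le tendsto_const_nhds h0
      (fun _ => zero_le) fun r => ENNReal.div_le_div_right (hitProb_le_one _) _

end Levy

/-! ### Laws of the increments of a subordinator as the time step shrinks. -/

section Subordinator

variable {Ω : Type*} [MeasurableSpace Ω] {P : Measure Ω} {ν : Measure ℝ} {S : ℝ≥0 → Ω → ℝ}

theorem IsSubordinator.ae_nonneg (hS : IsSubordinator S ν P) : ∀ᵐ ω ∂P, ∀ t, 0 ≤ S t ω := by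
  filter_upwards [hS.zero, hS.monotone] with ω h0 hm t
  rw [← h0]
  exact hm (zero_le)

theorem IsSubordinator.integrable_exp [IsProbabilityMeasure P] (hS : IsSubordinator S ν P) (t : ℝ≥0) {s : ℝ}
    (hs : 0 ≤ s) : Integrable (fun ω => Real.exp (-(s * S t ω))) P := by
  have := hS.measurable t
  refine (integrable_const (1 : ℝ)).mono' (by fun_prop) ?_
  filter_upwards [hS.ae_nonneg] with ω h
  rw [Real.norm_of_nonneg (Real.exp_pos _).le]
  exact Real.exp_le_one_iff.2 (by have := mul_nonneg hs (h t); linarith)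

theorem IsSubordinator.lintegral_exp [IsProbabilityMeasure P] (hS : IsSubordinator S ν P) (t : ℝ≥0) {s : ℝ}
    (hs : 0 ≤ s) : ∫⁻ ω, ENNReal.ofReal (Real.exp (-(s * S t ω))) ∂P =
      ENNReal.ofReal (Real.exp (-(t * laplaceExponent ν s))) := by
  rw [← hS.laplace t s hs, ofReal_integral_eq_lintegral_ofReal (hS.integrable_exp t hs)
    (Eventually.of_forall fun _ => (Real.exp_pos _).le)]

/-- The law of an increment of the subordinator over a time interval of length `h`. -/
abbrev stepLaw (S : ℝ≥0 → Ω → ℝ) (P : Measure Ω) (h : ℝ≥0) : Measure ℝ := P.map (S h)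

theorem IsSubordinator.stepLaw_nonneg (hS : IsSubordinator S ν P) (h : ℝ≥0) :
    ∀ᵐ y ∂stepLaw S P h, 0 ≤ y := by
  rw [stepLaw, ae_map_iff (hS.measurable h).aemeasurable measurableSet_Ici]
  exact hS.ae_nonneg.mono fun ω h' => h' h

variable [IsProbabilityMeasure P]

theorem IsSubordinator.lintegral_one_sub_exp (hS : IsSubordinator S ν P) (h : ℝ≥0) {s : ℝ}
    (hs : 0 ≤ s) : ∫⁻ y, ENNReal.ofReal (1 - Real.exp (-(s * y))) ∂stepLaw S P h =
      ENNReal.ofReal (1 - Real.exp (-(h * laplaceExponent ν s))) := by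
  have hm := hS.measurable h
  have hi : Integrable (fun ω => 1 - Real.exp (-(s * S h ω))) P :=
    (integrable_const _).sub (hS.integrable_exp h hs)
  rw [stepLaw, lintegral_map (by fun_prop) hm, ← ofReal_integral_eq_lintegral_ofReal
    hi (hS.ae_nonneg.mono fun ω h' =>
      one_sub_exp_nonneg (mul_nonneg hs (h' h))),
    integral_sub (integrable_const _) (hS.integrable_exp h hs), hS.laplace h s hs]
  simp

theorem IsSubordinator.psi_stepLaw_le (hS : IsSubordinator S ν P) (h : ℝ≥0) {r : ℝ}
    (hr : 0 ≤ r) :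
    psi (stepLaw S P h) r ≤ h * ENNReal.ofReal (r * laplaceExponent ν 1) := by
  have h1 : psi (stepLaw S P h) r ≤ ENNReal.ofReal r *
      ∫⁻ y, ENNReal.ofReal (1 - Real.exp (-(1 * y))) ∂stepLaw S P h := by
    rw [← lintegral_const_mul _ (by fun_prop)]
    refine lintegral_mono fun y => (hitProb_le _).trans_eq ?_
    rw [ENNReal.ofReal_mul hr, one_mul]
  refine h1.trans ?_
  rw [hS.lintegral_one_sub_exp h zero_le_one, ← ENNReal.ofReal_mul hr,
    ← ENNReal.ofReal_coe_nnreal (p := h), ← ENNReal.ofReal_mul h.coe_nonneg]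
  refine ENNReal.ofReal_le_ofReal ?_
  have := Real.add_one_le_exp (-(h * laplaceExponent ν 1))
  nlinarith

theorem tendsto_one_sub_exp_div (c : ℝ) :
    Tendsto (fun h : ℝ => (1 - Real.exp (-(h * c))) / h) (𝓝[>] 0) (𝓝 c) := by
  have h1 : HasDerivAt (fun h : ℝ => 1 - Real.exp (-(h * c))) c 0 := by
    have : HasDerivAt (fun h : ℝ => 1 - Real.exp (-(h * c)))
        (-(Real.exp (-(0 * c)) * -(1 * c))) 0 :=
      ((((hasDerivAt_id (0 : ℝ)).mul_const c).neg).exp).const_sub 1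
    simpa using this
  have h2 := (hasDerivAt_iff_tendsto_slope.1 h1).mono_left
    (nhdsWithin_mono 0 (fun x hx => ne_of_gt hx : Set.Ioi (0:ℝ) ⊆ {0}ᶜ))
  refine h2.congr fun h => ?_
  simp [slope_def_field]

/-- Stands in for the convergence of `h⁻¹ P(S_h ∈ ·)` to `ν`. By `psi_eq_tsum` both sides are
averages with the same Poisson weights, of `(1 - e^{-hΦ(k)}) / h` and of `Φ(k)`; the former tends to
the latter and is bounded by it. -/
theorem IsSubordinator.tendsto_psi_stepLaw (hS : IsSubordinator S ν P) {u : ℕ → ℝ≥0}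
    (hu : ∀ n, 0 < u n) (hu0 : Tendsto u atTop (𝓝 0)) {r : ℝ} (hr : 0 ≤ r) :
    Tendsto (fun n => psi (stepLaw S P (u n)) r / u n) atTop (𝓝 (psi ν r)) := by
  have hν := hS.levy
  set Φ := laplaceExponent ν
  have hΦ : ∀ n : ℕ, 0 ≤ Φ n := fun n => hν.laplaceExponent_nonneg n.cast_nonneg
  set w : ℕ → ℝ≥0∞ := fun k => ENNReal.ofReal (Real.exp (-r) * r ^ k / k.factorial)
  have e1 : ∀ n, psi (stepLaw S P (u n)) r / u n =
      ∫⁻ k : ℕ, w k * ENNReal.ofReal ((1 - Real.exp (-(u n * Φ k))) / u n) ∂Measure.count := by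
    intro n
    have hun : (u n : ℝ≥0∞) ≠ 0 := by simpa using (hu n).ne'
    rw [psi_eq_tsum (hS.stepLaw_nonneg _) hr, lintegral_count, div_eq_mul_inv,
      ← ENNReal.tsum_mul_right]
    refine tsum_congr fun k => ?_
    rw [hS.lintegral_one_sub_exp _ k.cast_nonneg,
      ENNReal.ofReal_div_of_pos (NNReal.coe_pos.2 (hu n)),
      ENNReal.ofReal_coe_nnreal, ← div_eq_mul_inv, mul_div_assoc]
  have e2 : psi ν r = ∫⁻ k : ℕ, w k * ENNReal.ofReal (Φ k) ∂Measure.count := by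
    rw [psi_eq_tsum (hν.ae_pos.mono fun _ h => h.le) hr, lintegral_count]
    exact tsum_congr fun k => by rw [hν.lintegral_one_sub_exp k.cast_nonneg]
  simp_rw [e1]
  rw [e2]
  refine tendsto_lintegral_of_dominated_convergence (fun k : ℕ => w k * ENNReal.ofReal (Φ k))
    (fun n => measurable_of_countable _) ?_ ?_ ?_
  · intro n
    refine Eventually.of_forall fun k => ?_
    refine mul_le_mul_right (ENNReal.ofReal_le_ofReal ?_) _
    have hun : (0 : ℝ) < u n := by simpa using hu n
    rw [div_le_iff₀ hun]
    nlinarith [Real.add_one_le_exp (-(u n * Φ k))]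
  · rw [← e2]
    exact hν.psi_ne_top hr
  · refine Eventually.of_forall fun k => ?_
    refine ENNReal.Tendsto.const_mul ?_ (Or.inr ENNReal.ofReal_ne_top)
    refine ENNReal.tendsto_ofReal ((tendsto_one_sub_exp_div (Φ k)).comp ?_)
    refine tendsto_nhdsWithin_iff.2 ⟨?_, Eventually.of_forall fun n => by simpa using hu n⟩
    exact (NNReal.tendsto_coe.2 hu0).congr fun n => rfl

/-- The infimum over `n` of `e^{-S_n}` has mean at most `e^{-nΦ(1)}` for every `n`, so it vanishes
almost surely; monotone paths then tend to infinity. -/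
theorem IsSubordinator.tendsto_atTop (hS : IsSubordinator S ν P) (h0 : ν ≠ 0) :
    ∀ᵐ ω ∂P, Tendsto (fun t => S t ω) atTop atTop := by
  have hc : 0 < laplaceExponent ν 1 := hS.levy.laplaceExponent_pos h0 one_pos
  have hT : Tendsto (fun n : ℕ => ENNReal.ofReal
      (Real.exp (-(((n : ℝ≥0) : ℝ) * laplaceExponent ν 1)))) atTop (𝓝 0) := by
    rw [← ENNReal.ofReal_zero]
    refine ENNReal.tendsto_ofReal (Real.tendsto_exp_neg_atTop_nhds_zero.comp ?_)
    simp only [NNReal.coe_natCast]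
    exact tendsto_natCast_atTop_atTop.atTop_mul_const hc
  have hZ : ∫⁻ ω, ⨅ n : ℕ, ENNReal.ofReal (Real.exp (-(1 * S n ω))) ∂P = 0 := by
    refine le_antisymm (ge_of_tendsto' hT fun n => ?_) zero_le
    rw [← hS.lintegral_exp n zero_le_one]
    exact lintegral_mono fun ω => iInf_le _ n
  have hmeas : Measurable fun ω => ⨅ n : ℕ, ENNReal.ofReal (Real.exp (-(1 * S n ω))) := by
    refine Measurable.iInf fun n => ?_
    have := hS.measurable (n : ℝ≥0)
    fun_prop
  filter_upwards [(lintegral_eq_zero_iff hmeas).1 hZ, hS.monotone] with ω hω hm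
  refine tendsto_atTop_atTop_of_monotone hm fun b => ?_
  have : ⨅ n : ℕ, ENNReal.ofReal (Real.exp (-(1 * S n ω))) < ENNReal.ofReal (Real.exp (-b)) := by
    simp only [Pi.zero_apply] at hω
    rw [hω]
    simpa using Real.exp_pos (-b)
  obtain ⟨n, hn⟩ := iInf_lt_iff.1 this
  refine ⟨n, ?_⟩
  have := (ENNReal.ofReal_lt_ofReal_iff (Real.exp_pos _)).1 hn
  rw [Real.exp_lt_exp] at this
  linarith

end Subordinator

/-! ### First-step and last-step recursions for a multiplicative random walk. -/

section Operators

/-- One step of a multiplicative random walk with step law `μ`. -/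
def stepOp (μ : Measure ℝ) (G : ℝ → ℝ≥0∞) (r : ℝ) : ℝ≥0∞ := ∫⁻ y, G (r * Real.exp (-y)) ∂μ

/-- One step of a multiplicative random walk, on the event that the interval it jumps over
is hit. -/
def hitOp (μ : Measure ℝ) (G : ℝ → ℝ≥0∞) (r : ℝ) : ℝ≥0∞ :=
  ∫⁻ y, hitProb (r * (1 - Real.exp (-y))) * G (r * Real.exp (-y)) ∂μ

/-- The `m`-th binomial moment of the number of intervals that are hit during the first `M` steps
of a multiplicative random walk, weighted with `G` at its final position. -/
def chainMoment (μ : Measure ℝ) (G : ℝ → ℝ≥0∞) : ℕ → ℕ → ℝ → ℝ≥0∞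
  | 0, 0 => G
  | 0, M + 1 => stepOp μ (chainMoment μ G 0 M)
  | _ + 1, 0 => 0
  | m + 1, M + 1 => stepOp μ (chainMoment μ G (m + 1) M) + hitOp μ (chainMoment μ G m M)

variable {μ : Measure ℝ}

theorem chainMoment_zero_succ (G : ℝ → ℝ≥0∞) (M : ℕ) :
    chainMoment μ G 0 (M + 1) = stepOp μ (chainMoment μ G 0 M) := rfl

theorem chainMoment_succ_succ (G : ℝ → ℝ≥0∞) (m M : ℕ) : chainMoment μ G (m + 1) (M + 1) =
    stepOp μ (chainMoment μ G (m + 1) M) + hitOp μ (chainMoment μ G m M) := rfl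

theorem stepOp_zero : stepOp μ 0 = 0 := by ext r; simp [stepOp]

theorem hitOp_zero : hitOp μ 0 = 0 := by ext r; simp [hitOp]

theorem stepOp_add {G : ℝ → ℝ≥0∞} (hG : Measurable G) (H : ℝ → ℝ≥0∞) :
    stepOp μ (G + H) = stepOp μ G + stepOp μ H := by
  ext r
  exact lintegral_add_left (hG.comp (by fun_prop)) _

theorem hitOp_add {G : ℝ → ℝ≥0∞} (hG : Measurable G) (H : ℝ → ℝ≥0∞) :
    hitOp μ (G + H) = hitOp μ G + hitOp μ H := by
  ext r
  simp only [hitOp, Pi.add_apply, mul_add]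
  exact lintegral_add_left
    ((measurable_hitProb.comp (by fun_prop)).mul (hG.comp (by fun_prop))) _

theorem measurable_stepOp [SFinite μ] {G : ℝ → ℝ≥0∞} (hG : Measurable G) :
    Measurable (stepOp μ G) := by
  refine Measurable.lintegral_prod_right (f := fun r y : ℝ => G (r * Real.exp (-y))) ?_
  exact hG.comp (by fun_prop)

theorem measurable_hitOp [SFinite μ] {G : ℝ → ℝ≥0∞} (hG : Measurable G) :
    Measurable (hitOp μ G) := by
  refine Measurable.lintegral_prod_right (f := fun r y : ℝ =>
    hitProb (r * (1 - Real.exp (-y))) * G (r * Real.exp (-y))) ?_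
  exact (measurable_hitProb.comp (by fun_prop)).mul (hG.comp (by fun_prop))

theorem measurable_chainMoment [SFinite μ] {G : ℝ → ℝ≥0∞} (hG : Measurable G) (m M : ℕ) :
    Measurable (chainMoment μ G m M) := by
  induction M generalizing m with
  | zero => cases m with
    | zero => simpa [chainMoment] using hG
    | succ m => exact measurable_const
  | succ M ih => cases m with
    | zero => simpa [chainMoment] using measurable_stepOp (ih 0)
    | succ m =>
      simpa [chainMoment] using (measurable_stepOp (ih (m + 1))).add (measurable_hitOp (ih m))

theorem chainMoment_zero_succ_last (G : ℝ → ℝ≥0∞) (M : ℕ) :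
    chainMoment μ G 0 (M + 1) = chainMoment μ (stepOp μ G) 0 M := by
  induction M with
  | zero => rfl
  | succ M ih => rw [chainMoment, ih, chainMoment]

/-- The definition peels off the first step, which is the form of the renewal equation; the
identification with expectations peels off the last one. The terminal weight `G` is what lets the
last step be absorbed. -/
theorem chainMoment_succ_last [SFinite μ] {G : ℝ → ℝ≥0∞} (hG : Measurable G) (m M : ℕ) :
    chainMoment μ G (m + 1) (M + 1) =
      chainMoment μ (stepOp μ G) (m + 1) M + chainMoment μ (hitOp μ G) m M := by
  induction M generalizing m with
  | zero => cases m with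
    | zero => simp [chainMoment, stepOp_zero]
    | succ m => simp [chainMoment, stepOp_zero, hitOp_zero]
  | succ M ih =>
    have h1 := measurable_chainMoment (μ := μ) (measurable_stepOp (μ := μ) hG)
    cases m with
    | zero =>
      rw [chainMoment_succ_succ, ih 0, chainMoment_zero_succ_last, stepOp_add (h1 _ _),
        chainMoment_succ_succ, chainMoment_zero_succ]
      abel
    | succ m =>
      rw [chainMoment_succ_succ, ih (m + 1), ih m, stepOp_add (h1 _ _), hitOp_add (h1 _ _),
        chainMoment_succ_succ, chainMoment_succ_succ]
      abel

end Operators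

/-! ### Hit intervals of a walk with independent increments. -/

section Walk

/-- The probability that the `k`-th interval of the multiplicative random walk with increments `x`
is hit. -/
def gapHit (r : ℝ) (x : ℕ → ℝ) (k : ℕ) : ℝ≥0∞ :=
  hitProb (r * (Real.exp (-∑ j ∈ Finset.range k, x j) -
    Real.exp (-∑ j ∈ Finset.range (k + 1), x j)))

/-- The `m`-th elementary symmetric polynomial in the first `M` terms of a sequence. -/
def esymmRange (p : ℕ → ℝ≥0∞) (m M : ℕ) : ℝ≥0∞ :=
  ∑ T ∈ (Finset.range M).powersetCard m, ∏ k ∈ T, p k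

theorem esymmRange_succ (p : ℕ → ℝ≥0∞) (m M : ℕ) :
    esymmRange p (m + 1) (M + 1) = esymmRange p (m + 1) M + p M * esymmRange p m M := by
  unfold esymmRange
  rw [Finset.range_add_one, Finset.powersetCard_succ_insert Finset.notMem_range_self,
    Finset.sum_union, Finset.sum_image, Finset.mul_sum]
  · congr 1
    refine Finset.sum_congr rfl fun T hT => ?_
    rw [Finset.prod_insert]
    exact fun h => Finset.notMem_range_self ((Finset.mem_powersetCard.1 hT).1 h)
  · intro S hS T hT h
    have hS' : M ∉ S := fun h' => Finset.notMem_range_self ((Finset.mem_powersetCard.1 hS).1 h')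
    have hT' : M ∉ T := fun h' => Finset.notMem_range_self ((Finset.mem_powersetCard.1 hT).1 h')
    rw [← Finset.erase_insert hS', ← Finset.erase_insert hT', h]
  · rw [Finset.disjoint_left]
    intro S hS hS'
    obtain ⟨T, -, rfl⟩ := Finset.mem_image.1 hS'
    exact Finset.notMem_range_self ((Finset.mem_powersetCard.1 hS).1 (Finset.mem_insert_self _ _))

theorem esymmRange_congr {p q : ℕ → ℝ≥0∞} {M : ℕ} (h : ∀ k < M, p k = q k) (m : ℕ) :
    esymmRange p m M = esymmRange q m M :=
  Finset.sum_congr rfl fun _ hT => Finset.prod_congr rfl fun k hk =>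
    h k (Finset.mem_range.1 ((Finset.mem_powersetCard.1 hT).1 hk))

theorem measurable_gapHit (r : ℝ) (k : ℕ) : Measurable fun x : ℕ → ℝ => gapHit r x k :=
  measurable_hitProb.comp (by fun_prop)

theorem measurable_esymmRange_gapHit (r : ℝ) (m M : ℕ) :
    Measurable fun x : ℕ → ℝ => esymmRange (gapHit r x) m M :=
  Finset.measurable_sum _ fun _ _ => Finset.measurable_prod _ fun k _ => measurable_gapHit r k

variable {Ω : Type*} [MeasurableSpace Ω] {P : Measure Ω}

theorem lintegral_indepFun [IsProbabilityMeasure P] {α β : Type*} [MeasurableSpace α] [MeasurableSpace β] {U : Ω → α}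
    {V : Ω → β} (hU : Measurable U) (hV : Measurable V) (h : IndepFun U V P)
    {f : α → β → ℝ≥0∞} (hf : Measurable (Function.uncurry f)) :
    ∫⁻ ω, f (U ω) (V ω) ∂P = ∫⁻ ω, ∫⁻ b, f (U ω) b ∂(P.map V) ∂P := by
  have : IsProbabilityMeasure (P.map V) := Measure.isProbabilityMeasure_map hV.aemeasurable
  have h1 := (indepFun_iff_map_prod_eq_prod_map_map hU.aemeasurable hV.aemeasurable).1 h
  have h2 := lintegral_map (μ := P) hf (hU.prodMk hV)
  simp only [Function.uncurry_apply_pair] at h2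
  rw [← h2, h1, lintegral_prod _ hf.aemeasurable,
    lintegral_map (Measurable.lintegral_prod_right' hf) hU]
  simp only [Function.uncurry_apply_pair]

theorem indepFun_of_depends_on_past {ξ : ℕ → Ω → ℝ} (hξ : ∀ k, Measurable (ξ k))
    (hind : iIndepFun ξ P) {α : Type*} [MeasurableSpace α] {F : (ℕ → ℝ) → α} (hF : Measurable F)
    {M : ℕ} (hdep : ∀ x y : ℕ → ℝ, (∀ j < M, x j = y j) → F x = F y) :
    IndepFun (fun ω => F fun k => ξ k ω) (ξ M) P := by
  have h := hind.indepFun_finset (Finset.range M) {M} (by simp) hξ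
  -- Padding by zeros: by `hdep` the coordinates from `M` on do not influence `F`.
  let ext : (Finset.range M → ℝ) → ℕ → ℝ := fun x j =>
    if hj : j ∈ Finset.range M then x ⟨j, hj⟩ else 0
  have hext : Measurable ext := by
    refine measurable_pi_lambda _ fun j => ?_
    by_cases hj : j ∈ Finset.range M
    · simp only [ext, dif_pos hj]
      exact measurable_pi_apply _
    · simp only [ext, dif_neg hj]
      exact measurable_const
  have h2 := h.comp (hF.comp hext) (measurable_pi_apply (⟨M, by simp⟩ : ({M} : Finset ℕ)))
  convert! h2 using 1
  ext ω
  exact hdep _ _ fun j hj => by simp [ext, hj]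

/-- The last increment is independent of the others. Integrating it out turns the weight `G` into
`stepOp μ G` when the last interval is not among the chosen ones, and into `hitOp μ G` when it is;
this is the recursion of `chainMoment_succ_last`. -/
theorem lintegral_esymmRange_gapHit [IsProbabilityMeasure P] {μ : Measure ℝ} [IsProbabilityMeasure μ] {ξ : ℕ → Ω → ℝ}
    (hξ : ∀ k, Measurable (ξ k)) (hind : iIndepFun ξ P) (hlaw : ∀ k, P.map (ξ k) = μ) (r : ℝ)
    (m M : ℕ) {G : ℝ → ℝ≥0∞} (hG : Measurable G) :
    ∫⁻ ω, esymmRange (gapHit r fun k => ξ k ω) m M *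
      G (r * Real.exp (-∑ j ∈ Finset.range M, ξ j ω)) ∂P = chainMoment μ G m M r := by
  -- The increment of index `M` is integrated out with the first `M` increments frozen.
  have key : ∀ (m M : ℕ) (H : ℝ → ℝ → ℝ≥0∞), Measurable (Function.uncurry H) →
      ∫⁻ ω, esymmRange (gapHit r fun k => ξ k ω) m M *
        H (r * Real.exp (-∑ j ∈ Finset.range M, ξ j ω)) (ξ M ω) ∂P =
      ∫⁻ ω, esymmRange (gapHit r fun k => ξ k ω) m M *
        ∫⁻ y, H (r * Real.exp (-∑ j ∈ Finset.range M, ξ j ω)) y ∂μ ∂P := by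
    intro m M H hH
    have hF : Measurable fun x : ℕ → ℝ =>
        (esymmRange (gapHit r x) m M, r * Real.exp (-∑ j ∈ Finset.range M, x j)) :=
      (measurable_esymmRange_gapHit r m M).prodMk (by fun_prop)
    have h1 := indepFun_of_depends_on_past hξ hind hF (M := M) (fun x y hxy => by
      have hs : ∀ k ≤ M, ∑ j ∈ Finset.range k, x j = ∑ j ∈ Finset.range k, y j := fun k hk =>
        Finset.sum_congr rfl fun j hj => hxy j ((Finset.mem_range.1 hj).trans_le hk)
      rw [hs M le_rfl, esymmRange_congr (q := gapHit r y)]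
      intro k hk
      rw [gapHit, gapHit, hs k hk.le, hs (k + 1) hk])
    have h2 := lintegral_indepFun (f := fun (u : ℝ≥0∞ × ℝ) y => u.1 * H u.2 y)
      (hF.comp (measurable_pi_lambda _ hξ)) (hξ M) h1
      (by
        refine (measurable_fst.comp measurable_fst).mul ?_
        exact hH.comp ((measurable_snd.comp measurable_fst).prodMk measurable_snd))
    rw [hlaw] at h2
    refine h2.trans (lintegral_congr fun ω => ?_)
    exact lintegral_const_mul _ (hH.comp measurable_prodMk_left)
  have hexp : ∀ (M : ℕ) ω, r * Real.exp (-∑ j ∈ Finset.range (M + 1), ξ j ω) =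
      r * Real.exp (-∑ j ∈ Finset.range M, ξ j ω) * Real.exp (-ξ M ω) := by
    intro M ω
    rw [Finset.sum_range_succ, neg_add, Real.exp_add, mul_assoc]
  have hgap : ∀ (M : ℕ) ω, gapHit r (fun k => ξ k ω) M =
      hitProb (r * Real.exp (-∑ j ∈ Finset.range M, ξ j ω) * (1 - Real.exp (-ξ M ω))) := by
    intro M ω
    rw [gapHit, mul_sub r, hexp, mul_sub, mul_one]
  have hes : ∀ m M, Measurable fun ω => esymmRange (gapHit r fun k => ξ k ω) m M := fun m M =>
    (measurable_esymmRange_gapHit r m M).comp (measurable_pi_lambda _ hξ)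
  have hGs : ∀ {G : ℝ → ℝ≥0∞}, Measurable G →
      Measurable (Function.uncurry fun r y : ℝ => G (r * Real.exp (-y))) := fun hG =>
    hG.comp (by fun_prop)
  have hGh : ∀ {G : ℝ → ℝ≥0∞}, Measurable G → Measurable (Function.uncurry fun r y : ℝ =>
      hitProb (r * (1 - Real.exp (-y))) * G (r * Real.exp (-y))) := fun hG =>
    (measurable_hitProb.comp (by fun_prop)).mul (hG.comp (by fun_prop))
  induction M generalizing m G with
  | zero => cases m with
    | zero => simp [chainMoment, esymmRange]
    | succ m =>
      have : (∅ : Finset ℕ).powersetCard (m + 1) = ∅ := Finset.powersetCard_eq_empty.2 (by simp)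
      simp [chainMoment, esymmRange, this]
  | succ M ih =>
    cases m with
    | zero =>
      rw [chainMoment_zero_succ_last, ← ih 0 (measurable_stepOp hG)]
      simp_rw [hexp]
      have := key 0 M _ (hGs hG)
      simpa [esymmRange, stepOp] using this
    | succ m =>
      rw [chainMoment_succ_last hG, Pi.add_apply, ← ih (m + 1) (measurable_stepOp hG),
        ← ih m (measurable_hitOp hG)]
      have e1 := key (m + 1) M _ (hGs hG)
      have e2 := key m M _ (hGh hG)
      unfold stepOp hitOp
      rw [← e1, ← e2, ← lintegral_add_left]
      · refine lintegral_congr fun ω => ?_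
        rw [esymmRange_succ, hexp, hgap]
        ring
      · refine (hes _ _).mul (hG.comp ?_)
        have := hξ
        fun_prop

end Walk

/-! ### The renewal equation for the binomial moments of a walk. -/

section WalkMoment

/-- The `m`-th binomial moment of the number of intervals of a multiplicative random walk that are
hit. -/
def walkMoment (μ : Measure ℝ) (m : ℕ) (r : ℝ) : ℝ≥0∞ := ⨆ M, chainMoment μ 1 m M r

variable {μ : Measure ℝ} [IsProbabilityMeasure μ]

theorem stepOp_one : stepOp μ 1 = 1 := by ext r; simp [stepOp]

omit [IsProbabilityMeasure μ] in
theorem stepOp_mono {G H : ℝ → ℝ≥0∞} (h : G ≤ H) : stepOp μ G ≤ stepOp μ H :=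
  fun _ => lintegral_mono fun _ => h _

omit [IsProbabilityMeasure μ] in
theorem hitOp_mono {G H : ℝ → ℝ≥0∞} (h : G ≤ H) : hitOp μ G ≤ hitOp μ H :=
  fun _ => lintegral_mono fun _ => mul_le_mul_right (h _) _

theorem chainMoment_one_zero (M : ℕ) : chainMoment μ 1 0 M = 1 := by
  induction M with
  | zero => rfl
  | succ M ih => rw [chainMoment_zero_succ, ih, stepOp_one]

theorem walkMoment_zero (r : ℝ) : walkMoment μ 0 r = 1 := by
  simp [walkMoment, chainMoment_one_zero]

theorem chainMoment_le_succ (m M : ℕ) : chainMoment μ 1 m M ≤ chainMoment μ 1 m (M + 1) := by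
  induction M generalizing m with
  | zero => cases m with
    | zero => simp [chainMoment_one_zero]
    | succ m => exact fun r => zero_le
  | succ M ih => cases m with
    | zero => simp [chainMoment_one_zero]
    | succ m =>
      rw [chainMoment_succ_succ, chainMoment_succ_succ]
      exact add_le_add (stepOp_mono (ih _)) (hitOp_mono (ih _))

theorem monotone_chainMoment (m : ℕ) : Monotone fun M => chainMoment μ 1 m M :=
  monotone_nat_of_le_succ (chainMoment_le_succ m)

theorem measurable_walkMoment (m : ℕ) : Measurable (walkMoment μ m) :=
  Measurable.iSup fun M => measurable_chainMoment measurable_one m M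

omit [IsProbabilityMeasure μ] in
theorem chainMoment_monotoneOn (m M : ℕ) :
    MonotoneOn (chainMoment μ 1 m M) (Set.Ici 0) := by
  have hmul : ∀ (y : ℝ) {r s : ℝ}, 0 ≤ r → r ≤ s →
      r * Real.exp (-y) ∈ Set.Ici (0 : ℝ) ∧ s * Real.exp (-y) ∈ Set.Ici (0 : ℝ) ∧
        r * Real.exp (-y) ≤ s * Real.exp (-y) := fun y r s hr hrs =>
    ⟨mul_nonneg hr (Real.exp_pos _).le, mul_nonneg (hr.trans hrs) (Real.exp_pos _).le, by gcongr⟩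
  induction M generalizing m with
  | zero => cases m with
    | zero => exact fun _ _ _ _ _ => le_rfl
    | succ m => exact fun _ _ _ _ _ => le_rfl
  | succ M ih => cases m with
    | zero =>
      intro r hr s hs hrs
      refine lintegral_mono fun y => ?_
      obtain ⟨h1, h2, h3⟩ := hmul y hr hrs
      exact ih 0 h1 h2 h3
    | succ m =>
      intro r hr s hs hrs
      refine add_le_add (lintegral_mono fun y => ?_) (lintegral_mono fun y => ?_)
      · obtain ⟨h1, h2, h3⟩ := hmul y hr hrs
        exact ih (m + 1) h1 h2 h3
      · obtain ⟨h1, h2, h3⟩ := hmul y hr hrs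
        exact mul_le_mul' (hitProb_mul_mono _ hr hs hrs) (ih m h1 h2 h3)

omit [IsProbabilityMeasure μ] in
theorem walkMoment_monotoneOn (m : ℕ) : MonotoneOn (walkMoment μ m) (Set.Ici 0) :=
  fun _ hr _ hs hrs => iSup_mono fun M => chainMoment_monotoneOn m M hr hs hrs

/-- With `z = r e^{-y}` the recursion gives `z^{m+1} + (r - z) z^m = r z^m ≤ r^{m+1}`. The point is
that the bound depends neither on the number of steps nor on the step law, hence not on the mesh. -/
theorem chainMoment_le_pow (hμ : ∀ᵐ y ∂μ, 0 ≤ y) (m M : ℕ) {r : ℝ} (hr : 0 ≤ r) :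
    chainMoment μ 1 m M r ≤ ENNReal.ofReal (r ^ m) := by
  induction M generalizing m r with
  | zero => cases m with
    | zero => simp [chainMoment]
    | succ m => exact zero_le
  | succ M ih => cases m with
    | zero => simp [chainMoment_one_zero]
    | succ m =>
      have hm : Measurable fun y => chainMoment μ 1 (m + 1) M (r * Real.exp (-y)) :=
        (measurable_chainMoment measurable_one _ _).comp (by fun_prop)
      rw [chainMoment_succ_succ, Pi.add_apply, stepOp, hitOp, ← lintegral_add_left hm]
      have h1 : ∫⁻ _, ENNReal.ofReal (r ^ (m + 1)) ∂μ = ENNReal.ofReal (r ^ (m + 1)) := by simp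
      rw [← h1]
      refine lintegral_mono_ae (hμ.mono fun y hy => ?_)
      have hz : 0 ≤ r * Real.exp (-y) := mul_nonneg hr (Real.exp_pos _).le
      have hz1 : Real.exp (-y) ≤ 1 := Real.exp_le_one_iff.2 (by linarith)
      have hd : 0 ≤ r * (1 - Real.exp (-y)) := mul_nonneg hr (by linarith)
      calc _ ≤ ENNReal.ofReal ((r * Real.exp (-y)) ^ (m + 1)) +
            ENNReal.ofReal (r * (1 - Real.exp (-y))) * ENNReal.ofReal ((r * Real.exp (-y)) ^ m) :=
            add_le_add (ih _ hz) (mul_le_mul' (hitProb_le _) (ih _ hz))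
        _ = ENNReal.ofReal ((r * Real.exp (-y)) ^ (m + 1) +
            r * (1 - Real.exp (-y)) * (r * Real.exp (-y)) ^ m) := by
            rw [← ENNReal.ofReal_mul hd, ← ENNReal.ofReal_add (by positivity) (by positivity)]
        _ ≤ _ := by
            refine ENNReal.ofReal_le_ofReal ?_
            have h2 : (r * Real.exp (-y)) ^ (m + 1) +
              r * (1 - Real.exp (-y)) * (r * Real.exp (-y)) ^ m =
                r * (r * Real.exp (-y)) ^ m := by ring
            rw [h2, pow_succ']
            gcongr
            exact mul_le_of_le_one_right hr hz1

theorem walkMoment_le_pow (hμ : ∀ᵐ y ∂μ, 0 ≤ y) (m : ℕ) {r : ℝ} (hr : 0 ≤ r) :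
    walkMoment μ m r ≤ ENNReal.ofReal (r ^ m) :=
  iSup_le fun M => chainMoment_le_pow hμ m M hr

/-- Either the first interval is not chosen, or it is hit and is the leftmost of the `m + 1` chosen
ones. Monotone convergence in the number of steps removes the horizon. -/
theorem walkMoment_succ (m : ℕ) (r : ℝ) : walkMoment μ (m + 1) r =
    stepOp μ (walkMoment μ (m + 1)) r + hitOp μ (walkMoment μ m) r := by
  have h1 : walkMoment μ (m + 1) r = ⨆ M, chainMoment μ 1 (m + 1) (M + 1) r :=
    (Monotone.iSup_nat_add (f := fun M => chainMoment μ 1 (m + 1) M r)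
      (fun a b hab => monotone_chainMoment _ hab r) 1).symm
  have hm := fun m M => measurable_chainMoment (μ := μ) measurable_one m M
  have h2 : stepOp μ (walkMoment μ (m + 1)) r = ⨆ M, stepOp μ (chainMoment μ 1 (m + 1) M) r :=
    lintegral_iSup (fun M => (hm _ M).comp (by fun_prop))
      fun a b hab y => monotone_chainMoment _ hab _
  have h3 : hitOp μ (walkMoment μ m) r = ⨆ M, hitOp μ (chainMoment μ 1 m M) r := by
    unfold hitOp walkMoment
    simp_rw [ENNReal.mul_iSup]
    exact lintegral_iSup
      (fun M => (measurable_hitProb.comp (by fun_prop)).mul ((hm _ M).comp (by fun_prop)))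
      fun a b hab y => mul_le_mul_right (monotone_chainMoment _ hab _) _
  rw [h1, h2, h3, ENNReal.iSup_add_iSup_of_monotone]
  · rfl
  · exact fun a b hab => stepOp_mono (monotone_chainMoment _ hab) r
  · exact fun a b hab => hitOp_mono (monotone_chainMoment _ hab) r

end WalkMoment

/-! ### The subordinator observed at the multiples of `h`. -/

section Skeleton

variable {Ω : Type*} [MeasurableSpace Ω] {P : Measure Ω} [IsProbabilityMeasure P]
  {ν : Measure ℝ} {S : ℝ≥0 → Ω → ℝ}

omit [IsProbabilityMeasure P] in
theorem IsSubordinator.ae_skeleton_eq_sum (hS : IsSubordinator S ν P) (h : ℝ≥0) :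
    ∀ᵐ ω ∂P, ∀ k : ℕ, S (k * h) ω =
      ∑ j ∈ Finset.range k, (S ((j + 1 : ℕ) * h) ω - S (j * h) ω) := by
  filter_upwards [hS.zero] with ω h0 k
  rw [Finset.sum_range_sub (fun j : ℕ => S (j * h) ω)]
  simp [h0]

omit [IsProbabilityMeasure P] in
theorem IsSubordinator.map_increment (hS : IsSubordinator S ν P) (h : ℝ≥0) (k : ℕ) :
    P.map (fun ω => S ((k + 1 : ℕ) * h) ω - S (k * h) ω) = stepLaw S P h := by
  have := (hS.stationary_increments (k * h) h).map_eq
  rw [stepLaw, ← this]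
  congr! 4
  push_cast
  ring

omit [IsProbabilityMeasure P] in
theorem IsSubordinator.iIndepFun_increments (hS : IsSubordinator S ν P) (h : ℝ≥0) :
    iIndepFun (fun (k : ℕ) ω => S ((k + 1 : ℕ) * h) ω - S (k * h) ω) P :=
  hS.indep_increments.nat (t := fun k : ℕ => k * h) fun a b hab => by
    dsimp only
    gcongr

/-- The probability, given the subordinator, that the `k`-th interval of its `h`-skeleton
is hit. -/
def skeletonHit (S : ℝ≥0 → Ω → ℝ) (h : ℝ≥0) (r : ℝ) (ω : Ω) (k : ℕ) : ℝ≥0∞ :=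
  hitProb (r * (Real.exp (-S (k * h) ω) - Real.exp (-S ((k + 1 : ℕ) * h) ω)))

theorem IsSubordinator.isProbabilityMeasure_stepLaw (hS : IsSubordinator S ν P) (h : ℝ≥0) :
    IsProbabilityMeasure (stepLaw S P h) :=
  Measure.isProbabilityMeasure_map (hS.measurable h).aemeasurable

theorem IsSubordinator.lintegral_esymmRange_skeletonHit (hS : IsSubordinator S ν P) (h : ℝ≥0)
    (r : ℝ) (m M : ℕ) :
    ∫⁻ ω, esymmRange (skeletonHit S h r ω) m M ∂P = chainMoment (stepLaw S P h) 1 m M r := by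
  have := hS.isProbabilityMeasure_stepLaw h
  rw [← lintegral_esymmRange_gapHit (fun k => (hS.measurable _).sub (hS.measurable _))
    (hS.iIndepFun_increments h) (hS.map_increment h) r m M measurable_one]
  refine lintegral_congr_ae ?_
  filter_upwards [hS.ae_skeleton_eq_sum h] with ω hω
  rw [Pi.one_apply, mul_one]
  refine esymmRange_congr (fun k _ => ?_) m
  rw [gapHit, skeletonHit, hω k, hω (k + 1)]
  rfl

theorem IsSubordinator.lintegral_skeleton_succ (hS : IsSubordinator S ν P) (h : ℝ≥0) (r : ℝ)
    (k : ℕ) {G : ℝ → ℝ≥0∞} (hG : Measurable G) :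
    ∫⁻ ω, G (r * Real.exp (-S ((k + 1 : ℕ) * h) ω)) ∂P =
      ∫⁻ ω, stepOp (stepLaw S P h) G (r * Real.exp (-S (k * h) ω)) ∂P := by
  have hle : (k : ℝ≥0) * h ≤ (k + 1 : ℕ) * h := by
    gcongr
    simp
  have h1 := hS.indep_increments.indepFun_eval_sub (zero_le (a := (k : ℝ≥0) * h)) hle hS.zero
  have h2 := lintegral_indepFun (f := fun s y => G (r * Real.exp (-s) * Real.exp (-y)))
    (hS.measurable _) ((hS.measurable _).sub (hS.measurable _)) h1 (hG.comp (by fun_prop))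
  have h3 : P.map (S ((k + 1 : ℕ) * h) - S (k * h)) = stepLaw S P h := hS.map_increment h k
  rw [h3] at h2
  refine Eq.trans (lintegral_congr fun ω => ?_) h2
  rw [mul_assoc, ← Real.exp_add, Pi.sub_apply]
  congr 3
  ring

/-- The renewal equation iterated `n` times: `k` is the index of the leftmost chosen interval, and
the last term covers the choices that avoid the first `n` intervals. -/
theorem IsSubordinator.walkMoment_eq_sum (hS : IsSubordinator S ν P) (h : ℝ≥0) (m : ℕ) (r : ℝ)
    (n : ℕ) :
    walkMoment (stepLaw S P h) (m + 1) r =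
      ∑ k ∈ Finset.range n, ∫⁻ ω, hitOp (stepLaw S P h) (walkMoment (stepLaw S P h) m)
        (r * Real.exp (-S (k * h) ω)) ∂P +
      ∫⁻ ω, walkMoment (stepLaw S P h) (m + 1) (r * Real.exp (-S (n * h) ω)) ∂P := by
  have := hS.isProbabilityMeasure_stepLaw h
  have hm := hS.measurable
  induction n with
  | zero =>
    have : ∀ᵐ ω ∂P, walkMoment (stepLaw S P h) (m + 1) (r * Real.exp (-S ((0 : ℕ) * h) ω)) =
        walkMoment (stepLaw S P h) (m + 1) r := by
      filter_upwards [hS.zero] with ω hω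
      simp [hω]
    rw [lintegral_congr_ae this]
    simp
  | succ n ih =>
    rw [ih, Finset.sum_range_succ, add_assoc]
    congr 1
    rw [hS.lintegral_skeleton_succ h r n (measurable_walkMoment _), ← lintegral_add_right]
    · refine lintegral_congr fun ω => ?_
      rw [walkMoment_succ, add_comm]
    · exact (measurable_stepOp (measurable_walkMoment _)).comp (by fun_prop)

/-- The remainder is at most `r^{m+1} E e^{-(m+1) S_{nh}} = r^{m+1} e^{-nhΦ(m+1)}`, which vanishes
because `Φ(m+1) > 0`. -/
theorem IsSubordinator.walkMoment_eq_tsum (hS : IsSubordinator S ν P) (hν : ν ≠ 0) {h : ℝ≥0}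
    (hh : 0 < h) (m : ℕ) {r : ℝ} (hr : 0 ≤ r) :
    walkMoment (stepLaw S P h) (m + 1) r =
      ∑' k : ℕ, ∫⁻ ω, hitOp (stepLaw S P h) (walkMoment (stepLaw S P h) m)
        (r * Real.exp (-S (k * h) ω)) ∂P := by
  have := hS.isProbabilityMeasure_stepLaw h
  have hc : 0 < laplaceExponent ν (m + 1 : ℕ) := hS.levy.laplaceExponent_pos hν (by positivity)
  have hT : Tendsto (fun n : ℕ => ∫⁻ ω, walkMoment (stepLaw S P h) (m + 1)
      (r * Real.exp (-S (n * h) ω)) ∂P) atTop (𝓝 0) := by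
    have hT1 : Tendsto (fun n : ℕ => ENNReal.ofReal (r ^ (m + 1)) * ENNReal.ofReal
        (Real.exp (-(((n * h : ℝ≥0) : ℝ) * laplaceExponent ν (m + 1 : ℕ))))) atTop (𝓝 0) := by
      rw [← mul_zero (ENNReal.ofReal (r ^ (m + 1)))]
      refine ENNReal.Tendsto.const_mul ?_ (Or.inr ENNReal.ofReal_ne_top)
      rw [← ENNReal.ofReal_zero]
      refine ENNReal.tendsto_ofReal (Real.tendsto_exp_neg_atTop_nhds_zero.comp ?_)
      simp only [NNReal.coe_mul, NNReal.coe_natCast]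
      exact (tendsto_natCast_atTop_atTop.atTop_mul_const (NNReal.coe_pos.2 hh)).atTop_mul_const hc
    refine tendsto_of_tendsto_of_tendsto_of_le_of_le tendsto_const_nhds hT1
      (fun _ => zero_le) fun n => ?_
    rw [← hS.lintegral_exp _ (Nat.cast_nonneg _), ← lintegral_const_mul]
    · refine lintegral_mono fun ω => ?_
      refine (walkMoment_le_pow (hS.stepLaw_nonneg h) _ (by positivity)).trans_eq ?_
      rw [mul_pow, ENNReal.ofReal_mul (by positivity), ← Real.exp_nat_mul]
      ring_nf
    · have := hS.measurable (n * h)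
      fun_prop
  have hT2 := (ENNReal.summable (f := fun k : ℕ => ∫⁻ ω, hitOp (stepLaw S P h)
    (walkMoment (stepLaw S P h) m) (r * Real.exp (-S (k * h) ω)) ∂P)).hasSum.tendsto_sum_nat.add hT
  rw [add_zero] at hT2
  refine tendsto_nhds_unique ?_ hT2
  simp_rw [← hS.walkMoment_eq_sum h m r]
  exact tendsto_const_nhds

end Skeleton

/-! ### Finiteness and hitting probabilities of the Poisson sample. -/

section Poisson

variable {Ω : Type*} [MeasurableSpace Ω] {P : Measure Ω} {X : Ω → Set ℝ} {μ : Measure ℝ}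

theorem IsPoissonProcess.measure_nonempty (hX : IsPoissonProcess X μ P) {A : Set ℝ}
    (hA : MeasurableSet A) (hμ : μ A ≠ ∞) :
    P {ω | (X ω ∩ A).Nonempty} = hitProb (μ A).toReal := by
  have h1 : {ω | (X ω ∩ A).Nonempty} = {ω | (X ω ∩ A).encard ≠ 0} := by
    ext ω
    simp [Set.nonempty_iff_ne_empty]
  have hm : MeasurableSet {n : ℕ∞ | n ≠ 0} := (measurableSet_singleton 0).compl
  rw [h1, (hX.count_law A hA hμ).measure_eq (p := fun n => n ≠ 0) hm,
    Measure.map_apply (measurable_of_countable _) hm]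
  have h2 : ((↑) : ℕ → ℕ∞) ⁻¹' {n : ℕ∞ | n ≠ 0} = {0}ᶜ := by
    ext n
    simp
  rw [h2, prob_compl_eq_one_sub (measurableSet_singleton 0), poissonMeasure_singleton, hitProb,
    ENNReal.ofReal_sub _ (Real.exp_pos _).le]
  simp [ENNReal.toReal]

theorem IsPoissonProcess.ae_finite (hX : IsPoissonProcess X μ P) (hμ : μ Set.univ ≠ ∞) :
    ∀ᵐ ω ∂P, (X ω).Finite := by
  have h := (hX.count_law Set.univ MeasurableSet.univ hμ).measure_eq
    (p := fun n => n = ⊤) (measurableSet_singleton ⊤)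
  have hm : MeasurableSet {n : ℕ∞ | n = ⊤} := measurableSet_singleton ⊤
  rw [Measure.map_apply (measurable_of_countable _) hm] at h
  have h2 : ((↑) : ℕ → ℕ∞) ⁻¹' {n : ℕ∞ | n = ⊤} = ∅ := by
    ext n
    simp
  simp only [Set.inter_univ] at h
  rw [ae_iff]
  have h3 : {a | ¬(X a).Finite} = {ω | (X ω).encard = ⊤} := by
    ext ω
    exact Set.encard_eq_top_iff.symm
  rw [h3, h]
  exact (congrArg _ h2).trans measure_empty

theorem IsPoissonProcess.measure_forall_nonempty (hX : IsPoissonProcess X μ P) {ι : Type*}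
    [Fintype ι] {A : ι → Set ℝ} (hA : ∀ i, MeasurableSet (A i)) (hμ : ∀ i, μ (A i) ≠ ∞)
    (hd : Pairwise fun i j => Disjoint (A i) (A j)) :
    P {ω | ∀ i, (X ω ∩ A i).Nonempty} = ∏ i, hitProb (μ (A i)).toReal := by
  let e := Fintype.equivFin ι
  have h1 := hX.indep_counts _ (fun i => A (e.symm i)) (fun i => hA _) fun i j hij =>
    hd (e.symm.injective.ne hij)
  have h2 := h1.measure_inter_preimage_eq_mul Finset.univ (sets := fun _ => {0}ᶜ)
    fun i _ => (measurableSet_singleton 0).compl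
  have h3 : ∀ i, (fun ω => (X ω ∩ A i).encard) ⁻¹' {0}ᶜ = {ω | (X ω ∩ A i).Nonempty} := by
    intro i
    ext ω
    simp [Set.nonempty_iff_ne_empty]
  simp only [h3, Finset.mem_univ, Set.iInter_true] at h2
  have h4 : {ω | ∀ i, (X ω ∩ A i).Nonempty} = ⋂ i, {ω | (X ω ∩ A (e.symm i)).Nonempty} := by
    ext ω
    simp only [Set.mem_ofPred_eq, Set.mem_iInter]
    exact ⟨fun h i => h _, fun h i => by simpa using h (e i)⟩
  rw [h4, h2, ← e.symm.prod_comp]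
  exact Finset.prod_congr rfl fun i _ => hX.measure_nonempty (hA _) (hμ _)

end Poisson

/-! ### Hitting random intervals by an independent Poisson sample. -/

section RandomIntervals

variable {Ω : Type*} [MeasurableSpace Ω] {P : Measure Ω} [IsProbabilityMeasure P]

omit [IsProbabilityMeasure P] in
-- Because `U` takes countably many values, conditioning on it is a sum, and no joint measurability
-- of the family `E` is needed.
theorem measure_mem_of_countable {κ : Type*} [Countable κ] [MeasurableSpace κ]
    [MeasurableSingletonClass κ] {U : Ω → κ} (hU : Measurable U) {E : κ → Set Ω}
    (hE : ∀ v, MeasurableSet (E v)) (h : ∀ v, P (U ⁻¹' {v} ∩ E v) = P (U ⁻¹' {v}) * P (E v)) :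
    MeasurableSet {ω | ω ∈ E (U ω)} ∧ P {ω | ω ∈ E (U ω)} = ∫⁻ ω, P (E (U ω)) ∂P := by
  have h1 : {ω | ω ∈ E (U ω)} = ⋃ v, U ⁻¹' {v} ∩ E v := by
    ext ω
    simp
  have hm : ∀ v, MeasurableSet (U ⁻¹' {v} ∩ E v) := fun v =>
    (hU (measurableSet_singleton v)).inter (hE v)
  refine ⟨h1 ▸ MeasurableSet.iUnion hm, ?_⟩
  rw [h1, measure_iUnion _ hm]
  · rw [← lintegral_map (f := fun v => P (E v)) (measurable_of_countable _) hU,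
      lintegral_countable']
    refine tsum_congr fun v => ?_
    rw [h, Measure.map_apply hU (measurableSet_singleton v), mul_comm]
  · intro v w hvw
    refine Disjoint.mono Set.inter_subset_left Set.inter_subset_left ?_
    rw [Set.disjoint_left]
    rintro ω rfl h'
    exact hvw h'

/-- Also supplies the null measurability of the limit event, which in the application depends on
random endpoints and is not measurable by construction. -/
theorem tendsto_measure_of_ae_eventually {As : ℕ → Set Ω} {A : Set Ω}
    (hAs : ∀ i, MeasurableSet (As i)) (h : ∀ᵐ ω ∂P, ∀ᶠ i in atTop, ω ∈ As i ↔ ω ∈ A) :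
    NullMeasurableSet A P ∧ Tendsto (fun i => P (As i)) atTop (𝓝 (P A)) := by
  have hn : NullMeasurableSet A P :=
    nullMeasurableSet_of_tendsto_indicator atTop (fun i => (hAs i).nullMeasurableSet) h
  refine ⟨hn, ?_⟩
  rw [← measure_toMeasurable A]
  refine tendsto_measure_of_ae_tendsto_indicator_of_isFiniteMeasure atTop
    (measurableSet_toMeasurable P A) hAs ?_
  filter_upwards [h, hn.toMeasurable_ae_eq.mem_iff] with ω h1 h2
  filter_upwards [h1] with i hi
  rw [hi, h2]

/-- The point of the grid of mesh `1 / (j + 1)` that follows `a`, with index given. -/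
def gridPoint (j : ℕ) (i : ℤ) : ℝ := ((i : ℝ) + 1) / (j + 1)

/-- The index of the grid point following `a`. -/
def gridIndex (j : ℕ) (a : ℝ) : ℤ := ⌊((j : ℝ) + 1) * a⌋

theorem lt_gridPoint (j : ℕ) (a : ℝ) : a < gridPoint j (gridIndex j a) := by
  rw [gridPoint, lt_div_iff₀ (by positivity), mul_comm]
  exact Int.lt_floor_add_one _

theorem gridPoint_le (j : ℕ) (a : ℝ) : gridPoint j (gridIndex j a) ≤ a + 1 / (j + 1) := by
  rw [gridPoint, div_le_iff₀ (by positivity), add_mul, one_div_mul_cancel (by positivity)]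
  linarith [Int.floor_le (((j : ℝ) + 1) * a), mul_comm a ((j : ℝ) + 1),
    show (gridIndex j a : ℝ) = ⌊((j : ℝ) + 1) * a⌋ from rfl]

theorem gridPoint_mono (j : ℕ) {a b : ℝ} (h : a ≤ b) :
    gridPoint j (gridIndex j a) ≤ gridPoint j (gridIndex j b) := by
  unfold gridPoint gridIndex
  gcongr

theorem gridPoint_le_one (j : ℕ) {a : ℝ} (h : a < 1) : gridPoint j (gridIndex j a) ≤ 1 := by
  rw [gridPoint, div_le_one (by positivity)]
  have h1 : gridIndex j a < (j : ℤ) + 1 := by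
    rw [gridIndex, Int.floor_lt]
    push_cast
    have : (0 : ℝ) < j + 1 := by positivity
    nlinarith
  have h2 : gridIndex j a + 1 ≤ (j : ℤ) + 1 := h1
  exact_mod_cast h2

theorem tendsto_gridPoint (a : ℝ) :
    Tendsto (fun j : ℕ => gridPoint j (gridIndex j a)) atTop (𝓝 a) := by
  refine tendsto_of_tendsto_of_tendsto_of_le_of_le tendsto_const_nhds ?_
    (fun j => (lt_gridPoint j a).le) fun j => gridPoint_le j a
  simpa using tendsto_one_div_add_atTop_nhds_zero_nat.const_add a

theorem eventually_gridPoint_le_iff (a x : ℝ) :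
    ∀ᶠ j : ℕ in atTop, gridPoint j (gridIndex j a) ≤ x ↔ a < x := by
  rcases lt_or_ge a x with h | h
  · filter_upwards [(tendsto_gridPoint a).eventually_le_const h] with j hj
    simp [hj, h]
  · refine Eventually.of_forall fun j => ?_
    simp [h.not_gt, (h.trans_lt (lt_gridPoint j a))]

/-- Rounding goes strictly upwards, so `L < x` becomes `grid L ≤ x` and `x ≤ R` becomes `x < grid
R`: intervals `Ioc` turn into intervals `Ico`. Finiteness of `X` and of the index type makes one
mesh work for all conditions. -/
theorem eventually_forall_nonempty_iff {X : Set ℝ} (hX : X.Finite) {ι : Type*} [Finite ι]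
    (L R : ι → ℝ) :
    ∀ᶠ j : ℕ in atTop, (∀ i, (X ∩ Set.Ico (gridPoint j (gridIndex j (L i)))
      (gridPoint j (gridIndex j (R i)))).Nonempty) ↔ ∀ i, (X ∩ Set.Ioc (L i) (R i)).Nonempty := by
  have h1 : ∀ᶠ j : ℕ in atTop, ∀ i, ∀ x ∈ X,
      (gridPoint j (gridIndex j (L i)) ≤ x ↔ L i < x) ∧
        (gridPoint j (gridIndex j (R i)) ≤ x ↔ R i < x) := by
    refine eventually_all.2 fun i => (eventually_all_finite hX).2 fun x _ => ?_
    exact (eventually_gridPoint_le_iff _ _).and (eventually_gridPoint_le_iff _ _)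
  filter_upwards [h1] with j hj
  refine forall_congr' fun i => exists_congr fun x => and_congr_right fun hx => ?_
  obtain ⟨h2, h3⟩ := hj i x hx
  rw [Set.mem_Ico, Set.mem_Ioc, h2, ← not_le (a := gridPoint j (gridIndex j (R i))), h3, not_lt]

/-- The probability that disjoint intervals depending on the process `S` are all hit by an
independent Poisson process. -/
theorem measure_forall_hit {S : ℝ≥0 → Ω → ℝ} (hSm : ∀ t, Measurable (S t)) {X : Ω → Set ℝ}
    {ρ : ℝ} (hρ : 0 < ρ)
    (hX : IsPoissonProcess X (ENNReal.ofReal ρ • volume.restrict (Set.Icc (0 : ℝ) 1)) P)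
    (hSX : IndepOfProcess S X P) {ι : Type*} [Fintype ι] {L R : ι → (ℝ≥0 → ℝ) → ℝ}
    (hL : ∀ i, Measurable (L i)) (hR : ∀ i, Measurable (R i))
    (hLR : ∀ᵐ ω ∂P, ∀ i, 0 ≤ L i (fun t => S t ω) ∧
      L i (fun t => S t ω) ≤ R i (fun t => S t ω) ∧ R i (fun t => S t ω) < 1)
    (hd : ∀ᵐ ω ∂P, Pairwise fun i j =>
      R i (fun t => S t ω) ≤ L j (fun t => S t ω) ∨ R j (fun t => S t ω) ≤ L i (fun t => S t ω)) :
    NullMeasurableSet {ω | ∀ i, (X ω ∩ Set.Ioc (L i fun t => S t ω)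
      (R i fun t => S t ω)).Nonempty} P ∧
    P {ω | ∀ i, (X ω ∩ Set.Ioc (L i fun t => S t ω) (R i fun t => S t ω)).Nonempty} =
      ∫⁻ ω, ∏ i, hitProb (ρ * (R i (fun t => S t ω) - L i (fun t => S t ω))) ∂P := by
  set μ : Measure ℝ := ENNReal.ofReal ρ • volume.restrict (Set.Icc (0 : ℝ) 1) with hμ
  have hμfin : ∀ A, μ A ≠ ∞ := fun A => by
    rw [hμ, Measure.smul_apply, smul_eq_mul]
    exact ENNReal.mul_ne_top ENNReal.ofReal_ne_top (measure_ne_top _ _)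
  have hμIco : ∀ a b : ℝ, 0 ≤ a → a ≤ b → b ≤ 1 → (μ (Set.Ico a b)).toReal = ρ * (b - a) := by
    intro a b ha hab hb
    rw [hμ, Measure.smul_apply, smul_eq_mul, Measure.restrict_apply measurableSet_Ico,
      Set.inter_eq_left.2 (Set.Ico_subset_Icc_self.trans (Set.Icc_subset_Icc ha hb)), Real.volume_Ico,
      ← ENNReal.ofReal_mul hρ.le,
      ENNReal.toReal_ofReal (mul_nonneg hρ.le (sub_nonneg.2 hab))]
  -- The rounded endpoints range over a countable set, so independence can be used value by value;
  -- the mesh is then refined.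
  let D : ℕ → (ℝ≥0 → ℝ) → ι → ℤ × ℤ := fun j s i => (gridIndex j (L i s), gridIndex j (R i s))
  have hD : ∀ j, Measurable (D j) := fun j => by
    refine measurable_pi_lambda _ fun i => ?_
    have h1 := hL i
    have h2 := hR i
    exact (Int.measurable_floor.comp (h1.const_mul _)).prodMk
      (Int.measurable_floor.comp (h2.const_mul _))
  have hpath : Measurable fun ω (t : ℝ≥0) => S t ω := measurable_pi_lambda _ hSm
  let I : ℕ → (ι → ℤ × ℤ) → ι → Set ℝ := fun j v i =>
    Set.Ico (gridPoint j (v i).1) (gridPoint j (v i).2)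
  let E : ℕ → (ι → ℤ × ℤ) → Set Ω := fun j v => {ω | ∀ i, (X ω ∩ I j v i).Nonempty}
  have hE : ∀ j v, ∃ B : Set ({A : Set ℝ // MeasurableSet A} → ℕ∞), MeasurableSet B ∧
      E j v = (fun ω (A : {A : Set ℝ // MeasurableSet A}) => (X ω ∩ A.1).encard) ⁻¹' B := by
    intro j v
    refine ⟨⋂ i, {f | f ⟨I j v i, measurableSet_Ico⟩ ≠ 0}, MeasurableSet.iInter fun i => ?_, ?_⟩
    · exact measurable_pi_apply (⟨I j v i, measurableSet_Ico⟩ : {A : Set ℝ // MeasurableSet A})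
        (measurableSet_singleton 0).compl
    · ext ω
      simp [E, Set.nonempty_iff_ne_empty]
  have hcount : Measurable fun ω (A : {A : Set ℝ // MeasurableSet A}) => (X ω ∩ A.1).encard :=
    measurable_pi_lambda _ fun A => hX.measurable_count A.1 A.2
  have hEm : ∀ j v, MeasurableSet (E j v) := fun j v => by
    obtain ⟨B, hB, h⟩ := hE j v
    exact h ▸ hcount hB
  have hind : ∀ j v, P ((fun ω => D j fun t => S t ω) ⁻¹' {v} ∩ E j v) =
      P ((fun ω => D j fun t => S t ω) ⁻¹' {v}) * P (E j v) := by
    intro j v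
    obtain ⟨B, hB, h⟩ := hE j v
    rw [h]
    exact hSX.measure_inter_preimage_eq_mul _ _ ((hD j) (measurableSet_singleton v)) hB
  have hj := fun j => measure_mem_of_countable ((hD j).comp hpath) (hEm j) (hind j)
  have hfin := hX.ae_finite (hμfin _)
  obtain ⟨hn, hlim⟩ := tendsto_measure_of_ae_eventually (P := P)
    (A := {ω | ∀ i, (X ω ∩ Set.Ioc (L i fun t => S t ω) (R i fun t => S t ω)).Nonempty})
    (fun j => (hj j).1) (hfin.mono fun ω hω =>
      eventually_forall_nonempty_iff hω (fun i => L i fun t => S t ω) fun i => R i fun t => S t ω)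
  refine ⟨hn, tendsto_nhds_unique hlim ?_⟩
  simp_rw [fun j => (hj j).2]
  refine tendsto_lintegral_of_dominated_convergence' (fun _ => 1) (fun j => ?_) (fun j => ?_)
    (by simp) ?_
  · exact ((measurable_of_countable fun v => P (E j v)).comp ((hD j).comp hpath)).aemeasurable
  · exact Eventually.of_forall fun ω => prob_le_one
  · filter_upwards [hLR, hd] with ω h1 h2
    have h3 : ∀ j, P (E j (((D j) ∘ fun ω t => S t ω) ω)) = ∏ i, hitProb
        (ρ * (gridPoint j (gridIndex j (R i fun t => S t ω)) -
          gridPoint j (gridIndex j (L i fun t => S t ω)))) := by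
      intro j
      rw [hX.measure_forall_nonempty (fun i => measurableSet_Ico) (fun i => hμfin _)]
      · refine Finset.prod_congr rfl fun i _ => ?_
        exact congrArg hitProb (hμIco _ _ ((h1 i).1.trans (lt_gridPoint j _).le)
          (gridPoint_mono j (h1 i).2.1) (gridPoint_le_one j (h1 i).2.2))
      -- Rounding is monotone, so ordered intervals stay disjoint on the grid.
      · intro i k hik
        rw [Set.disjoint_left]
        rintro x ⟨hx1, hx2⟩ ⟨hx3, hx4⟩
        rcases h2 hik with h | h
        · exact absurd (hx2.trans_le ((gridPoint_mono j h).trans hx3)) (lt_irrefl _)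
        · exact absurd (hx4.trans_le ((gridPoint_mono j h).trans hx1)) (lt_irrefl _)
    simp_rw [h3]
    refine ENNReal.tendsto_finsetProd_of_ne_top _ (fun i _ => ?_) fun i _ => ?_
    · have hc : Continuous hitProb := by
        unfold hitProb
        exact ENNReal.continuous_ofReal.comp (by fun_prop)
      exact (hc.tendsto _).comp (((tendsto_gridPoint _).sub (tendsto_gridPoint _)).const_mul ρ)
    · exact (hitProb_le_one _).trans_lt ENNReal.one_lt_top |>.ne

end RandomIntervals

/-! ### Riemann sums of antitone functions. -/

section Riemann

theorem iUnion_Ico_mul_natCast {h : ℝ} (hh : 0 < h) :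
    ⋃ k : ℕ, Set.Ico ((k : ℝ) * h) (((k + 1 : ℕ) : ℝ) * h) = Set.Ici 0 := by
  ext t
  simp only [Set.mem_iUnion, Set.mem_Ico, Set.mem_Ici]
  constructor
  · rintro ⟨k, hk, -⟩
    exact le_trans (by positivity) hk
  · intro ht
    refine ⟨⌊t / h⌋₊, ?_, ?_⟩
    · rw [← le_div_iff₀ hh]
      exact Nat.floor_le (by positivity)
    · rw [← div_lt_iff₀ hh]
      exact_mod_cast Nat.lt_floor_add_one _

theorem pairwise_disjoint_Ico_mul_natCast {h : ℝ} (hh : 0 < h) :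
    Pairwise (Function.onFun Disjoint
      fun k : ℕ => Set.Ico ((k : ℝ) * h) (((k + 1 : ℕ) : ℝ) * h)) := by
  have : Monotone fun k : ℕ => (k : ℝ) * h := fun a b hab => by
    dsimp only
    gcongr
  simpa using this.pairwise_disjoint_on_Ico_succ

theorem lintegral_Ioi_eq_tsum {h : ℝ} (hh : 0 < h) (f : ℝ → ℝ≥0∞) :
    ∫⁻ t in Set.Ioi (0 : ℝ), f t =
      ∑' k : ℕ, ∫⁻ t in Set.Ico ((k : ℝ) * h) (((k + 1 : ℕ) : ℝ) * h), f t := by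
  rw [← lintegral_iUnion (fun k => measurableSet_Ico) (pairwise_disjoint_Ico_mul_natCast hh),
    iUnion_Ico_mul_natCast hh, restrict_Ioi_eq_restrict_Ici]

theorem volume_Ico_mul_natCast {h : ℝ} (k : ℕ) :
    volume (Set.Ico ((k : ℝ) * h) (((k + 1 : ℕ) : ℝ) * h)) = ENNReal.ofReal h := by
  rw [Real.volume_Ico]
  push_cast
  ring_nf

/-- Together with the next lemma: the integral lies between the sum without its term `k = 0` and the
full sum. -/
theorem lintegral_le_tsum_of_antitone {h : ℝ≥0} (hh : 0 < h) {φ : ℝ≥0 → ℝ≥0∞}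
    (hφ : Antitone φ) :
    ∫⁻ t in Set.Ioi (0 : ℝ), φ t.toNNReal ≤ ∑' k : ℕ, h * φ (k * h) := by
  rw [lintegral_Ioi_eq_tsum (NNReal.coe_pos.2 hh)]
  refine ENNReal.tsum_le_tsum fun k => ?_
  refine (setLIntegral_mono measurable_const (g := fun _ => φ (k * h)) fun t ht => ?_).trans_eq ?_
  · refine hφ ?_
    rw [← NNReal.coe_le_coe]
    simpa using Or.inl ht.1
  · rw [setLIntegral_const, volume_Ico_mul_natCast, mul_comm, ENNReal.ofReal_coe_nnreal]

theorem tsum_succ_le_lintegral_of_antitone {h : ℝ≥0} (hh : 0 < h) {φ : ℝ≥0 → ℝ≥0∞}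
    (hφ : Antitone φ) :
    ∑' k : ℕ, h * φ ((k + 1 : ℕ) * h) ≤ ∫⁻ t in Set.Ioi (0 : ℝ), φ t.toNNReal := by
  rw [lintegral_Ioi_eq_tsum (NNReal.coe_pos.2 hh)]
  refine ENNReal.tsum_le_tsum fun k => ?_
  refine Eq.trans_le ?_ (setLIntegral_mono' measurableSet_Ico (f := fun _ => φ ((k + 1 : ℕ) * h))
    fun t ht => ?_)
  · rw [setLIntegral_const, volume_Ico_mul_natCast, mul_comm, ENNReal.ofReal_coe_nnreal]
  · refine hφ (Real.toNNReal_le_iff_le_coe.2 ?_)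
    exact_mod_cast ht.2.le

end Riemann

/-! ### The potential operator and the two bounds for the skeleton moments. -/

section Potential

variable {Ω : Type*} [MeasurableSpace Ω] {P : Measure Ω} [IsProbabilityMeasure P]
  {ν : Measure ℝ} {S : ℝ≥0 → Ω → ℝ}

/-- The potential operator of the multiplicative subordinator. -/
def potential (S : ℝ≥0 → Ω → ℝ) (P : Measure Ω) (G : ℝ → ℝ≥0∞) (r : ℝ) : ℝ≥0∞ :=
  ∫⁻ t in Set.Ioi (0 : ℝ), ∫⁻ ω, G (r * Real.exp (-S t.toNNReal ω)) ∂P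

omit [IsProbabilityMeasure P] in
theorem IsSubordinator.antitone_lintegral (hS : IsSubordinator S ν P) {G : ℝ → ℝ≥0∞}
    (hG : MonotoneOn G (Set.Ici 0)) {r : ℝ} (hr : 0 ≤ r) :
    Antitone fun t : ℝ≥0 => ∫⁻ ω, G (r * Real.exp (-S t ω)) ∂P := by
  intro s t hst
  refine lintegral_mono_ae ?_
  filter_upwards [hS.monotone] with ω hω
  refine hG (mul_nonneg hr (Real.exp_pos _).le) (mul_nonneg hr (Real.exp_pos _).le) ?_
  have := hω hst
  dsimp only at this
  gcongr

theorem measurable_comp_mul_exp {G : ℝ → ℝ≥0∞} (hG : MonotoneOn G (Set.Ici 0)) {r : ℝ}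
    (hr : 0 ≤ r) : Measurable fun s : ℝ => G (r * Real.exp (-s)) := by
  have h1 : Monotone fun z => G (max z 0) := fun a b hab =>
    hG (Set.mem_Ici.2 (le_max_right a 0)) (Set.mem_Ici.2 (le_max_right b 0))
      (max_le_max_right 0 hab)
  have h2 : (fun s : ℝ => G (r * Real.exp (-s))) =
      (fun z => G (max z 0)) ∘ fun s => r * Real.exp (-s) := by
    ext s
    simp [max_eq_left (mul_nonneg hr (Real.exp_pos (-s)).le)]
  rw [h2]
  exact h1.measurable.comp (by fun_prop)

theorem lintegral_exp_neg_mul {c : ℝ} (hc : 0 < c) :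
    ∫⁻ t in Set.Ioi (0 : ℝ), ENNReal.ofReal (Real.exp (-(t * c))) = ENNReal.ofReal (1 / c) := by
  have h1 : ∀ t : ℝ, Real.exp (-(t * c)) = Real.exp (-c * t) := fun t => by ring_nf
  simp_rw [h1]
  rw [← ofReal_integral_eq_lintegral_ofReal (integrableOn_exp_mul_Ioi (by linarith) 0)
    (Eventually.of_forall fun t => (Real.exp_pos _).le), integral_exp_mul_Ioi (by linarith)]
  simp

theorem exp_neg_rpow (s β : ℝ) : Real.exp (-s) ^ β = Real.exp (-(β * s)) := by
  rw [← Real.exp_mul]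
  ring_nf

theorem IsSubordinator.lintegral_rpow (hS : IsSubordinator S ν P) {C : ℝ≥0∞} {r β : ℝ}
    (hr : 0 ≤ r) (hβ : 0 ≤ β) (t : ℝ≥0) :
    ∫⁻ ω, C * ENNReal.ofReal ((r * Real.exp (-S t ω)) ^ β) ∂P =
      C * ENNReal.ofReal (r ^ β) * ENNReal.ofReal (Real.exp (-(t * laplaceExponent ν β))) := by
  have hm := hS.measurable t
  rw [← hS.lintegral_exp t hβ, ← lintegral_const_mul _ (by fun_prop)]
  refine lintegral_congr fun ω => ?_
  rw [Real.mul_rpow hr (Real.exp_pos _).le, exp_neg_rpow, ENNReal.ofReal_mul (by positivity),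
    mul_assoc]

/-- Powers are eigenfunctions of the potential operator with eigenvalue `1 / Φ(β)`: the source of
the factors `1 / Φ(αj)` in the final constant. -/
theorem IsSubordinator.potential_rpow (hS : IsSubordinator S ν P) (hν : ν ≠ 0) {C : ℝ≥0∞}
    {r β : ℝ} (hr : 0 ≤ r) (hβ : 0 < β) :
    potential S P (fun z => C * ENNReal.ofReal (z ^ β)) r =
      C * ENNReal.ofReal (r ^ β) * ENNReal.ofReal (1 / laplaceExponent ν β) := by
  rw [potential, ← lintegral_exp_neg_mul (hS.levy.laplaceExponent_pos hν hβ),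
    ← lintegral_const_mul _ (by fun_prop)]
  refine setLIntegral_congr_fun measurableSet_Ioi fun t ht => ?_
  rw [hS.lintegral_rpow hr hβ.le, Real.coe_toNNReal _ (le_of_lt ht)]

/-- Dominated convergence over `ω` for each `t`, then over `t`. The dominating power has a finite
potential since `β > 0`; this `β` need not be related to the growth of `H`. -/
theorem IsSubordinator.tendsto_potential (hS : IsSubordinator S ν P) (hν : ν ≠ 0) {ι : Type*}
    {l : Filter ι} [l.IsCountablyGenerated] {G : ι → ℝ → ℝ≥0∞} {H : ℝ → ℝ≥0∞} {C : ℝ≥0∞}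
    (hC : C ≠ ∞) {r β : ℝ} (hr : 0 < r) (hβ : 0 < β)
    (hG : ∀ᶠ i in l, MonotoneOn (G i) (Set.Ici 0))
    (hle : ∀ᶠ i in l, ∀ z, 0 < z → z ≤ r → G i z ≤ C * ENNReal.ofReal (z ^ β))
    (hlim : ∀ z, 0 < z → z ≤ r → Tendsto (fun i => G i z) l (𝓝 (H z))) :
    Tendsto (fun i => potential S P (G i) r) l (𝓝 (potential S P H r)) := by
  have hz : ∀ᵐ ω ∂P, ∀ t, 0 < r * Real.exp (-S t ω) ∧ r * Real.exp (-S t ω) ≤ r := by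
    filter_upwards [hS.ae_nonneg] with ω hω t
    refine ⟨by positivity, mul_le_of_le_one_right hr.le (Real.exp_le_one_iff.2 ?_)⟩
    linarith [hω t]
  have hbd : ∀ᶠ i in l, ∀ t : ℝ≥0, ∫⁻ ω, G i (r * Real.exp (-S t ω)) ∂P ≤
      C * ENNReal.ofReal (r ^ β) * ENNReal.ofReal (Real.exp (-(t * laplaceExponent ν β))) := by
    filter_upwards [hle] with i hi t
    rw [← hS.lintegral_rpow hr.le hβ.le]
    exact lintegral_mono_ae (hz.mono fun ω hω => hi _ (hω t).1 (hω t).2)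
  refine tendsto_lintegral_filter_of_dominated_convergence
    (fun t => C * ENNReal.ofReal (r ^ β) * ENNReal.ofReal (Real.exp (-(t * laplaceExponent ν β))))
    ?_ ?_ ?_ ?_
  · filter_upwards [hG] with i hi
    exact (hS.antitone_lintegral hi hr.le).measurable.comp measurable_real_toNNReal
  · filter_upwards [hbd] with i hi
    filter_upwards [ae_restrict_mem measurableSet_Ioi] with t ht
    simpa [Real.coe_toNNReal _ (le_of_lt (Set.mem_Ioi.1 ht))] using hi t.toNNReal
  · rw [lintegral_const_mul _ (by fun_prop),
      lintegral_exp_neg_mul (hS.levy.laplaceExponent_pos hν hβ)]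
    exact ENNReal.mul_ne_top (ENNReal.mul_ne_top hC ENNReal.ofReal_ne_top) ENNReal.ofReal_ne_top
  · refine Eventually.of_forall fun t => ?_
    refine tendsto_lintegral_filter_of_dominated_convergence
      (fun ω => C * ENNReal.ofReal ((r * Real.exp (-S t.toNNReal ω)) ^ β)) ?_ ?_ ?_ ?_
    · filter_upwards [hG] with i hi
      exact (measurable_comp_mul_exp hi hr.le).comp (hS.measurable _)
    · filter_upwards [hle] with i hi
      exact hz.mono fun ω hω => hi _ (hω _).1 (hω _).2
    · rw [hS.lintegral_rpow hr.le hβ.le]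
      exact ENNReal.mul_ne_top (ENNReal.mul_ne_top hC ENNReal.ofReal_ne_top) ENNReal.ofReal_ne_top
    · exact hz.mono fun ω hω => hlim _ (hω _).1 (hω _).2

omit [IsProbabilityMeasure P] in
theorem IsSubordinator.hitOp_le (hS : IsSubordinator S ν P) (h : ℝ≥0) {G : ℝ → ℝ≥0∞}
    (hG : MonotoneOn G (Set.Ici 0)) {r : ℝ} (hr : 0 ≤ r) :
    hitOp (stepLaw S P h) G r ≤ psi (stepLaw S P h) r * G r := by
  have hq : Measurable fun y => hitProb (r * (1 - Real.exp (-y))) :=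
    measurable_hitProb.comp (by fun_prop)
  rw [psi, ← lintegral_mul_const _ hq]
  refine lintegral_mono_ae ((hS.stepLaw_nonneg h).mono fun y hy => mul_le_mul_right (hG ?_ hr ?_) _)
  · exact mul_nonneg hr (Real.exp_pos _).le
  · exact mul_le_of_le_one_right hr (Real.exp_le_one_iff.2 (by linarith))

/-- Steps with `1 - e^{-y} ≤ δ` end at a point not below `(1 - δ) r`. The other steps have
probability at most `hΦ(1)/δ` by Markov's inequality. After division by `h` this loss is a constant,
negligible when `ψ → ∞`. -/
theorem IsSubordinator.le_hitOp (hS : IsSubordinator S ν P) (h : ℝ≥0) {G : ℝ → ℝ≥0∞}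
    (hG : MonotoneOn G (Set.Ici 0)) {r δ : ℝ} (hr : 0 ≤ r) (hδ : 0 < δ) (hδ1 : δ < 1) :
    (psi (stepLaw S P h) r - h * ENNReal.ofReal (laplaceExponent ν 1 / δ)) * G ((1 - δ) * r) ≤
      hitOp (stepLaw S P h) G r := by
  set μ := stepLaw S P h
  set B : Set ℝ := {y | 1 - Real.exp (-y) ≤ δ}
  have hB : MeasurableSet B := measurableSet_le (by fun_prop) measurable_const
  have hq : Measurable fun y => hitProb (r * (1 - Real.exp (-y))) :=
    measurable_hitProb.comp (by fun_prop)
  have h1 : μ Bᶜ ≤ h * ENNReal.ofReal (laplaceExponent ν 1 / δ) := by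
    have h2 := mul_meas_ge_le_lintegral₀ (μ := μ)
      (f := fun y => ENNReal.ofReal (1 - Real.exp (-(1 * y)))) (by fun_prop) (ENNReal.ofReal δ)
    rw [hS.lintegral_one_sub_exp h zero_le_one] at h2
    have h3 : Bᶜ ⊆ {y | ENNReal.ofReal δ ≤ ENNReal.ofReal (1 - Real.exp (-(1 * y)))} := by
      intro y hy
      have hy' : δ < 1 - Real.exp (-y) := not_le.1 hy
      refine ENNReal.ofReal_le_ofReal ?_
      rw [one_mul]
      exact hy'.le
    have h4 : ENNReal.ofReal (1 - Real.exp (-(h * laplaceExponent ν 1))) ≤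
        h * ENNReal.ofReal (laplaceExponent ν 1) := by
      rw [← ENNReal.ofReal_coe_nnreal (p := h), ← ENNReal.ofReal_mul h.coe_nonneg]
      exact ENNReal.ofReal_le_ofReal (by
        linarith [Real.add_one_le_exp (-(h * laplaceExponent ν 1))])
    have h5 : ENNReal.ofReal δ * μ Bᶜ ≤ h * ENNReal.ofReal (laplaceExponent ν 1) :=
      (mul_le_mul_right (measure_mono h3) _).trans (h2.trans h4)
    rw [ENNReal.ofReal_div_of_pos hδ, ← mul_div_assoc,
      ENNReal.le_div_iff_mul_le (Or.inl (by simpa using hδ)) (Or.inl ENNReal.ofReal_ne_top),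
      mul_comm]
    exact h5
  have h2 : psi μ r - h * ENNReal.ofReal (laplaceExponent ν 1 / δ) ≤
      ∫⁻ y in B, hitProb (r * (1 - Real.exp (-y))) ∂μ := by
    rw [tsub_le_iff_right, psi, ← lintegral_add_compl _ hB]
    refine add_le_add le_rfl (le_trans ?_ h1)
    calc _ ≤ ∫⁻ _ in Bᶜ, 1 ∂μ := lintegral_mono fun y => hitProb_le_one _
      _ = μ Bᶜ := by simp
  refine (mul_le_mul_left h2 _).trans ?_
  rw [← lintegral_mul_const _ hq]
  refine le_trans (setLIntegral_mono' hB fun y hy => ?_) (setLIntegral_le_lintegral B _)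
  refine mul_le_mul_right (hG ?_ ?_ ?_) _
  · exact mul_nonneg (by linarith) hr
  · exact mul_nonneg hr (Real.exp_pos _).le
  · have hy' : 1 - Real.exp (-y) ≤ δ := hy
    nlinarith

/-- The integrand that bounds the binomial moments of the skeleton from above. -/
def upperKernel (S : ℝ≥0 → Ω → ℝ) (P : Measure Ω) (m : ℕ) (h : ℝ≥0) (z : ℝ) : ℝ≥0∞ :=
  psi (stepLaw S P h) z / h * walkMoment (stepLaw S P h) m z

/-- The integrand that bounds the binomial moments of the skeleton from below. -/
def lowerKernel (S : ℝ≥0 → Ω → ℝ) (P : Measure Ω) (c : ℝ≥0∞) (δ : ℝ) (m : ℕ) (h : ℝ≥0) (z : ℝ) :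
    ℝ≥0∞ :=
  (psi (stepLaw S P h) z / h - c) * walkMoment (stepLaw S P h) m ((1 - δ) * z)

omit [IsProbabilityMeasure P] in
theorem upperKernel_monotoneOn (m : ℕ) (h : ℝ≥0) :
    MonotoneOn (upperKernel S P m h) (Set.Ici 0) := fun _ hr _ hs hrs =>
  mul_le_mul' (ENNReal.div_le_div_right (psi_monotoneOn _ hr hs hrs) _)
    (walkMoment_monotoneOn m hr hs hrs)

omit [IsProbabilityMeasure P] in
theorem lowerKernel_monotoneOn (c : ℝ≥0∞) {δ : ℝ} (hδ : δ < 1) (m : ℕ) (h : ℝ≥0) :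
    MonotoneOn (lowerKernel S P c δ m h) (Set.Ici 0) := fun r hr s hs hrs =>
  mul_le_mul' (tsub_le_tsub_right (ENNReal.div_le_div_right (psi_monotoneOn _ hr hs hrs) _) _)
    (walkMoment_monotoneOn m (mul_nonneg (sub_nonneg.2 hδ.le) hr)
      (mul_nonneg (sub_nonneg.2 hδ.le) hs)
      (mul_le_mul_of_nonneg_left hrs (by linarith)))

theorem IsSubordinator.upperKernel_le (hS : IsSubordinator S ν P) (m : ℕ) {h : ℝ≥0} (hh : 0 < h)
    {z : ℝ} (hz : 0 < z) : upperKernel S P m h z ≤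
      ENNReal.ofReal (laplaceExponent ν 1) * ENNReal.ofReal (z ^ ((m : ℝ) + 1)) := by
  have := hS.isProbabilityMeasure_stepLaw h
  have hh' : (h : ℝ≥0∞) ≠ 0 := by simpa using hh.ne'
  have h1 : psi (stepLaw S P h) z / h ≤ ENNReal.ofReal (z * laplaceExponent ν 1) := by
    rw [ENNReal.div_le_iff hh' ENNReal.coe_ne_top, mul_comm]
    exact hS.psi_stepLaw_le h hz.le
  refine (mul_le_mul' h1 (walkMoment_le_pow (hS.stepLaw_nonneg h) m hz.le)).trans_eq ?_
  have hΦ := hS.levy.laplaceExponent_nonneg zero_le_one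
  rw [← ENNReal.ofReal_mul (by positivity), ← ENNReal.ofReal_mul hΦ, Real.rpow_add_one hz.ne',
    Real.rpow_natCast]
  ring_nf

theorem IsSubordinator.lowerKernel_le (hS : IsSubordinator S ν P) (c : ℝ≥0∞) {δ : ℝ}
    (hδ : 0 < δ) (hδ1 : δ < 1) (m : ℕ) {h : ℝ≥0} (hh : 0 < h)
    {z : ℝ} (hz : 0 < z) : lowerKernel S P c δ m h z ≤
      ENNReal.ofReal (laplaceExponent ν 1) * ENNReal.ofReal (z ^ ((m : ℝ) + 1)) := by
  refine le_trans (mul_le_mul' tsub_le_self ?_) (hS.upperKernel_le m hh hz)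
  exact walkMoment_monotoneOn m (mul_nonneg (by linarith) hz.le) hz.le (by nlinarith)

theorem IsSubordinator.walkMoment_le_potential (hS : IsSubordinator S ν P) (hν : ν ≠ 0)
    {h : ℝ≥0} (hh : 0 < h) (m : ℕ) {r : ℝ} (hr : 0 < r) :
    walkMoment (stepLaw S P h) (m + 1) r ≤
      h * (ENNReal.ofReal (laplaceExponent ν 1) * ENNReal.ofReal (r ^ ((m : ℝ) + 1))) +
        potential S P (upperKernel S P m h) r := by
  have hh' : (h : ℝ≥0∞) ≠ 0 := by simpa using hh.ne'
  rw [hS.walkMoment_eq_tsum hν hh m hr.le]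
  have hanti := hS.antitone_lintegral (upperKernel_monotoneOn (S := S) (P := P) m h) hr.le
  have h1 : ∀ k : ℕ, ∫⁻ ω, hitOp (stepLaw S P h) (walkMoment (stepLaw S P h) m)
      (r * Real.exp (-S (k * h) ω)) ∂P ≤
      h * ∫⁻ ω, upperKernel S P m h (r * Real.exp (-S (k * h) ω)) ∂P := by
    intro k
    rw [← lintegral_const_mul' _ _ ENNReal.coe_ne_top]
    refine lintegral_mono fun ω => ?_
    refine (hS.hitOp_le h (walkMoment_monotoneOn m) (by positivity)).trans_eq ?_
    rw [upperKernel, ← mul_assoc, ENNReal.mul_div_cancel hh' ENNReal.coe_ne_top]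
  refine (ENNReal.tsum_le_tsum h1).trans ?_
  -- The sum over left endpoints exceeds the integral of an antitone function; without its first
  -- term it becomes a sum over right endpoints, which does not. The first term is of order `h`.
  rw [tsum_eq_zero_add' ENNReal.summable]
  refine add_le_add (mul_le_mul_right ?_ _) (tsum_succ_le_lintegral_of_antitone hh hanti)
  have h0 : ∀ᵐ ω ∂P, upperKernel S P m h (r * Real.exp (-S ((0 : ℕ) * h) ω)) =
      upperKernel S P m h r := by
    filter_upwards [hS.zero] with ω hω
    simp [hω]
  rw [lintegral_congr_ae h0, lintegral_const, measure_univ, mul_one]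
  exact hS.upperKernel_le m hh hr

theorem IsSubordinator.potential_le_walkMoment (hS : IsSubordinator S ν P) (hν : ν ≠ 0)
    {h : ℝ≥0} (hh : 0 < h) (m : ℕ) {δ : ℝ} (hδ : 0 < δ) (hδ1 : δ < 1) {r : ℝ} (hr : 0 < r) :
    potential S P (lowerKernel S P (ENNReal.ofReal (laplaceExponent ν 1 / δ)) δ m h) r ≤
      walkMoment (stepLaw S P h) (m + 1) r := by
  have hh' : (h : ℝ≥0∞) ≠ 0 := by simpa using hh.ne'
  set c := ENNReal.ofReal (laplaceExponent ν 1 / δ)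
  rw [hS.walkMoment_eq_tsum hν hh m hr.le]
  have hmono := lowerKernel_monotoneOn (S := S) (P := P) c hδ1 m h
  refine (lintegral_le_tsum_of_antitone hh (hS.antitone_lintegral hmono hr.le)).trans ?_
  refine ENNReal.tsum_le_tsum fun k => ?_
  rw [← lintegral_const_mul' _ _ ENNReal.coe_ne_top]
  refine lintegral_mono fun ω => ?_
  refine Eq.trans_le ?_ (hS.le_hitOp h (walkMoment_monotoneOn m) (by positivity) hδ hδ1)
  rw [lowerKernel, ← mul_assoc, ENNReal.mul_sub (fun _ _ => ENNReal.coe_ne_top),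
    ENNReal.mul_div_cancel hh' ENNReal.coe_ne_top]

variable {u : ℕ → ℝ≥0} {F : ℝ → ℝ≥0∞} {m : ℕ}

/-- The hypothesis concerns moments of order `m` only, yet the conclusion controls those of order `m
+ 1`. The case `m = 0`, where `F = 1`, needs no prior convergence and is used to show that the
sample avoids the range. -/
theorem IsSubordinator.tendsto_potential_upperKernel (hS : IsSubordinator S ν P) (hν : ν ≠ 0)
    (hu : ∀ n, 0 < u n) (hu0 : Tendsto u atTop (𝓝 0))
    (hF : ∀ r, 0 < r → Tendsto (fun n => walkMoment (stepLaw S P (u n)) m r) atTop (𝓝 (F r)))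
    {r : ℝ} (hr : 0 < r) :
    Tendsto (fun n => u n * (ENNReal.ofReal (laplaceExponent ν 1) *
      ENNReal.ofReal (r ^ ((m : ℝ) + 1))) + potential S P (upperKernel S P m (u n)) r) atTop
      (𝓝 (potential S P (fun z => psi ν z * F z) r)) := by
  have hFtop : ∀ z, 0 < z → F z ≠ ∞ := fun z hz =>
    ((le_of_tendsto' (hF z hz) fun n =>
      have := hS.isProbabilityMeasure_stepLaw (u n)
      walkMoment_le_pow (hS.stepLaw_nonneg _) m hz.le).trans_lt ENNReal.ofReal_lt_top).ne
  have h1 : Tendsto (fun n => potential S P (upperKernel S P m (u n)) r) atTop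
      (𝓝 (potential S P (fun z => psi ν z * F z) r)) := by
    refine hS.tendsto_potential hν (C := ENNReal.ofReal (laplaceExponent ν 1))
      ENNReal.ofReal_ne_top hr (β := (m : ℝ) + 1) (by positivity)
      (Eventually.of_forall fun n => upperKernel_monotoneOn m _)
      (Eventually.of_forall fun n z hz _ => hS.upperKernel_le m (hu n) hz) fun z hz _ => ?_
    exact ENNReal.Tendsto.mul (hS.tendsto_psi_stepLaw hu hu0 hz.le) (Or.inr (hFtop z hz))
      (hF z hz) (Or.inr (hS.levy.psi_ne_top hz.le))
  have h2 : Tendsto (fun n => (u n : ℝ≥0∞) * (ENNReal.ofReal (laplaceExponent ν 1) *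
      ENNReal.ofReal (r ^ ((m : ℝ) + 1)))) atTop (𝓝 0) := by
    have := ENNReal.Tendsto.mul_const (b := ENNReal.ofReal (laplaceExponent ν 1) *
      ENNReal.ofReal (r ^ ((m : ℝ) + 1))) (ENNReal.tendsto_coe.2 hu0)
      (Or.inr (ENNReal.mul_ne_top ENNReal.ofReal_ne_top ENNReal.ofReal_ne_top))
    simpa using this
  simpa using h2.add h1

theorem IsSubordinator.tendsto_potential_lowerKernel (hS : IsSubordinator S ν P) (hν : ν ≠ 0)
    (hu : ∀ n, 0 < u n) (hu0 : Tendsto u atTop (𝓝 0))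
    (hF : ∀ r, 0 < r → Tendsto (fun n => walkMoment (stepLaw S P (u n)) m r) atTop (𝓝 (F r)))
    {c : ℝ≥0∞} (hc : c ≠ ∞) {δ : ℝ} (hδ : 0 < δ) (hδ1 : δ < 1) {r : ℝ} (hr : 0 < r) :
    Tendsto (fun n => potential S P (lowerKernel S P c δ m (u n)) r) atTop
      (𝓝 (potential S P (fun z => (psi ν z - c) * F ((1 - δ) * z)) r)) := by
  have hFtop : ∀ z, 0 < z → F z ≠ ∞ := fun z hz =>
    ((le_of_tendsto' (hF z hz) fun n =>
      have := hS.isProbabilityMeasure_stepLaw (u n)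
      walkMoment_le_pow (hS.stepLaw_nonneg _) m hz.le).trans_lt ENNReal.ofReal_lt_top).ne
  refine hS.tendsto_potential hν (C := ENNReal.ofReal (laplaceExponent ν 1))
    ENNReal.ofReal_ne_top hr (β := (m : ℝ) + 1) (by positivity)
    (Eventually.of_forall fun n => lowerKernel_monotoneOn c hδ1 m _)
    (Eventually.of_forall fun n z hz _ => hS.lowerKernel_le c hδ hδ1 m (hu n) hz) fun z hz _ => ?_
  have hz' : 0 < (1 - δ) * z := mul_pos (by linarith) hz
  refine ENNReal.Tendsto.mul (ENNReal.Tendsto.sub (hS.tendsto_psi_stepLaw hu hu0 hz.le)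
    tendsto_const_nhds (Or.inr hc)) (Or.inr (hFtop _ hz')) (hF _ hz') (Or.inr ?_)
  exact (tsub_le_self.trans_lt (hS.levy.psi_ne_top hz.le).lt_top).ne

/-- By scaling, the quotient is the potential at `1` of `z ↦ ψ(rz)/r`, which tends to `0` pointwise
and is at most `Φ(1) z`. -/
theorem IsSubordinator.tendsto_potential_psi_div (hS : IsSubordinator S ν P) (hν : ν ≠ 0) :
    Tendsto (fun r => potential S P (psi ν) r / ENNReal.ofReal r) atTop (𝓝 0) := by
  have h1 : ∀ᶠ r : ℝ in atTop, potential S P (fun z => psi ν (r * z) / ENNReal.ofReal r) 1 =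
      potential S P (psi ν) r / ENNReal.ofReal r := by
    filter_upwards [eventually_gt_atTop 0] with r hr
    have hr' : ENNReal.ofReal r ≠ 0 := by simpa using hr
    simp only [potential, div_eq_mul_inv, one_mul]
    rw [← lintegral_mul_const' _ _ (ENNReal.inv_ne_top.2 hr')]
    refine lintegral_congr fun t => ?_
    rw [lintegral_mul_const' _ _ (ENNReal.inv_ne_top.2 hr')]
  refine Tendsto.congr' h1 ?_
  have h0 : potential S P (fun _ => 0) 1 = 0 := by simp [potential]
  rw [← h0]
  refine hS.tendsto_potential hν (C := ENNReal.ofReal (laplaceExponent ν 1))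
    ENNReal.ofReal_ne_top one_pos (β := 1) one_pos ?_ ?_ ?_
  · filter_upwards [eventually_gt_atTop 0] with r hr x hx y hy hxy
    exact ENNReal.div_le_div_right (psi_monotoneOn ν (mul_nonneg hr.le hx) (mul_nonneg hr.le hy)
      (mul_le_mul_of_nonneg_left hxy hr.le)) _
  · filter_upwards [eventually_gt_atTop 0] with r hr z hz _
    rw [ENNReal.div_le_iff (by simpa using hr) ENNReal.ofReal_ne_top, Real.rpow_one,
      ← ENNReal.ofReal_mul (hS.levy.laplaceExponent_nonneg zero_le_one),
      ← ENNReal.ofReal_mul (mul_nonneg (hS.levy.laplaceExponent_nonneg zero_le_one) hz.le)]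
    refine (hS.levy.psi_le (by positivity)).trans_eq ?_
    ring_nf
  · intro z hz _
    have h2 := hS.levy.tendsto_psi_div.comp (tendsto_id.atTop_mul_const hz)
    have h3 := ENNReal.Tendsto.mul_const (b := ENNReal.ofReal z) h2 (Or.inr ENNReal.ofReal_ne_top)
    rw [zero_mul] at h3
    refine h3.congr' ?_
    filter_upwards [eventually_gt_atTop 0] with r hr
    have hz' : ENNReal.ofReal z ≠ 0 := by simpa using hz
    simp only [Function.comp_apply, id]
    rw [ENNReal.ofReal_mul hr.le, div_eq_mul_inv, div_eq_mul_inv, mul_assoc,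
      ENNReal.mul_inv (Or.inr ENNReal.ofReal_ne_top) (Or.inr hz'), mul_assoc,
      ENNReal.inv_mul_cancel hz' ENNReal.ofReal_ne_top, mul_one]

end Potential

/-! ### Deterministic paths: hit intervals against blocks. -/

section Path

/-- The image of a path under `x ↦ 1 - e^{-x}`. -/
def pathPoint (s : ℝ≥0 → ℝ) (t : ℝ≥0) : ℝ := 1 - Real.exp (-s t)

/-- The regularity of almost every path of an unbounded subordinator. -/
structure IsRegularPath (s : ℝ≥0 → ℝ) : Prop where
  zero : s 0 = 0
  monotone : Monotone s
  right_continuous : ∀ t, ContinuousWithinAt s (Set.Ici t) t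
  tendsto_atTop : Tendsto s atTop atTop

/-- The `k`-th interval of the `h`-skeleton of a path. -/
def skeletonInterval (s : ℝ≥0 → ℝ) (h : ℝ≥0) (k : ℕ) : Set ℝ :=
  Set.Ioc (pathPoint s (k * h)) (pathPoint s ((k + 1 : ℕ) * h))

/-- The indices of the intervals of the `h`-skeleton that are hit by `X`. -/
def hitSet (s : ℝ≥0 → ℝ) (h : ℝ≥0) (X : Set ℝ) : Set ℕ :=
  {k | (X ∩ skeletonInterval s h k).Nonempty}

variable {s : ℝ≥0 → ℝ} {X : Set ℝ} {h : ℝ≥0} {u : ℕ → ℝ≥0}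

theorem pathPoint_lt_one (s : ℝ≥0 → ℝ) (t : ℝ≥0) : pathPoint s t < 1 := by
  unfold pathPoint
  linarith [Real.exp_pos (-s t)]

theorem IsRegularPath.monotone_pathPoint (hs : IsRegularPath s) : Monotone (pathPoint s) := by
  intro a b hab
  have := hs.monotone hab
  unfold pathPoint
  gcongr

theorem IsRegularPath.monotone_skeleton (hs : IsRegularPath s) (h : ℝ≥0) :
    Monotone fun k : ℕ => pathPoint s (k * h) := fun a b hab =>
  hs.monotone_pathPoint (by gcongr)

theorem IsRegularPath.pathPoint_zero (hs : IsRegularPath s) : pathPoint s 0 = 0 := by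
  simp [pathPoint, hs.zero]

theorem IsRegularPath.exists_mem_skeletonInterval (hs : IsRegularPath s) (hh : 0 < h) {x : ℝ}
    (hx : x ∈ Set.Ioo (0 : ℝ) 1) : ∃ k, x ∈ skeletonInterval s h k := by
  have h1 : Tendsto (fun k : ℕ => pathPoint s (k * h)) atTop (𝓝 1) := by
    have h2 : Tendsto (fun k : ℕ => (k : ℝ≥0) * h) atTop atTop :=
      tendsto_natCast_atTop_atTop.atTop_mul_const hh
    have h3 := (Real.tendsto_exp_neg_atTop_nhds_zero.comp
      (hs.tendsto_atTop.comp h2)).const_sub 1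
    simpa [pathPoint] using h3
  have h2 : ∃ k : ℕ, x ≤ pathPoint s (k * h) :=
    ((h1.eventually (lt_mem_nhds hx.2)).exists).imp fun k hk => hk.le
  classical
  have h3 := Nat.find_spec h2
  have h4 : Nat.find h2 ≠ 0 := fun h0 => by
    rw [h0] at h3
    simp only [Nat.cast_zero, zero_mul, hs.pathPoint_zero] at h3
    exact hx.1.not_ge h3
  obtain ⟨k, hk⟩ := Nat.exists_eq_succ_of_ne_zero h4
  refine ⟨k, not_le.1 (Nat.find_min h2 (m := k) (by omega)), ?_⟩
  rw [hk] at h3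
  exact h3

/-- Some path point at a time `t` lies in `(x, y)`; the skeleton times `⌈t/u⌉ u` tend to `t` from
the right, where the path is continuous. -/
theorem IsRegularPath.eventually_exists_skeleton_mem_Ioo (hs : IsRegularPath s)
    (hu : ∀ n, 0 < u n) (hu0 : Tendsto u atTop (𝓝 0)) {x y z : ℝ}
    (hz : z ∈ closure (Set.range (pathPoint s))) (hxz : x < z) (hzy : z < y) :
    ∀ᶠ n in atTop, ∃ k : ℕ, pathPoint s (k * u n) ∈ Set.Ioo x y := by
  obtain ⟨_, hw, ⟨t, rfl⟩⟩ := mem_closure_iff.1 hz (Set.Ioo x y) isOpen_Ioo ⟨hxz, hzy⟩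
  have hc : ContinuousWithinAt (pathPoint s) (Set.Ici t) t :=
    (hs.right_continuous t).neg.rexp.const_sub 1
  have h1 : Tendsto (fun n => (⌈t / u n⌉₊ : ℝ≥0) * u n) atTop (𝓝[≥] t) := by
    refine tendsto_nhdsWithin_iff.2 ⟨?_, Eventually.of_forall fun n => ?_⟩
    · refine tendsto_of_tendsto_of_tendsto_of_le_of_le tendsto_const_nhds
        (by simpa using hu0.const_add t) (fun n => ?_) fun n => ?_
      · exact (div_le_iff₀ (hu n)).1 (Nat.le_ceil _)
      · have h2 := (Nat.ceil_lt_add_one (zero_le (a := t / u n))).le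
        calc (⌈t / u n⌉₊ : ℝ≥0) * u n ≤ (t / u n + 1) * u n := by gcongr
          _ = t + u n := by rw [add_mul, div_mul_cancel₀ _ (hu n).ne', one_mul]
    · exact (div_le_iff₀ (hu n)).1 (Nat.le_ceil _)
  filter_upwards [(hc.tendsto.comp h1).eventually (Ioo_mem_nhds hw.1 hw.2)] with n hn
  exact ⟨_, hn⟩

theorem ncard_image_eq_of_iff {α β γ : Type*} {f : α → β} {g : α → γ} {A : Set α}
    (h : ∀ x ∈ A, ∀ y ∈ A, f x = f y ↔ g x = g y) : (f '' A).ncard = (g '' A).ncard := by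
  refine Set.ncard_congr (fun b hb => g hb.choose) (fun b hb => ?_) (fun b c hb hc hbc => ?_)
    fun c hc => ?_
  · exact ⟨_, hb.choose_spec.1, rfl⟩
  · rw [← hb.choose_spec.2, ← hc.choose_spec.2]
    exact (h _ hb.choose_spec.1 _ hc.choose_spec.1).2 hbc
  · obtain ⟨x, hx, rfl⟩ := hc
    have hb : f x ∈ f '' A := ⟨x, hx, rfl⟩
    exact ⟨f x, hb, (h _ hb.choose_spec.1 _ hx).1 hb.choose_spec.2⟩

/-- Skeleton points belong to the range, so sample points in different skeleton intervals are in
different blocks. Conversely, if the range meets `[x, y]` it does so strictly inside, as `X` avoids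
it, and a fine skeleton separates `x` from `y`. A finite `X` has finitely many pairs to separate. -/
theorem IsRegularPath.eventually_ncard_hitSet (hs : IsRegularPath s)
    (hu : ∀ n, 0 < u n) (hu0 : Tendsto u atTop (𝓝 0)) (hX : X.Finite)
    (hX01 : X ⊆ Set.Ioo 0 1) (hXR : Disjoint X (closure (Set.range (pathPoint s)))) :
    ∀ᶠ n in atTop,
      (hitSet s (u n) X).ncard = blockCount (closure (Set.range (pathPoint s))) X := by
  set R := closure (Set.range (pathPoint s))
  have hlt : ∀ᶠ n in atTop, ∀ x ∈ X, ∀ y ∈ X, x < y → ¬Disjoint (Set.uIcc x y) R →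
      ∃ k : ℕ, pathPoint s (k * u n) ∈ Set.Ioo x y := by
    refine (eventually_all_finite hX).2 fun x hx => (eventually_all_finite hX).2 fun y hy => ?_
    by_cases hxy : x < y ∧ ¬Disjoint (Set.uIcc x y) R
    · obtain ⟨z, hz1, hz2⟩ := Set.not_disjoint_iff.1 hxy.2
      rw [Set.uIcc_of_le hxy.1.le] at hz1
      have hzx : x ≠ z := fun h => (Set.disjoint_left.1 hXR hx) (h ▸ hz2)
      have hzy : z ≠ y := fun h => (Set.disjoint_left.1 hXR hy) (h ▸ hz2)
      filter_upwards [hs.eventually_exists_skeleton_mem_Ioo hu hu0 hz2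
        (lt_of_le_of_ne hz1.1 hzx) (lt_of_le_of_ne hz1.2 hzy)] with n hn _ _
      exact hn
    · exact Eventually.of_forall fun n h1 h2 => absurd ⟨h1, h2⟩ hxy
  filter_upwards [hlt] with n hn
  -- The index of the interval containing `x`, with an arbitrary value off `X`.
  have hκ : ∀ x : ℝ, ∃ k, x ∈ X → x ∈ skeletonInterval s (u n) k := fun x => by
    by_cases hx : x ∈ X
    · exact (hs.exists_mem_skeletonInterval (hu n) (hX01 hx)).imp fun k hk _ => hk
    · exact ⟨0, fun h => absurd h hx⟩
  choose κ hκ using hκ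
  have hmono := hs.monotone_skeleton (u n)
  have key : ∀ k l : ℕ, ∀ x ∈ skeletonInterval s (u n) k, ∀ y ∈ skeletonInterval s (u n) l,
      k < l → x ≤ pathPoint s (l * u n) ∧ pathPoint s (l * u n) < y := fun k l x hx y hy hkl =>
    ⟨hx.2.trans (hmono (Nat.succ_le_of_lt hkl)), hy.1⟩
  have himg : hitSet s (u n) X = κ '' X := by
    ext k
    constructor
    · rintro ⟨x, hx, hxk⟩
      refine ⟨x, hx, ?_⟩
      by_contra hne
      rcases lt_or_gt_of_ne hne with h | h
      · have := key _ _ x (hκ x hx) x hxk h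
        exact absurd this.2 this.1.not_gt
      · have := key _ _ x hxk x (hκ x hx) h
        exact absurd this.2 this.1.not_gt
    · rintro ⟨x, hx, rfl⟩
      exact ⟨x, hx, hκ x hx⟩
  have hmemR : ∀ l : ℕ, pathPoint s (l * u n) ∈ R := fun l => subset_closure ⟨_, rfl⟩
  have hsep : ∀ x ∈ X, ∀ y ∈ X, x < y → (κ x = κ y ↔ (blockSetoid R).r x y) := by
    intro x hx y hy hxy
    constructor
    · intro hk
      refine Or.inr (by_contra fun hd => ?_)
      obtain ⟨k, hk1, hk2⟩ := hn x hx y hy hxy hd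
      have h1 : κ x < k := by
        by_contra hle
        exact absurd ((hmono (not_lt.1 hle)).trans_lt (hκ x hx).1) hk1.not_gt
      have h2 : pathPoint s (k * u n) < pathPoint s ((κ y + 1 : ℕ) * u n) :=
        hk2.trans_le (hκ y hy).2
      have h3 : k < κ y + 1 := by
        by_contra hle
        exact absurd (hmono (not_lt.1 hle)) h2.not_ge
      omega
    · rintro (rfl | hd)
      · rfl
      · by_contra hne
        rw [Set.uIcc_of_le hxy.le] at hd
        rcases lt_or_gt_of_ne hne with h | h
        · have := key _ _ x (hκ x hx) y (hκ y hy) h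
          exact Set.disjoint_left.1 hd ⟨this.1, this.2.le⟩ (hmemR _)
        · have := key _ _ y (hκ y hy) x (hκ x hx) h
          linarith
  rw [himg, blockCount]
  refine ncard_image_eq_of_iff fun x hx y hy => ?_
  rw [Quotient.eq (r := blockSetoid R)]
  rcases lt_trichotomy x y with h | rfl | h
  · exact hsep x hx y hy h
  · exact ⟨fun _ => (blockSetoid R).refl x, fun _ => rfl⟩
  · rw [eq_comm, hsep y hy x hx h]
    exact ⟨fun h => (blockSetoid R).symm h, fun h => (blockSetoid R).symm h⟩

/-- The skeleton intervals are disjoint, so choosing one sample point in each hit interval is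
injective. The bound is uniform in the mesh and serves for domination. -/
theorem IsRegularPath.hitSet_finite (hs : IsRegularPath s) (h : ℝ≥0) (hX : X.Finite) :
    (hitSet s h X).Finite ∧ (hitSet s h X).ncard ≤ X.ncard := by
  have hg : ∀ k ∈ hitSet s h X, ∃ x, x ∈ X ∧ x ∈ skeletonInterval s h k := fun k hk => hk
  choose! g hg1 hg2 using hg
  have hinj : Set.InjOn g (hitSet s h X) := by
    intro k hk l hl hkl
    have hmono := hs.monotone_skeleton h
    have h1 := hg2 k hk
    have h2 := hg2 l hl
    rw [← hkl] at h2
    by_contra hne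
    rcases lt_or_gt_of_ne hne with h | h
    · exact absurd (h1.2.trans (hmono (Nat.succ_le_of_lt h))) h2.1.not_ge
    · exact absurd (h2.2.trans (hmono (Nat.succ_le_of_lt h))) h1.1.not_ge
  exact ⟨Set.Finite.of_injOn hg1 hinj hX, Set.ncard_le_ncard_of_injOn g hg1 hinj hX⟩

/-- Links the two descriptions of binomial moments: sums of products over `m`-subsets, and binomial
coefficients of a count. -/
theorem esymmRange_indicator (A : Set ℕ) [DecidablePred (· ∈ A)] (m M : ℕ) :
    esymmRange (fun k => if k ∈ A then 1 else 0) m M =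
      (((Finset.range M).filter (· ∈ A)).card.choose m : ℝ≥0∞) := by
  unfold esymmRange
  simp_rw [Finset.prod_boole]
  rw [Finset.sum_boole, ← Finset.card_powersetCard]
  congr 2
  ext T
  simp only [Finset.mem_filter, Finset.mem_powersetCard, Finset.subset_iff, Finset.mem_range]
  grind

theorem iSup_choose_card_filter {A : Set ℕ} [DecidablePred (· ∈ A)] (hA : A.Finite) (m : ℕ) :
    ⨆ M, (((Finset.range M).filter (· ∈ A)).card.choose m : ℝ≥0∞) = (A.ncard.choose m : ℝ≥0∞) := by
  have hsub : ∀ M, (((Finset.range M).filter (· ∈ A) : Finset ℕ) : Set ℕ) ⊆ A := fun M k hk => by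
    simp only [Finset.coe_filter] at hk
    exact hk.2
  refine le_antisymm (iSup_le fun M => ?_) ?_
  · refine Nat.cast_le.2 (Nat.choose_le_choose m ?_)
    rw [← Set.ncard_coe_finset]
    exact Set.ncard_le_ncard (hsub M) hA
  · obtain ⟨M, hM⟩ := hA.bddAbove
    refine le_iSup_of_le (M + 1) (Nat.cast_le.2 (Nat.choose_le_choose m ?_))
    rw [← Set.ncard_coe_finset]
    refine Set.ncard_le_ncard (fun k hk => ?_) (Finset.finite_toSet _)
    simpa using ⟨hM hk, hk⟩

end Path

/-! ### From skeleton counts to the number of blocks. -/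

section BlockMoments

variable {Ω : Type*} [MeasurableSpace Ω] {P : Measure Ω} [IsProbabilityMeasure P]
  {ν : Measure ℝ} {S : ℝ≥0 → Ω → ℝ} {X : Ω → Set ℝ} {ρ : ℝ}

theorem IsSubordinator.ae_isRegularPath (hS : IsSubordinator S ν P) (hν : ν ≠ 0) :
    ∀ᵐ ω ∂P, IsRegularPath fun t => S t ω := by
  filter_upwards [hS.zero, hS.monotone, hS.right_continuous, hS.tendsto_atTop hν]
    with ω h1 h2 h3 h4
  exact ⟨h1, h2, h3, h4⟩

theorem measurable_pathPoint (t : ℝ≥0) : Measurable fun s : ℝ≥0 → ℝ => pathPoint s t := by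
  unfold pathPoint
  fun_prop

theorem IsSubordinator.measure_forall_hitSet (hS : IsSubordinator S ν P) (hν : ν ≠ 0)
    (hρ : 0 < ρ)
    (hX : IsPoissonProcess X (ENNReal.ofReal ρ • volume.restrict (Set.Icc (0 : ℝ) 1)) P)
    (hSX : IndepOfProcess S X P) (h : ℝ≥0) (T : Finset ℕ) :
    NullMeasurableSet {ω | ∀ k ∈ T, k ∈ hitSet (fun t => S t ω) h (X ω)} P ∧
    P {ω | ∀ k ∈ T, k ∈ hitSet (fun t => S t ω) h (X ω)} =
      ∫⁻ ω, ∏ k ∈ T, skeletonHit S h ρ ω k ∂P := by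
  have h1 := measure_forall_hit hS.measurable hρ hX hSX (ι := T)
    (L := fun k s => pathPoint s ((k : ℕ) * h)) (R := fun k s => pathPoint s (((k : ℕ) + 1 : ℕ) * h))
    (fun k => measurable_pathPoint _) (fun k => measurable_pathPoint _)
    ((hS.ae_isRegularPath hν).mono fun ω hω k => ⟨?_, ?_, pathPoint_lt_one _ _⟩)
    ((hS.ae_isRegularPath hν).mono fun ω hω k l hkl => ?_)
  · have e1 : {ω | ∀ k ∈ T, k ∈ hitSet (fun t => S t ω) h (X ω)} =
        {ω | ∀ k : T, (X ω ∩ Set.Ioc (pathPoint (fun t => S t ω) ((k : ℕ) * h))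
          (pathPoint (fun t => S t ω) (((k : ℕ) + 1 : ℕ) * h))).Nonempty} := by
      ext ω
      simp [hitSet, skeletonInterval]
    rw [e1]
    refine ⟨h1.1, h1.2.trans (lintegral_congr fun ω => ?_)⟩
    refine Eq.trans (Finset.prod_congr rfl fun k _ => ?_)
      (Finset.prod_coe_sort T (skeletonHit S h ρ ω))
    rw [skeletonHit, pathPoint, pathPoint]
    ring_nf
  · rw [← hω.pathPoint_zero]
    exact hω.monotone_pathPoint zero_le
  · exact hω.monotone_skeleton h (Nat.le_succ _)
  · have hkl' : (k : ℕ) ≠ l := fun h => hkl (Subtype.ext h)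
    rcases lt_or_gt_of_ne hkl' with h' | h'
    · exact Or.inl (hω.monotone_skeleton h (Nat.succ_le_of_lt h'))
    · exact Or.inr (hω.monotone_skeleton h (Nat.succ_le_of_lt h'))

/-- `n.choose m ≤ 2 ^ n` and a Poisson variable has all exponential moments. The value `⊤`, sent to
`0` by `toNat`, has no mass. -/
theorem lintegral_toNat_choose_poisson_ne_top (c : ℝ≥0) (m : ℕ) :
    ∫⁻ n : ℕ∞, ((n.toNat.choose m : ℕ) : ℝ≥0∞) ∂((poissonMeasure c).map ((↑) : ℕ → ℕ∞)) ≠ ∞ := by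
  rw [lintegral_map (measurable_of_countable _) (measurable_of_countable _), lintegral_countable']
  have hs : Summable fun n : ℕ => Real.exp (-c) * ((2 * c) ^ n / n.factorial : ℝ) :=
    (Real.summable_pow_div_factorial _).mul_left _
  have h1 := hs.tsum_ofReal_ne_top
  refine ne_top_of_le_ne_top h1 (ENNReal.tsum_le_tsum fun n => ?_)
  rw [poissonMeasure_singleton, ENat.toNat_natCast, ← ENNReal.ofReal_natCast,
    ← ENNReal.ofReal_mul (Nat.cast_nonneg _)]
  refine ENNReal.ofReal_le_ofReal ?_
  have h2 : (n.choose m : ℝ) ≤ 2 ^ n := by exact_mod_cast Nat.choose_le_two_pow n m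
  calc (n.choose m : ℝ) * (Real.exp (-c) * c ^ n / n.factorial)
      ≤ 2 ^ n * (Real.exp (-c) * c ^ n / n.factorial) := by gcongr
    _ = Real.exp (-c) * ((2 * c) ^ n / n.factorial) := by ring

/-- The binomial coefficient is expanded over the `m`-subsets `T` of the first `M` indices. The
probability that all intervals in `T` are hit is the mean of a product of hit probabilities, by
independence of the sample and the path; then `M` tends to infinity. -/
theorem IsSubordinator.lintegral_choose_hitSet (hS : IsSubordinator S ν P) (hν : ν ≠ 0)
    (hρ : 0 < ρ)
    (hX : IsPoissonProcess X (ENNReal.ofReal ρ • volume.restrict (Set.Icc (0 : ℝ) 1)) P)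
    (hSX : IndepOfProcess S X P) (hXfin : ∀ᵐ ω ∂P, (X ω).Finite) (h : ℝ≥0) (m : ℕ) :
    AEMeasurable (fun ω => ((hitSet (fun t => S t ω) h (X ω)).ncard.choose m : ℝ≥0∞)) P ∧
    ∫⁻ ω, ((hitSet (fun t => S t ω) h (X ω)).ncard.choose m : ℝ≥0∞) ∂P =
      walkMoment (stepLaw S P h) m ρ := by
  classical
  have := hS.isProbabilityMeasure_stepLaw h
  let J : ℕ → Ω → ℝ≥0∞ := fun M ω =>
    esymmRange (fun k => if k ∈ hitSet (fun t => S t ω) h (X ω) then 1 else 0) m M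
  have hprod : ∀ (T : Finset ℕ) ω,
      ∏ k ∈ T, (if k ∈ hitSet (fun t => S t ω) h (X ω) then (1 : ℝ≥0∞) else 0) =
        {ω | ∀ k ∈ T, k ∈ hitSet (fun t => S t ω) h (X ω)}.indicator 1 ω := fun T ω => by
    rw [Finset.prod_boole, Set.indicator_apply]
    rfl
  have hT := fun T => hS.measure_forall_hitSet hν hρ hX hSX h T
  have hprodm : ∀ T : Finset ℕ, AEMeasurable (fun ω =>
      ∏ k ∈ T, (if k ∈ hitSet (fun t => S t ω) h (X ω) then (1 : ℝ≥0∞) else 0)) P := fun T => by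
    simp_rw [hprod]
    exact aemeasurable_one.indicator₀ (hT T).1
  have hJm : ∀ M, AEMeasurable (J M) P := fun M =>
    Finset.aemeasurable_fun_sum _ fun T _ => hprodm T
  have hJ : ∀ M, ∫⁻ ω, J M ω ∂P = chainMoment (stepLaw S P h) 1 m M ρ := by
    intro M
    have hsm : ∀ T : Finset ℕ, Measurable fun ω => ∏ k ∈ T, skeletonHit S h ρ ω k := fun T =>
      Finset.measurable_fun_prod _ fun k _ => measurable_hitProb.comp (by
        have := hS.measurable (k * h)
        have := hS.measurable ((k + 1 : ℕ) * h)
        fun_prop)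
    rw [← hS.lintegral_esymmRange_skeletonHit]
    simp only [J, esymmRange]
    rw [lintegral_finsetSum' _ fun T _ => hprodm T, lintegral_finsetSum _ fun T _ => hsm T]
    refine Finset.sum_congr rfl fun T _ => ?_
    simp_rw [hprod]
    rw [lintegral_indicator_one₀ (hT T).1, (hT T).2]
  have hJmono : ∀ ω, Monotone fun M => J M ω := fun ω a b hab => by
    simp only [J, esymmRange_indicator]
    exact Nat.cast_le.2 (Nat.choose_le_choose m (Finset.card_le_card
      (Finset.filter_subset_filter _ (Finset.range_mono hab))))
  have hsup : ∀ᵐ ω ∂P, ⨆ M, J M ω =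
      ((hitSet (fun t => S t ω) h (X ω)).ncard.choose m : ℝ≥0∞) := by
    filter_upwards [hS.ae_isRegularPath hν, hXfin] with ω h1 h2
    simp only [J, esymmRange_indicator]
    exact iSup_choose_card_filter (h1.hitSet_finite h h2).1 m
  refine ⟨(AEMeasurable.iSup hJm).congr (hsup.mono fun ω hω => by simpa using hω), ?_⟩
  rw [← lintegral_congr_ae hsup, lintegral_iSup' hJm (Eventually.of_forall hJmono)]
  simp_rw [hJ]
  rfl

/-- Trades intensity `ρ` on a piece of length at most `1/r` for intensity `r` on the whole gap, so
that the sum over gaps becomes a first moment at intensity `r`. The factor `2` comes from `min 1 x ≤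
2x / (1 + x) ≤ 2(1 - e^{-x})`. -/
theorem ofReal_min_le_hitProb {ρ r Δ : ℝ} (hρ : 0 ≤ ρ) (hr : 0 < r) (hΔ : 0 ≤ Δ) :
    ENNReal.ofReal (ρ * min r⁻¹ Δ) ≤ ENNReal.ofReal (2 * ρ / r) * hitProb (r * Δ) := by
  rw [hitProb, ← ENNReal.ofReal_mul (by positivity)]
  refine ENNReal.ofReal_le_ofReal ?_
  have h0 : 0 ≤ r * Δ := by positivity
  have h1 : Real.exp (-(r * Δ)) ≤ 1 / (1 + r * Δ) := by
    rw [Real.exp_neg, ← one_div]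
    exact one_div_le_one_div_of_le (by positivity) (by linarith [Real.add_one_le_exp (r * Δ)])
  have h2 : min 1 (r * Δ) ≤ 2 * (1 - Real.exp (-(r * Δ))) := by
    have h3 : min 1 (r * Δ) ≤ 2 * (r * Δ / (1 + r * Δ)) := by
      rw [← mul_div_assoc, le_div_iff₀ (by positivity)]
      rcases le_total 1 (r * Δ) with h | h
      · rw [min_eq_left h]
        linarith
      · rw [min_eq_right h]
        nlinarith
    have h4 : r * Δ / (1 + r * Δ) = 1 - 1 / (1 + r * Δ) := by
      field_simp
      ring
    rw [h4] at h3
    linarith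
  have h3 : min r⁻¹ Δ = r⁻¹ * min 1 (r * Δ) := by
    rw [mul_min_of_nonneg _ _ (by positivity : (0 : ℝ) ≤ r⁻¹), mul_one, inv_mul_cancel_left₀ hr.ne']
  rw [h3]
  calc ρ * (r⁻¹ * min 1 (r * Δ)) ≤ ρ * (r⁻¹ * (2 * (1 - Real.exp (-(r * Δ))))) := by gcongr
    _ = 2 * ρ / r * (1 - Real.exp (-(r * Δ))) := by
      field_simp

theorem IsSubordinator.measure_hit_le (hS : IsSubordinator S ν P)
    (hρ : 0 < ρ)
    (hX : IsPoissonProcess X (ENNReal.ofReal ρ • volume.restrict (Set.Icc (0 : ℝ) 1)) P)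
    (hSX : IndepOfProcess S X P) (h : ℝ≥0) (k : ℕ) {r : ℝ} (hr : 0 < r)
    {L R : (ℝ≥0 → ℝ) → ℝ} (hL : Measurable L) (hR : Measurable R)
    (hLR : ∀ᵐ ω ∂P, 0 ≤ L (fun t => S t ω) ∧ R (fun t => S t ω) < 1 ∧
      R (fun t => S t ω) - L (fun t => S t ω) = min r⁻¹ (pathPoint (fun t => S t ω) ((k + 1 : ℕ) * h)
        - pathPoint (fun t => S t ω) (k * h))) :
    P {ω | (X ω ∩ Set.Ioc (L fun t => S t ω) (R fun t => S t ω)).Nonempty} ≤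
      ENNReal.ofReal (2 * ρ / r) * ∫⁻ ω, skeletonHit S h r ω k ∂P := by
  have hΔ : ∀ᵐ ω ∂P, 0 ≤ pathPoint (fun t => S t ω) ((k + 1 : ℕ) * h) -
      pathPoint (fun t => S t ω) (k * h) := by
    filter_upwards [hS.monotone] with ω hω
    have : S (k * h) ω ≤ S ((k + 1 : ℕ) * h) ω := hω (by
      gcongr
      simp)
    unfold pathPoint
    simpa using this
  have h1 := (measure_forall_hit hS.measurable hρ hX hSX (ι := Unit) (L := fun _ => L)
    (R := fun _ => R) (fun _ => hL) (fun _ => hR) (by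
      filter_upwards [hLR, hΔ] with ω h1 h2 _
      refine ⟨h1.1, ?_, h1.2.1⟩
      have : 0 ≤ min r⁻¹ (pathPoint (fun t => S t ω) ((k + 1 : ℕ) * h) -
        pathPoint (fun t => S t ω) (k * h)) := le_min (by positivity) h2
      linarith [h1.2.2]) (Eventually.of_forall fun ω i j hij => absurd rfl hij)).2
  simp only [forall_const, Finset.univ_unique, Finset.prod_singleton] at h1
  rw [h1, ← lintegral_const_mul' _ _ ENNReal.ofReal_ne_top]
  refine lintegral_mono_ae ?_
  filter_upwards [hLR, hΔ] with ω h2 h3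
  rw [h2.2.2]
  refine (hitProb_le _).trans ((ofReal_min_le_hitProb hρ.le hr h3).trans_eq ?_)
  rw [skeletonHit, pathPoint, pathPoint]
  ring_nf

theorem IsSubordinator.tsum_lintegral_skeletonHit (hS : IsSubordinator S ν P) (h : ℝ≥0) (r : ℝ) :
    ∑' k, ∫⁻ ω, skeletonHit S h r ω k ∂P = walkMoment (stepLaw S P h) 1 r := by
  have hm : ∀ k, Measurable fun ω => skeletonHit S h r ω k := fun k =>
    measurable_hitProb.comp (by
      have := hS.measurable (k * h)
      have := hS.measurable ((k + 1 : ℕ) * h)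
      fun_prop)
  rw [ENNReal.tsum_eq_iSup_nat, walkMoment]
  congr 1
  ext1 M
  rw [← hS.lintegral_esymmRange_skeletonHit, ← lintegral_finsetSum _ fun k _ => hm k]
  simp [esymmRange, Finset.powersetCard_one]

/-- A union bound over the two end pieces of each interval, each contributing `2ρ/r` times the hit
probability of the interval at intensity `r`. -/
theorem IsSubordinator.measure_skeleton_close_le (hS : IsSubordinator S ν P) (hν : ν ≠ 0)
    (hρ : 0 < ρ)
    (hX : IsPoissonProcess X (ENNReal.ofReal ρ • volume.restrict (Set.Icc (0 : ℝ) 1)) P)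
    (hSX : IndepOfProcess S X P) (h : ℝ≥0) {r : ℝ} (hr : 0 < r) :
    P {ω | ∃ k : ℕ, ∃ x ∈ X ω, x ∈ skeletonInterval (fun t => S t ω) h k ∧
      (x ≤ pathPoint (fun t => S t ω) (k * h) + r⁻¹ ∨
        pathPoint (fun t => S t ω) ((k + 1 : ℕ) * h) - r⁻¹ < x)} ≤
      ENNReal.ofReal (4 * ρ / r) * walkMoment (stepLaw S P h) 1 r := by
  let a : ℕ → (ℝ≥0 → ℝ) → ℝ := fun k s => pathPoint s (k * h)
  have ha : ∀ k, Measurable (a k) := fun k => measurable_pathPoint _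
  have hreg : ∀ᵐ ω ∂P, ∀ k, 0 ≤ a k (fun t => S t ω) ∧
      a k (fun t => S t ω) ≤ a (k + 1) (fun t => S t ω) ∧ a (k + 1) (fun t => S t ω) < 1 := by
    filter_upwards [hS.ae_isRegularPath hν] with ω hω k
    refine ⟨?_, hω.monotone_skeleton h (Nat.le_succ _), pathPoint_lt_one _ _⟩
    rw [← hω.pathPoint_zero]
    exact hω.monotone_pathPoint zero_le
  let A : ℕ → Set Ω := fun k => {ω | (X ω ∩ Set.Ioc (a k fun t => S t ω)
    (min (a k (fun t => S t ω) + r⁻¹) (a (k + 1) fun t => S t ω))).Nonempty}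
  let B : ℕ → Set Ω := fun k => {ω | (X ω ∩ Set.Ioc
    (max (a (k + 1) (fun t => S t ω) - r⁻¹) (a k fun t => S t ω))
    (a (k + 1) fun t => S t ω)).Nonempty}
  have hA : ∀ k, P (A k) ≤ ENNReal.ofReal (2 * ρ / r) * ∫⁻ ω, skeletonHit S h r ω k ∂P := fun k =>
    hS.measure_hit_le hρ hX hSX h k hr (L := a k) (R := fun s => min (a k s + r⁻¹) (a (k + 1) s))
      (ha k) (((ha k).add_const _).min (ha (k + 1))) (hreg.mono fun ω hω =>
        ⟨(hω k).1, (min_le_right _ _).trans_lt (hω k).2.2, by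
          rw [← min_sub_sub_right, add_sub_cancel_left]⟩)
  have hB : ∀ k, P (B k) ≤ ENNReal.ofReal (2 * ρ / r) * ∫⁻ ω, skeletonHit S h r ω k ∂P := fun k =>
    hS.measure_hit_le hρ hX hSX h k hr (L := fun s => max (a (k + 1) s - r⁻¹) (a k s))
      (R := a (k + 1)) (((ha (k + 1)).sub_const _).max (ha k)) (ha _) (hreg.mono fun ω hω =>
        ⟨(hω k).1.trans (le_max_right _ _), (hω k).2.2, by
          rw [← min_sub_sub_left, sub_sub_cancel]⟩)
  calc P _ ≤ P (⋃ k, A k ∪ B k) := by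
        refine measure_mono ?_
        rintro ω ⟨k, x, hx, hxk, h1 | h1⟩
        · exact Set.mem_iUnion.2 ⟨k, Or.inl ⟨x, hx, hxk.1, le_min h1 hxk.2⟩⟩
        · exact Set.mem_iUnion.2 ⟨k, Or.inr ⟨x, hx, max_lt h1 hxk.1, hxk.2⟩⟩
    _ ≤ ∑' k, P (A k ∪ B k) := measure_iUnion_le _
    _ ≤ ∑' k, ENNReal.ofReal (4 * ρ / r) * ∫⁻ ω, skeletonHit S h r ω k ∂P := by
        refine ENNReal.tsum_le_tsum fun k => ?_
        refine ((measure_union_le _ _).trans (add_le_add (hA k) (hB k))).trans_eq ?_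
        rw [← add_mul, ← ENNReal.ofReal_add (by positivity) (by positivity)]
        ring_nf
    _ = _ := by rw [ENNReal.tsum_mul_left, hS.tsum_lintegral_skeletonHit]

theorem IsRegularPath.eventually_close {s : ℝ≥0 → ℝ} (hs : IsRegularPath s) {u : ℕ → ℝ≥0}
    (hu : ∀ n, 0 < u n) (hu0 : Tendsto u atTop (𝓝 0)) {x ε : ℝ} (hx : x ∈ Set.Ioo (0 : ℝ) 1)
    (hxR : x ∈ closure (Set.range (pathPoint s))) (hε : 0 < ε) :
    ∀ᶠ n in atTop, ∃ k : ℕ, x ∈ skeletonInterval s (u n) k ∧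
      (x ≤ pathPoint s (k * u n) + ε ∨ pathPoint s ((k + 1 : ℕ) * u n) - ε < x) := by
  filter_upwards [hs.eventually_exists_skeleton_mem_Ioo hu hu0 hxR (sub_lt_self x hε)
    (lt_add_of_pos_right x hε)] with n hn
  obtain ⟨j, hj1, hj2⟩ := hn
  obtain ⟨k, hk⟩ := hs.exists_mem_skeletonInterval (hu n) hx
  refine ⟨k, hk, ?_⟩
  -- The skeleton point close to `x` lies at or before the left end of the interval of `x`, or at or
  -- after its right end; that end is then at least as close on its side.
  rcases le_or_gt j k with hjk | hjk
  · left
    have := hs.monotone_skeleton (u n) hjk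
    dsimp only at this
    linarith
  · right
    have := hs.monotone_skeleton (u n) (Nat.succ_le_of_lt hjk)
    simp only [Nat.succ_eq_add_one] at this
    linarith

omit [IsProbabilityMeasure P] in
theorem ae_subset_Ioo (hX : IsPoissonProcess X
    (ENNReal.ofReal ρ • volume.restrict (Set.Icc (0 : ℝ) 1)) P) :
    ∀ᵐ ω ∂P, X ω ⊆ Set.Ioo 0 1 := by
  have h0 : (ENNReal.ofReal ρ • volume.restrict (Set.Icc (0 : ℝ) 1)) (Set.Ioo (0 : ℝ) 1)ᶜ = 0 := by
    rw [Measure.smul_apply, ← restrict_Ioo_eq_restrict_Icc,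
      Measure.restrict_apply measurableSet_Ioo.compl]
    simp
  have h1 := hX.measure_nonempty measurableSet_Ioo.compl (by rw [h0]; simp)
  rw [h0] at h1
  have h2 : P {ω | (X ω ∩ (Set.Ioo 0 1)ᶜ).Nonempty} = 0 := by
    rw [h1]
    simp [hitProb]
  have h3 := measure_eq_zero_iff_ae_notMem.1 h2
  filter_upwards [h3] with ω hω x hx
  by_contra hx'
  exact hω ⟨x, hx, hx'⟩

/-- Almost surely, no sample point belongs to the closed range. -/
theorem IsSubordinator.ae_disjoint (hS : IsSubordinator S ν P) (hν : ν ≠ 0)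
    (hρ : 0 < ρ)
    (hX : IsPoissonProcess X (ENNReal.ofReal ρ • volume.restrict (Set.Icc (0 : ℝ) 1)) P)
    (hSX : IndepOfProcess S X P) {u : ℕ → ℝ≥0} (hu : ∀ n, 0 < u n)
    (hu0 : Tendsto u atTop (𝓝 0)) :
    ∀ᵐ ω ∂P, Disjoint (X ω) (closure (Set.range (pathPoint fun t => S t ω))) := by
  let E : ℝ → ℕ → Set Ω := fun r n =>
    {ω | ∃ k : ℕ, ∃ x ∈ X ω, x ∈ skeletonInterval (fun t => S t ω) (u n) k ∧
      (x ≤ pathPoint (fun t => S t ω) (k * u n) + r⁻¹ ∨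
        pathPoint (fun t => S t ω) ((k + 1 : ℕ) * u n) - r⁻¹ < x)}
  let N : Set Ω := {ω | ¬Disjoint (X ω) (closure (Set.range (pathPoint fun t => S t ω)))}
  -- A sample point in the range stays within `1/r` of an endpoint of its interval for all fine
  -- meshes.
  have hNE : ∀ r, 0 < r → ∀ᵐ ω ∂P, ω ∈ N → ω ∈ ⋃ j, ⋂ n ≥ j, E r n := by
    intro r hr
    filter_upwards [hS.ae_isRegularPath hν, ae_subset_Ioo hX] with ω hω h01 hN
    obtain ⟨x, hx, hxR⟩ := Set.not_disjoint_iff.1 hN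
    obtain ⟨j, hj⟩ := eventually_atTop.1
      (hω.eventually_close hu hu0 (h01 hx) hxR (inv_pos.2 hr))
    refine Set.mem_iUnion.2 ⟨j, Set.mem_iInter₂.2 fun n hn => ?_⟩
    obtain ⟨k, hk⟩ := hj n hn
    exact ⟨k, x, hx, hk⟩
  -- The mesh tends to `0` with `r` fixed; only afterwards does `r` tend to infinity.
  have hPN : ∀ r, 0 < r → P N ≤
      ENNReal.ofReal (4 * ρ) * (potential S P (psi ν) r / ENNReal.ofReal r) := by
    intro r hr
    have h1 : P N ≤ P (⋃ j, ⋂ n ≥ j, E r n) := measure_mono_ae (hNE r hr)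
    refine h1.trans ?_
    have hmono : Monotone fun j => ⋂ n ≥ j, E r n := fun i j hij =>
      Set.biInter_subset_biInter_left fun n hn => hij.trans hn
    rw [hmono.measure_iUnion]
    refine iSup_le fun j => ?_
    have hlim := ENNReal.Tendsto.const_mul (a := ENNReal.ofReal (4 * ρ / r))
      (hS.tendsto_potential_upperKernel hν hu hu0 (m := 0) (F := fun _ => 1) (fun z _ => by
        have := fun n => hS.isProbabilityMeasure_stepLaw (u n)
        simp_rw [walkMoment_zero]
        exact tendsto_const_nhds) hr) (Or.inr ENNReal.ofReal_ne_top)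
    simp only [mul_one] at hlim
    have h2 : ENNReal.ofReal (4 * ρ / r) * potential S P (fun z => psi ν z) r =
        ENNReal.ofReal (4 * ρ) * (potential S P (psi ν) r / ENNReal.ofReal r) := by
      rw [ENNReal.ofReal_div_of_pos hr, div_eq_mul_inv, div_eq_mul_inv]
      ring
    rw [h2] at hlim
    refine ge_of_tendsto hlim ?_
    filter_upwards [eventually_ge_atTop j] with n hn
    refine (measure_mono (Set.biInter_subset_of_mem hn)).trans ?_
    refine (hS.measure_skeleton_close_le hν hρ hX hSX (u n) hr).trans ?_
    exact mul_le_mul_right (hS.walkMoment_le_potential hν (hu n) 0 hr) _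
  have hlim := ENNReal.Tendsto.const_mul (a := ENNReal.ofReal (4 * ρ))
    (hS.tendsto_potential_psi_div hν) (Or.inr ENNReal.ofReal_ne_top)
  rw [mul_zero] at hlim
  have h0 : P N = 0 := le_antisymm (ge_of_tendsto hlim
    ((eventually_gt_atTop 0).mono fun r hr => hPN r hr)) zero_le
  simpa [N] using measure_eq_zero_iff_ae_notMem.1 h0

/-- The skeleton count equals the number of blocks for all fine meshes, almost surely, and its
binomial coefficients are dominated by those of the number of sample points, which are integrable.
-/
theorem IsSubordinator.tendsto_walkMoment (hS : IsSubordinator S ν P) (hν : ν ≠ 0)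
    (hρ : 0 < ρ)
    (hX : IsPoissonProcess X (ENNReal.ofReal ρ • volume.restrict (Set.Icc (0 : ℝ) 1)) P)
    (hSX : IndepOfProcess S X P) {u : ℕ → ℝ≥0} (hu : ∀ n, 0 < u n)
    (hu0 : Tendsto u atTop (𝓝 0)) (m : ℕ) :
    AEMeasurable (fun ω => ((compositionLength S X ω).choose m : ℝ≥0∞)) P ∧
    Tendsto (fun n => walkMoment (stepLaw S P (u n)) m ρ) atTop
      (𝓝 (∫⁻ ω, ((compositionLength S X ω).choose m : ℝ≥0∞) ∂P)) := by
  have hμ : (ENNReal.ofReal ρ • volume.restrict (Set.Icc (0 : ℝ) 1)) Set.univ ≠ ∞ := by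
    rw [Measure.smul_apply, smul_eq_mul]
    exact ENNReal.mul_ne_top ENNReal.ofReal_ne_top (measure_ne_top _ _)
  have hfin := hX.ae_finite hμ
  have hK := fun n => hS.lintegral_choose_hitSet hν hρ hX hSX hfin (u n) m
  have hlim : ∀ᵐ ω ∂P, Tendsto (fun n =>
      ((hitSet (fun t => S t ω) (u n) (X ω)).ncard.choose m : ℝ≥0∞)) atTop
      (𝓝 ((compositionLength S X ω).choose m : ℝ≥0∞)) := by
    filter_upwards [hS.ae_isRegularPath hν, hfin, ae_subset_Ioo hX,
      hS.ae_disjoint hν hρ hX hSX hu hu0] with ω h1 h2 h3 h4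
    refine tendsto_nhds_of_eventually_eq ?_
    filter_upwards [h1.eventually_ncard_hitSet hu hu0 h2 h3 h4] with n hn
    rw [hn]
    rfl
  refine ⟨aemeasurable_of_tendsto_metrizable_ae atTop (fun n => (hK n).1) hlim, ?_⟩
  simp_rw [← fun n => (hK n).2]
  refine tendsto_lintegral_of_dominated_convergence'
    (fun ω => (((X ω ∩ Set.univ).encard.toNat.choose m : ℕ) : ℝ≥0∞)) (fun n => (hK n).1)
    (fun n => ?_) ?_ hlim
  · filter_upwards [hS.ae_isRegularPath hν, hfin] with ω h1 h2
    rw [Set.inter_univ]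
    exact Nat.cast_le.2 (Nat.choose_le_choose m (h1.hitSet_finite (u n) h2).2)
  · have hl := hX.count_law Set.univ MeasurableSet.univ hμ
    have h1 := lintegral_map' (μ := P) (f := fun n : ℕ∞ => ((n.toNat.choose m : ℕ) : ℝ≥0∞))
      (measurable_of_countable _).aemeasurable hl.aemeasurable
    rw [← h1, hl.map_eq]
    exact lintegral_toNat_choose_poisson_ne_top _ m

end BlockMoments

/-! ### Regular variation at infinity and Potter bounds. -/

section RegularVariation

/-- Regular variation at `∞` with index `β`. -/
structure IsRegularlyVarying (g : ℝ → ℝ) (β : ℝ) : Prop where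
  eventually_pos : ∀ᶠ r in atTop, 0 < g r
  tendsto_ratio : ∀ c : ℝ, 0 < c → Tendsto (fun r => g (c * r) / g r) atTop (𝓝 (c ^ β))

variable {f g : ℝ → ℝ} {β γ : ℝ}

theorem IsRegularlyVarying.mul (hf : IsRegularlyVarying f β) (hg : IsRegularlyVarying g γ) :
    IsRegularlyVarying (fun r => f r * g r) (β + γ) := by
  refine ⟨?_, fun c hc => ?_⟩
  · filter_upwards [hf.eventually_pos, hg.eventually_pos] with r h1 h2
    exact mul_pos h1 h2
  · rw [Real.rpow_add hc]
    refine ((hf.tendsto_ratio c hc).mul (hg.tendsto_ratio c hc)).congr fun r => ?_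
    rw [div_mul_div_comm]

theorem IsRegularlyVarying.pow (hf : IsRegularlyVarying f β) (m : ℕ) :
    IsRegularlyVarying (fun r => f r ^ m) (β * m) := by
  refine ⟨hf.eventually_pos.mono fun r hr => pow_pos hr m, fun c hc => ?_⟩
  rw [Real.rpow_mul hc.le, Real.rpow_natCast]
  refine ((hf.tendsto_ratio c hc).pow m).congr fun r => ?_
  rw [div_pow]

theorem tendsto_comp_mul_atTop {l : Filter ℝ} (hf : Tendsto f atTop l) {c : ℝ} (hc : 0 < c) :
    Tendsto (fun r => f (c * r)) atTop l :=
  hf.comp (tendsto_id.const_mul_atTop hc)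

theorem IsRegularlyVarying.of_tendsto_div (hg : IsRegularlyVarying g β) {a : ℝ} (ha : 0 < a)
    (h : Tendsto (fun r => f r / g r) atTop (𝓝 a)) : IsRegularlyVarying f β := by
  have hpos : ∀ᶠ r in atTop, 0 < f r := by
    filter_upwards [h.eventually (lt_mem_nhds ha), hg.eventually_pos] with r h1 h2
    exact (div_pos_iff_of_pos_right h2).1 h1
  refine ⟨hpos, fun c hc => ?_⟩
  have h1 := ((tendsto_comp_mul_atTop h hc).div h ha.ne').mul (hg.tendsto_ratio c hc)
  rw [div_self ha.ne', one_mul] at h1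
  refine h1.congr' ?_
  have hgc : ∀ᶠ r in atTop, 0 < g (c * r) :=
    (tendsto_id.const_mul_atTop hc).eventually hg.eventually_pos
  filter_upwards [hpos, hg.eventually_pos, hgc] with r h2 h3 h4
  simp only [Pi.div_apply]
  field_simp

/-- Otherwise monotonicity would give a finite positive limit and the ratio at `c = 2` would tend to
`1`, not to `2^β`. -/
theorem IsRegularlyVarying.tendsto_atTop (hg : IsRegularlyVarying g β) (hβ : 0 < β)
    (hmono : MonotoneOn g (Set.Ici 0)) : Tendsto g atTop atTop := by
  have h1 : Monotone fun r => g (max r 0) := fun a b hab =>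
    hmono (Set.mem_Ici.2 (le_max_right a 0)) (Set.mem_Ici.2 (le_max_right b 0))
      (max_le_max_right 0 hab)
  have h2 : (fun r => g (max r 0)) =ᶠ[atTop] g := by
    filter_upwards [eventually_ge_atTop 0] with r hr
    rw [max_eq_left hr]
  rcases tendsto_atTop_of_monotone h1 with h | ⟨l, h⟩
  · exact h.congr' h2
  · exfalso
    have h3 : Tendsto g atTop (𝓝 l) := h.congr' h2
    have hl : 0 < l := by
      obtain ⟨r, hr, hr0⟩ := (hg.eventually_pos.and (eventually_ge_atTop 0)).exists
      refine hr.trans_le (ge_of_tendsto h3 ?_)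
      filter_upwards [eventually_ge_atTop r] with x hx
      exact hmono hr0 (hr0.trans hx) hx
    have h4 := (tendsto_comp_mul_atTop h3 two_pos).div h3 hl.ne'
    have h5 := tendsto_nhds_unique h4 (hg.tendsto_ratio 2 two_pos)
    rw [div_self hl.ne'] at h5
    exact absurd h5 (Real.one_lt_rpow one_lt_two hβ).ne

/-- A Potter-type bound for monotone regularly varying functions. -/
theorem IsRegularlyVarying.exists_le_rpow_mul (hg : IsRegularlyVarying g β) {b C : ℝ}
    (hγ : 0 < γ) (hγβ : γ < β) (hγb : γ ≤ b) (hmono : MonotoneOn g (Set.Ici 0))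
    (hC : ∀ r, 0 < r → g r ≤ C * r ^ b) :
    ∃ K R : ℝ, 0 < R ∧ ∀ r, R ≤ r → 0 < g r ∧ ∀ z, 0 < z → z ≤ 1 → g (r * z) ≤ K * z ^ γ * g r := by
  -- Since `γ < β`, halving a large argument multiplies `g` by at most `(1/2)^γ`.
  have h2 : (1 / 2 : ℝ) ^ β < (1 / 2 : ℝ) ^ γ :=
    Real.rpow_lt_rpow_of_exponent_gt (by norm_num) (by norm_num) hγβ
  have h3 : ∀ᶠ r in atTop, 0 < r ∧ 0 < g r ∧ g (1 / 2 * r) ≤ (1 / 2) ^ γ * g r := by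
    filter_upwards [(hg.tendsto_ratio (1 / 2) (by norm_num)).eventually (gt_mem_nhds h2),
      hg.eventually_pos, eventually_gt_atTop 0] with r h3 h4 h5
    exact ⟨h5, h4, ((div_lt_iff₀ h4).1 h3).le⟩
  obtain ⟨R, hR⟩ := eventually_atTop.1 h3
  have hR0 : 0 < R := (hR R le_rfl).1
  -- Induction on the number of halvings that lead from `r` to the vicinity of `r z`; the factor
  -- `2^γ` absorbs the last incomplete halving.
  have hstep : ∀ k : ℕ, ∀ r z : ℝ, 0 < z → z ≤ 1 → R ≤ r * z → (1 / 2 : ℝ) ^ (k + 1) < z →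
      g (r * z) ≤ 2 ^ γ * z ^ γ * g r := by
    have hbase : ∀ r z : ℝ, 0 < z → z ≤ 1 → R ≤ r * z → 1 / 2 < z →
        g (r * z) ≤ 2 ^ γ * z ^ γ * g r := by
      intro r z hz hz1 hRz h
      have hr : 0 < r := pos_of_mul_pos_left (hR0.trans_le hRz) hz.le
      have hle : r * z ≤ r := mul_le_of_le_one_right hr.le hz1
      have h5 : 1 ≤ (2 : ℝ) ^ γ * z ^ γ := by
        rw [← Real.mul_rpow two_pos.le hz.le]
        exact Real.one_le_rpow (by linarith) hγ.le
      calc g (r * z) ≤ g r := hmono (Set.mem_Ici.2 (by positivity)) hr.le hle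
        _ ≤ _ := le_mul_of_one_le_left (hR r (hRz.trans hle)).2.1.le h5
    intro k
    induction k with
    | zero =>
      intro r z hz hz1 hRz h
      exact hbase r z hz hz1 hRz (by simpa using h)
    | succ k ih =>
      intro r z hz hz1 hRz h
      rcases lt_or_ge (1 / 2) z with h' | h'
      · exact hbase r z hz hz1 hRz h'
      · have hr : 0 < r := pos_of_mul_pos_left (hR0.trans_le hRz) hz.le
        have hrz : 1 / 2 * r * (2 * z) = r * z := by ring
        have hle : r * z ≤ r := mul_le_of_le_one_right hr.le hz1
        have h5 := ih (1 / 2 * r) (2 * z) (by linarith) (by linarith) (by rwa [hrz])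
          (by rw [pow_succ] at h; linarith)
        rw [hrz, Real.mul_rpow two_pos.le hz.le] at h5
        refine h5.trans ?_
        have h6 := (hR r (hRz.trans hle)).2.2
        have h7 : (2 : ℝ) ^ γ * (1 / 2) ^ γ = 1 := by
          rw [← Real.mul_rpow two_pos.le (by norm_num)]
          norm_num
        calc (2 : ℝ) ^ γ * (2 ^ γ * z ^ γ) * g (1 / 2 * r)
            ≤ 2 ^ γ * (2 ^ γ * z ^ γ) * ((1 / 2) ^ γ * g r) := by gcongr
          _ = 2 ^ γ * (1 / 2) ^ γ * (2 ^ γ * z ^ γ * g r) := by ring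
          _ = _ := by rw [h7, one_mul]
  have hbig : ∀ r z : ℝ, 0 < z → z ≤ 1 → R ≤ r * z → g (r * z) ≤ 2 ^ γ * z ^ γ * g r := by
    intro r z hz hz1 hRz
    obtain ⟨k, hk⟩ := exists_pow_lt_of_lt_one hz (by norm_num : (1 / 2 : ℝ) < 1)
    refine hstep k r z hz hz1 hRz (lt_of_le_of_lt ?_ hk)
    exact pow_le_pow_of_le_one (by norm_num) (by norm_num) (Nat.le_succ k)
  have hgR : 0 < g R := (hR R le_rfl).2.1
  have hC0 : 0 ≤ C := by
    have := (hgR.le.trans (hC R hR0))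
    exact nonneg_of_mul_nonneg_left this (Real.rpow_pos_of_pos hR0 b)
  -- For `r z < R` regular variation says nothing and only `hC` applies. There `(rz)^b ≤ R^{b-γ}
  -- (rz)^γ` because `γ ≤ b`, and `r^γ` is at most a constant times `g r` by the bound at `z = R /
  -- r`.
  set D := C * R ^ (b - γ) * (2 ^ γ * R ^ γ / g R) with hD
  have hD0 : 0 ≤ D := by positivity
  refine ⟨2 ^ γ + D, R, hR0, fun r hr => ⟨(hR r hr).2.1, fun z hz hz1 => ?_⟩⟩
  have hr0 : 0 < r := hR0.trans_le hr
  have hgr := (hR r hr).2.1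
  have hzγ : 0 ≤ z ^ γ * g r := by positivity
  rcases le_or_gt R (r * z) with h | h
  · refine (hbig r z hz hz1 h).trans ?_
    nlinarith
  · have h1 : g R ≤ 2 ^ γ * (R / r) ^ γ * g r := by
      have := hbig r (R / r) (by positivity) ((div_le_one hr0).2 hr) (by field_simp; exact le_rfl)
      rwa [mul_div_cancel₀ _ hr0.ne'] at this
    have h2 : r ^ γ ≤ 2 ^ γ * R ^ γ / g R * g r := by
      rw [Real.div_rpow hR0.le hr0.le] at h1
      have hrγ : 0 < r ^ γ := by positivity
      rw [div_mul_eq_mul_div, le_div_iff₀ hgR]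
      calc r ^ γ * g R ≤ r ^ γ * (2 ^ γ * (R ^ γ / r ^ γ) * g r) := by gcongr
        _ = _ := by field_simp
    have h3 : (r * z) ^ b ≤ R ^ (b - γ) * (r * z) ^ γ := by
      have : b = (b - γ) + γ := by ring
      conv_lhs => rw [this, Real.rpow_add (by positivity)]
      gcongr
    calc g (r * z) ≤ C * (R ^ (b - γ) * (r * z) ^ γ) :=
          (hC _ (by positivity)).trans (by gcongr)
      _ = C * R ^ (b - γ) * z ^ γ * r ^ γ := by
          rw [Real.mul_rpow hr0.le hz.le]
          ring
      _ ≤ C * R ^ (b - γ) * z ^ γ * (2 ^ γ * R ^ γ / g R * g r) := by gcongr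
      _ = D * (z ^ γ * g r) := by rw [hD]; ring
      _ ≤ _ := by
        have : 0 ≤ (2 : ℝ) ^ γ := by positivity
        nlinarith

end RegularVariation

/-! ### Potentials of regularly varying functions. -/

section PotentialAsymptotics

variable {Ω : Type*} [MeasurableSpace Ω] {P : Measure Ω} [IsProbabilityMeasure P]
  {ν : Measure ℝ} {S : ℝ≥0 → Ω → ℝ}

/-- After scaling, the quotient is the potential at `1` of `z ↦ h(ρz)/g(ρ)`, which tends to `κ z^β`.
The Potter bound with exponent `β/2` dominates it on `(0, 1]`, and the power is an eigenfunction. -/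
theorem IsSubordinator.tendsto_potential_div (hS : IsSubordinator S ν P) (hν : ν ≠ 0)
    {g h : ℝ → ℝ} {β b C κ : ℝ} (hβ : 0 < β) (hβb : β ≤ b) (hg : IsRegularlyVarying g β)
    (hgm : MonotoneOn g (Set.Ici 0)) (hC : ∀ r, 0 < r → g r ≤ C * r ^ b) (hhm : MonotoneOn h (Set.Ici 0))
    (hhg : ∀ r, 0 < r → h r ≤ g r)
    (hκ : Tendsto (fun r => h r / g r) atTop (𝓝 κ)) (hκ0 : 0 ≤ κ) :
    Tendsto (fun ρ => potential S P (fun z => ENNReal.ofReal (h z)) ρ / ENNReal.ofReal (g ρ)) atTop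
      (𝓝 (ENNReal.ofReal (κ / laplaceExponent ν β))) := by
  obtain ⟨K, R, hR, hKR⟩ := hg.exists_le_rpow_mul (γ := β / 2) (by linarith) (by linarith)
    (by linarith) hgm hC
  have h1 : ∀ᶠ ρ in atTop, potential S P (fun z => ENNReal.ofReal (h (ρ * z) / g ρ)) 1 =
      potential S P (fun z => ENNReal.ofReal (h z)) ρ / ENNReal.ofReal (g ρ) := by
    filter_upwards [eventually_ge_atTop R] with ρ hρ
    have hgρ := (hKR ρ hρ).1
    have hinv : (ENNReal.ofReal (g ρ))⁻¹ ≠ ∞ := ENNReal.inv_ne_top.2 (by simpa using hgρ)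
    simp only [potential, one_mul, ENNReal.ofReal_div_of_pos hgρ]
    simp only [div_eq_mul_inv]
    rw [← lintegral_mul_const' _ _ hinv]
    refine lintegral_congr fun t => ?_
    rw [lintegral_mul_const' _ _ hinv]
  refine Tendsto.congr' h1 ?_
  have h2 : potential S P (fun z => ENNReal.ofReal κ * ENNReal.ofReal (z ^ β)) 1 =
      ENNReal.ofReal (κ / laplaceExponent ν β) := by
    rw [hS.potential_rpow hν zero_le_one hβ, Real.one_rpow, ENNReal.ofReal_one, mul_one,
      ← ENNReal.ofReal_mul hκ0, mul_one_div]
  rw [← h2]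
  refine hS.tendsto_potential hν (C := ENNReal.ofReal K) ENNReal.ofReal_ne_top one_pos
    (β := β / 2) (by linarith) ?_ ?_ ?_
  · filter_upwards [eventually_ge_atTop R] with ρ hρ x hx y hy hxy
    have hρ0 : 0 ≤ ρ := hR.le.trans hρ
    have hgρ := (hKR ρ hρ).1
    refine ENNReal.ofReal_le_ofReal (div_le_div_of_nonneg_right ?_ hgρ.le)
    exact hhm (mul_nonneg hρ0 hx) (mul_nonneg hρ0 hy) (mul_le_mul_of_nonneg_left hxy hρ0)
  · filter_upwards [eventually_ge_atTop R] with ρ hρ z hz hz1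
    have hgρ := (hKR ρ hρ).1
    rw [← ENNReal.ofReal_mul' (by positivity)]
    refine ENNReal.ofReal_le_ofReal ((div_le_iff₀ hgρ).2 ?_)
    exact (hhg _ (mul_pos (hR.trans_le hρ) hz)).trans ((hKR ρ hρ).2 z hz hz1)
  · intro z hz _
    rw [← ENNReal.ofReal_mul hκ0]
    refine ENNReal.tendsto_ofReal ?_
    have h3 := (tendsto_comp_mul_atTop hκ hz).mul (hg.tendsto_ratio z hz)
    refine h3.congr' ?_
    filter_upwards [eventually_ge_atTop R, eventually_ge_atTop (R / z)] with ρ hρ hρz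
    have h4 := (hKR ρ hρ).1
    have h5 := (hKR (z * ρ) (by rwa [div_le_iff₀' hz] at hρz)).1
    rw [mul_comm z ρ] at h5 ⊢
    field_simp

end PotentialAsymptotics

/-! ### The asymptotic recursion for the binomial moments. -/

section Moments

variable {Ω : Type*} [MeasurableSpace Ω] {P : Measure Ω} [IsProbabilityMeasure P]
  {ν : Measure ℝ} {S : ℝ≥0 → Ω → ℝ}

/-- The mesh of the dyadic skeleton of level `n`. -/
def dyadicStep (n : ℕ) : ℝ≥0 := (1 / 2) ^ n

theorem dyadicStep_pos (n : ℕ) : 0 < dyadicStep n := by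
  unfold dyadicStep
  positivity

theorem tendsto_dyadicStep : Tendsto dyadicStep atTop (𝓝 0) :=
  NNReal.tendsto_pow_atTop_nhds_zero_of_lt_one (by rw [← NNReal.coe_lt_coe]; norm_num)

/-- The `m`-th binomial moment of the number of blocks, as a function of the intensity. -/
def binomMoment (S : ℝ≥0 → Ω → ℝ) (P : Measure Ω) (m : ℕ) (r : ℝ) : ℝ≥0∞ :=
  limsup (fun n => walkMoment (stepLaw S P (dyadicStep n)) m r) atTop

/-- The binomial moments along the dyadic skeletons converge. -/
def SkeletonConverges (S : ℝ≥0 → Ω → ℝ) (P : Measure Ω) : Prop :=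
  ∀ m r, 0 < r → Tendsto (fun n => walkMoment (stepLaw S P (dyadicStep n)) m r) atTop
    (𝓝 (binomMoment S P m r))

omit [IsProbabilityMeasure P] in
theorem binomMoment_monotoneOn (m : ℕ) : MonotoneOn (binomMoment S P m) (Set.Ici 0) :=
  fun _ hr _ hs hrs => limsup_le_limsup
    (Eventually.of_forall fun _ => walkMoment_monotoneOn m hr hs hrs)

theorem IsSubordinator.binomMoment_zero (hS : IsSubordinator S ν P) (r : ℝ) :
    binomMoment S P 0 r = 1 := by
  have := fun n => hS.isProbabilityMeasure_stepLaw (dyadicStep n)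
  simp_rw [binomMoment, walkMoment_zero]
  simp

theorem IsSubordinator.binomMoment_le_pow (hS : IsSubordinator S ν P) (m : ℕ) {r : ℝ}
    (hr : 0 ≤ r) : binomMoment S P m r ≤ ENNReal.ofReal (r ^ m) := by
  have := fun n => hS.isProbabilityMeasure_stepLaw (dyadicStep n)
  refine (limsup_le_limsup (Eventually.of_forall fun n =>
    walkMoment_le_pow (hS.stepLaw_nonneg _) m hr)).trans_eq ?_
  exact limsup_const _

/-- This bound and the next one, with `δ` at one's disposal, replace an exact integral recursion:
they agree to first order as `r → ∞` and then `δ → 0`. -/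
theorem IsSubordinator.binomMoment_succ_le (hS : IsSubordinator S ν P) (hν : ν ≠ 0)
    (hc : SkeletonConverges S P) (m : ℕ) {r : ℝ} (hr : 0 < r) :
    binomMoment S P (m + 1) r ≤ potential S P (fun z => psi ν z * binomMoment S P m z) r :=
  le_of_tendsto_of_tendsto' (hc (m + 1) r hr)
    (hS.tendsto_potential_upperKernel hν dyadicStep_pos tendsto_dyadicStep (hc m) hr)
    fun n => hS.walkMoment_le_potential hν (dyadicStep_pos n) m hr

theorem IsSubordinator.le_binomMoment_succ (hS : IsSubordinator S ν P) (hν : ν ≠ 0)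
    (hc : SkeletonConverges S P) (m : ℕ) {δ : ℝ} (hδ : 0 < δ) (hδ1 : δ < 1) {r : ℝ}
    (hr : 0 < r) :
    potential S P (fun z => (psi ν z - ENNReal.ofReal (laplaceExponent ν 1 / δ)) *
      binomMoment S P m ((1 - δ) * z)) r ≤ binomMoment S P (m + 1) r :=
  le_of_tendsto_of_tendsto'
    (hS.tendsto_potential_lowerKernel hν dyadicStep_pos tendsto_dyadicStep (hc m)
      ENNReal.ofReal_ne_top hδ hδ1 hr) (hc (m + 1) r hr)
    fun n => hS.potential_le_walkMoment hν (dyadicStep_pos n) m hδ hδ1 hr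

/-- The real-valued version of `psi`. -/
def realPsi (ν : Measure ℝ) (r : ℝ) : ℝ := (psi ν r).toReal

/-- The real-valued version of `binomMoment`. -/
def realMoment (S : ℝ≥0 → Ω → ℝ) (P : Measure Ω) (m : ℕ) (r : ℝ) : ℝ := (binomMoment S P m r).toReal

theorem IsLevyMeasure.realPsi_monotoneOn (hν : IsLevyMeasure ν) :
    MonotoneOn (realPsi ν) (Set.Ici 0) := fun _ hr _ hs hrs =>
  ENNReal.toReal_mono (hν.psi_ne_top hs) (psi_monotoneOn ν hr hs hrs)

theorem realPsi_nonneg (ν : Measure ℝ) (r : ℝ) : 0 ≤ realPsi ν r := ENNReal.toReal_nonneg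

theorem IsLevyMeasure.realPsi_le (hν : IsLevyMeasure ν) {r : ℝ} (hr : 0 ≤ r) :
    realPsi ν r ≤ laplaceExponent ν 1 * r := by
  have h0 := mul_nonneg hr (hν.laplaceExponent_nonneg zero_le_one)
  have h := ENNReal.toReal_mono ENNReal.ofReal_ne_top (hν.psi_le hr)
  rwa [ENNReal.toReal_ofReal h0, mul_comm] at h

theorem IsSubordinator.binomMoment_ne_top (hS : IsSubordinator S ν P) (m : ℕ) {r : ℝ}
    (hr : 0 ≤ r) : binomMoment S P m r ≠ ∞ :=
  ((hS.binomMoment_le_pow m hr).trans_lt ENNReal.ofReal_lt_top).ne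

omit [IsProbabilityMeasure P] in
theorem realMoment_nonneg (m : ℕ) (r : ℝ) : 0 ≤ realMoment S P m r := ENNReal.toReal_nonneg

theorem IsSubordinator.realMoment_monotoneOn (hS : IsSubordinator S ν P) (m : ℕ) :
    MonotoneOn (realMoment S P m) (Set.Ici 0) := fun _ hr _ hs hrs =>
  ENNReal.toReal_mono (hS.binomMoment_ne_top m hs) (binomMoment_monotoneOn m hr hs hrs)

theorem IsSubordinator.realMoment_le (hS : IsSubordinator S ν P) (m : ℕ) {r : ℝ}
    (hr : 0 ≤ r) : realMoment S P m r ≤ r ^ m := by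
  have h := ENNReal.toReal_mono ENNReal.ofReal_ne_top (hS.binomMoment_le_pow m hr)
  rwa [ENNReal.toReal_ofReal (by positivity)] at h

theorem IsSubordinator.realMoment_zero (hS : IsSubordinator S ν P) (r : ℝ) :
    realMoment S P 0 r = 1 := by
  rw [realMoment, hS.binomMoment_zero]
  rfl

omit [IsProbabilityMeasure P] in
theorem potential_congr {G H : ℝ → ℝ≥0∞}
    (h : ∀ z, 0 < z → G z = H z) {r : ℝ} (hr : 0 < r) : potential S P G r = potential S P H r :=
  lintegral_congr fun _ => lintegral_congr fun _ => h _ (by positivity)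

theorem IsSubordinator.realMoment_succ_le (hS : IsSubordinator S ν P) (hν : ν ≠ 0)
    (hc : SkeletonConverges S P) (m : ℕ) {r : ℝ} (hr : 0 < r) :
    ENNReal.ofReal (realMoment S P (m + 1) r) ≤
      potential S P (fun z => ENNReal.ofReal (realPsi ν z * realMoment S P m z)) r := by
  rw [realMoment, ENNReal.ofReal_toReal (hS.binomMoment_ne_top _ hr.le)]
  refine (hS.binomMoment_succ_le hν hc m hr).trans_eq (potential_congr (fun z hz => ?_) hr)
  rw [ENNReal.ofReal_mul (realPsi_nonneg _ _), realPsi, realMoment,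
    ENNReal.ofReal_toReal (hS.levy.psi_ne_top hz.le),
    ENNReal.ofReal_toReal (hS.binomMoment_ne_top _ hz.le)]

theorem IsSubordinator.le_realMoment_succ (hS : IsSubordinator S ν P) (hν : ν ≠ 0)
    (hc : SkeletonConverges S P) (m : ℕ) {δ : ℝ} (hδ : 0 < δ) (hδ1 : δ < 1) {r : ℝ}
    (hr : 0 < r) :
    potential S P (fun z => ENNReal.ofReal (max (realPsi ν z - laplaceExponent ν 1 / δ) 0 *
      realMoment S P m ((1 - δ) * z))) r ≤ ENNReal.ofReal (realMoment S P (m + 1) r) := by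
  rw [realMoment, ENNReal.ofReal_toReal (hS.binomMoment_ne_top _ hr.le)]
  refine Eq.trans_le (potential_congr (fun z hz => ?_) hr)
    (hS.le_binomMoment_succ hν hc m hδ hδ1 hr)
  have hΦ := hS.levy.laplaceExponent_nonneg zero_le_one
  rw [ENNReal.ofReal_mul (le_max_right _ _), realMoment,
    ENNReal.ofReal_toReal (hS.binomMoment_ne_top _ (mul_nonneg (by linarith) hz.le)),
    ENNReal.ofReal_max, ENNReal.ofReal_zero, max_eq_left zero_le,
    ENNReal.ofReal_sub _ (by positivity), realPsi,
    ENNReal.ofReal_toReal (hS.levy.psi_ne_top hz.le)]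

variable {α : ℝ}

/-- The upper bound is the potential of `g = ψ F_m`. The lower one is the potential of a function
equivalent to `(1 - δ)^{αm} g`, because `ψ → ∞` makes the subtracted constant negligible. Both are
evaluated by `IsSubordinator.tendsto_potential_div`, and `δ` tends to `0`. -/
theorem IsSubordinator.tendsto_realMoment_succ_div (hS : IsSubordinator S ν P) (hν : ν ≠ 0)
    (hc : SkeletonConverges S P) (hα0 : 0 < α) (hα1 : α ≤ 1)
    (hψ : IsRegularlyVarying (realPsi ν) α) (m : ℕ)
    (hm : IsRegularlyVarying (realMoment S P m) (α * m)) :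
    Tendsto (fun r => realMoment S P (m + 1) r / (realPsi ν r * realMoment S P m r)) atTop
      (𝓝 (1 / laplaceExponent ν (α * (m + 1 : ℕ)))) := by
  set g : ℝ → ℝ := fun r => realPsi ν r * realMoment S P m r with hgdef
  have hΦ1 := hS.levy.laplaceExponent_nonneg zero_le_one
  have hβ : 0 < α * (m + 1 : ℕ) := by positivity
  have hΦβ := hS.levy.laplaceExponent_pos hν hβ
  have hg : IsRegularlyVarying g (α * (m + 1 : ℕ)) := by
    have := hψ.mul hm
    convert! this using 1
    push_cast
    ring
  have hgm : MonotoneOn g (Set.Ici 0) := fun x hx y hy hxy =>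
    mul_le_mul (hS.levy.realPsi_monotoneOn hx hy hxy) (hS.realMoment_monotoneOn m hx hy hxy)
      (realMoment_nonneg _ _) (realPsi_nonneg _ _)
  have hC : ∀ r, 0 < r → g r ≤ laplaceExponent ν 1 * r ^ ((m : ℝ) + 1) := fun r hr => by
    rw [Real.rpow_add_one hr.ne', Real.rpow_natCast]
    refine (mul_le_mul (hS.levy.realPsi_le hr.le) (hS.realMoment_le m hr.le)
      (realMoment_nonneg _ _) (by positivity)).trans_eq (by ring)
  -- The Potter bound requires the index to be at most the exponent `m + 1` of the global bound
  -- `hC`; this uses `α ≤ 1`.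
  have hβb : α * (m + 1 : ℕ) ≤ (m : ℝ) + 1 := by
    push_cast
    nlinarith [(Nat.cast_nonneg m : (0 : ℝ) ≤ m)]
  have hgpos := hg.eventually_pos
  have hup := hS.tendsto_potential_div hν hβ hβb hg hgm hC hgm (fun r _ => le_rfl)
    (κ := 1) (tendsto_const_nhds.congr' (hgpos.mono fun r hr => (div_self hr.ne').symm))
    zero_le_one
  have hup' : ∀ᶠ r in atTop, ENNReal.ofReal (realMoment S P (m + 1) r / g r) ≤
      potential S P (fun z => ENNReal.ofReal (g z)) r / ENNReal.ofReal (g r) := by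
    filter_upwards [hgpos, eventually_gt_atTop 0] with r h1 h2
    rw [ENNReal.ofReal_div_of_pos h1]
    exact ENNReal.div_le_div_right (hS.realMoment_succ_le hν hc m h2) _
  have hψtop := hψ.tendsto_atTop hα0 hS.levy.realPsi_monotoneOn
  have hlow : ∀ δ, 0 < δ → δ < 1 → ∀ a, a < (1 - δ) ^ (α * m) / laplaceExponent ν (α * (m + 1 : ℕ)) →
      ∀ᶠ r in atTop, a < realMoment S P (m + 1) r / g r := by
    intro δ hδ hδ1 a ha
    set c := laplaceExponent ν 1 / δ
    have hc0 : 0 ≤ c := by positivity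
    have hδ' : 0 < 1 - δ := by linarith
    have hκ : Tendsto (fun r => max (realPsi ν r - c) 0 * realMoment S P m ((1 - δ) * r) / g r)
        atTop (𝓝 ((1 - δ) ^ (α * m))) := by
      have h1 : Tendsto (fun r => 1 - c / realPsi ν r) atTop (𝓝 1) := by
        simpa using (hψtop.const_div_atTop c).const_sub 1
      have h2 := h1.mul (hm.tendsto_ratio (1 - δ) hδ')
      rw [one_mul] at h2
      refine h2.congr' ?_
      filter_upwards [hψtop.eventually_ge_atTop c, hψ.eventually_pos, hm.eventually_pos]
        with r h3 h4 h5
      rw [max_eq_left (by linarith), hgdef]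
      field_simp
    have h3 := hS.tendsto_potential_div hν hβ hβb hg hgm hC
      (h := fun r => max (realPsi ν r - c) 0 * realMoment S P m ((1 - δ) * r))
      (fun x hx y hy hxy => mul_le_mul
        (max_le_max_right 0 (sub_le_sub_right (hS.levy.realPsi_monotoneOn hx hy hxy) c))
        (hS.realMoment_monotoneOn m (mul_nonneg hδ'.le hx) (mul_nonneg hδ'.le hy)
          (mul_le_mul_of_nonneg_left hxy hδ'.le)) (realMoment_nonneg _ _) (le_max_right _ _))
      (fun r hr => mul_le_mul (max_le (by linarith) (realPsi_nonneg _ _))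
        (hS.realMoment_monotoneOn m (mul_nonneg hδ'.le hr.le) hr.le (by nlinarith))
        (realMoment_nonneg _ _) (realPsi_nonneg _ _)) hκ (by positivity)
    rcases lt_or_ge a 0 with ha0 | ha0
    · exact Eventually.of_forall fun r => ha0.trans_le (div_nonneg (realMoment_nonneg _ _)
        (mul_nonneg (realPsi_nonneg _ _) (realMoment_nonneg _ _)))
    · have h4 := h3.eventually (lt_mem_nhds
        ((ENNReal.ofReal_lt_ofReal_iff_of_nonneg ha0).2 ha))
      filter_upwards [h4, hgpos, eventually_gt_atTop 0] with r h5 h6 h7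
      have h8 : potential S P (fun z => ENNReal.ofReal (max (realPsi ν z - c) 0 *
          realMoment S P m ((1 - δ) * z))) r / ENNReal.ofReal (g r) ≤
          ENNReal.ofReal (realMoment S P (m + 1) r / g r) := by
        rw [ENNReal.ofReal_div_of_pos h6]
        exact ENNReal.div_le_div_right (hS.le_realMoment_succ hν hc m hδ hδ1 h7) _
      exact (ENNReal.ofReal_lt_ofReal_iff_of_nonneg ha0).1 (h5.trans_le h8)
  refine tendsto_order.2 ⟨fun a ha => ?_, fun a ha => ?_⟩
  · have h1 : Tendsto (fun δ : ℝ => (1 - δ) ^ (α * m) / laplaceExponent ν (α * (m + 1 : ℕ)))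
        (𝓝[>] 0) (𝓝 (1 / laplaceExponent ν (α * (m + 1 : ℕ)))) := by
      have h2 : ContinuousAt (fun δ : ℝ => (1 - δ) ^ (α * m) /
          laplaceExponent ν (α * (m + 1 : ℕ))) 0 := by
        refine ContinuousAt.div_const ?_ _
        exact ContinuousAt.rpow_const (by fun_prop) (Or.inl (by norm_num))
      have h3 := h2.tendsto.mono_left (nhdsWithin_le_nhds (s := Set.Ioi 0))
      simpa using h3
    obtain ⟨δ, hδa, hδ⟩ := ((h1.eventually (lt_mem_nhds ha)).and
      (Ioo_mem_nhdsGT (zero_lt_one (α := ℝ)))).exists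
    exact hlow δ hδ.1 hδ.2 a hδa
  · have ha0 : 0 < a := lt_trans (by positivity) ha
    have h4 := hup.eventually (gt_mem_nhds ((ENNReal.ofReal_lt_ofReal_iff ha0).2 ha))
    filter_upwards [h4, hup'] with r h5 h6
    exact (ENNReal.ofReal_lt_ofReal_iff ha0).1 (h6.trans_lt h5)

/-- The asymptotics at order `m` make `F_m` regularly varying of index `αm`, which is the input
required at order `m + 1`. -/
theorem IsSubordinator.tendsto_realMoment_div (hS : IsSubordinator S ν P) (hν : ν ≠ 0)
    (hc : SkeletonConverges S P) (hα0 : 0 < α) (hα1 : α ≤ 1)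
    (hψ : IsRegularlyVarying (realPsi ν) α) (m : ℕ) :
    Tendsto (fun r => realMoment S P m r / realPsi ν r ^ m) atTop
      (𝓝 (∏ j ∈ Finset.Icc 1 m, 1 / laplaceExponent ν (α * j))) := by
  induction m with
  | zero => simp [hS.realMoment_zero]
  | succ m ih =>
    have hpos : 0 < ∏ j ∈ Finset.Icc 1 m, 1 / laplaceExponent ν (α * j) :=
      Finset.prod_pos fun j hj => one_div_pos.2 (hS.levy.laplaceExponent_pos hν (by
        have : 0 < j := (Finset.mem_Icc.1 hj).1
        positivity))
    have hm : IsRegularlyVarying (realMoment S P m) (α * m) := (hψ.pow m).of_tendsto_div hpos ih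
    rw [Finset.prod_Icc_succ_top (Nat.le_add_left 1 m)]
    have h1 := ih.mul (hS.tendsto_realMoment_succ_div hν hc hα0 hα1 hψ m hm)
    refine h1.congr' ?_
    filter_upwards [hψ.eventually_pos, hm.eventually_pos] with r h2 h3
    field_simp
    ring

end Moments

/-! ### An Abelian comparison of Laplace transforms. -/

section LaplaceComparison

/-- The Laplace transform of `F` on `(0, ∞)`. -/
def laplaceOn (F : ℝ → ℝ) (r : ℝ) : ℝ := ∫ x in Set.Ioi (0 : ℝ), Real.exp (-(r * x)) * F x

variable {F G H : ℝ → ℝ}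

theorem integrableOn_exp_mul_of_le {r s : ℝ} (hrs : r ≤ s)
    (hF : IntegrableOn (fun x => Real.exp (-(r * x)) * F x) (Set.Ioi 0)) :
    IntegrableOn (fun x => Real.exp (-(s * x)) * F x) (Set.Ioi 0) := by
  have h1 : (fun x => Real.exp (-(s * x)) * F x) =
      fun x => Real.exp (-((s - r) * x)) * (Real.exp (-(r * x)) * F x) := by
    ext x
    rw [← mul_assoc, ← Real.exp_add]
    congr 2; ring
  rw [h1]
  refine Integrable.bdd_mul (c := 1) hF (by fun_prop) ?_
  filter_upwards [ae_restrict_mem measurableSet_Ioi] with x hx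
  rw [Real.norm_of_nonneg (Real.exp_pos _).le, Real.exp_le_one_iff]
  have := mul_nonneg (sub_nonneg.2 hrs) (Set.mem_Ioi.1 hx).le
  linarith

theorem integrableOn_exp_mul_abs {r : ℝ}
    (hF : IntegrableOn (fun x => Real.exp (-(r * x)) * F x) (Set.Ioi 0)) :
    IntegrableOn (fun x => Real.exp (-(r * x)) * |F x|) (Set.Ioi 0) := by
  refine (integrable_congr (Eventually.of_forall fun x => ?_)).1 (Integrable.abs hF)
  simp only [abs_mul, Real.abs_exp]

/-- The mass of `F` on `(0, η]` with `η < δ` keeps its transform above `c e^{-(r-1)η}`, while the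
tail beyond `δ` is at most `C e^{-(r-1)δ}`. -/
theorem tendsto_laplace_tail_div (hF : IntegrableOn (fun x => Real.exp (-(1 * x)) * F x) (Set.Ioi 0))
    (hF0 : ∀ x, 0 < x → 0 ≤ F x) (hFpos : ∀ᶠ x in 𝓝[>] 0, 0 < F x)
    (hH : IntegrableOn (fun x => Real.exp (-(1 * x)) * H x) (Set.Ioi 0)) {δ : ℝ} (hδ : 0 < δ) :
    Tendsto (fun r => (∫ x in Set.Ioi δ, Real.exp (-(r * x)) * |H x|) / laplaceOn F r) atTop
      (𝓝 0) := by
  obtain ⟨η₀, hη₀, hpos⟩ := mem_nhdsGT_iff_exists_Ioc_subset.1 hFpos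
  have hη₀' : (0 : ℝ) < η₀ := hη₀
  set η := min η₀ (δ / 2)
  have hη : 0 < η := lt_min hη₀' (half_pos hδ)
  have hηδ : η < δ := (min_le_right _ _).trans_lt (half_lt_self hδ)
  set c := ∫ x in Set.Ioc 0 η, Real.exp (-(1 * x)) * F x with hc
  set C := ∫ x in Set.Ioi δ, Real.exp (-(1 * x)) * |H x| with hC
  have habs : ∀ r : ℝ, 1 ≤ r →
      IntegrableOn (fun x => Real.exp (-(r * x)) * |H x|) (Set.Ioi 0) := fun r hr =>
    integrableOn_exp_mul_abs (integrableOn_exp_mul_of_le hr hH)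
  have hsub : Set.Ioi δ ⊆ Set.Ioi 0 := Set.Ioi_subset_Ioi hδ.le
  have hsub' : Set.Ioc 0 η ⊆ Set.Ioi 0 := Set.Ioc_subset_Ioi_self
  have hc0 : 0 < c := by
    rw [hc, setIntegral_pos_iff_support_of_nonneg_ae]
    · have : Set.Ioc 0 η ⊆ Function.support (fun x => Real.exp (-(1 * x)) * F x) ∩ Set.Ioc 0 η :=
        fun x hx => ⟨(mul_pos (Real.exp_pos _)
          (hpos ⟨hx.1, hx.2.trans (min_le_left _ _)⟩)).ne', hx⟩
      refine lt_of_lt_of_le ?_ (measure_mono this)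
      simpa using hη
    · filter_upwards [ae_restrict_mem measurableSet_Ioc] with x hx
      exact mul_nonneg (Real.exp_pos _).le (hF0 x hx.1)
    · exact hF.mono_set hsub'
  have hlow : ∀ r : ℝ, 1 ≤ r → Real.exp (-((r - 1) * η)) * c ≤ laplaceOn F r := by
    intro r hr
    rw [hc, ← integral_const_mul]
    refine le_trans ?_ (setIntegral_mono_set (integrableOn_exp_mul_of_le hr hF) ?_
      hsub'.eventuallyLE)
    · refine setIntegral_mono_on ((hF.mono_set hsub').const_mul _)
        ((integrableOn_exp_mul_of_le hr hF).mono_set hsub') measurableSet_Ioc fun x hx => ?_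
      rw [← mul_assoc, ← Real.exp_add]
      refine mul_le_mul_of_nonneg_right (Real.exp_le_exp.2 ?_) (hF0 x hx.1)
      nlinarith [mul_nonneg (sub_nonneg.2 hr) (sub_nonneg.2 hx.2)]
    · filter_upwards [ae_restrict_mem measurableSet_Ioi] with x hx
      exact mul_nonneg (Real.exp_pos _).le (hF0 x hx)
  have hup : ∀ r : ℝ, 1 ≤ r → (∫ x in Set.Ioi δ, Real.exp (-(r * x)) * |H x|) ≤
      Real.exp (-((r - 1) * δ)) * C := by
    intro r hr
    rw [hC, ← integral_const_mul]
    refine setIntegral_mono_on ((habs r hr).mono_set hsub)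
      (((habs 1 le_rfl).mono_set hsub).const_mul _) measurableSet_Ioi fun x hx => ?_
    rw [← mul_assoc, ← Real.exp_add]
    refine mul_le_mul_of_nonneg_right (Real.exp_le_exp.2 ?_) (abs_nonneg _)
    nlinarith [mul_nonneg (sub_nonneg.2 hr) (sub_nonneg.2 (Set.mem_Ioi.1 hx).le)]
  have hlim : Tendsto (fun r : ℝ => Real.exp (-((r - 1) * (δ - η))) * (C / c)) atTop (𝓝 0) := by
    rw [← zero_mul (C / c)]
    refine (Real.tendsto_exp_atBot.comp (tendsto_neg_atTop_atBot.comp ?_)).mul_const _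
    exact (tendsto_atTop_add_const_right _ (-1) tendsto_id).atTop_mul_const (sub_pos.2 hηδ)
  refine squeeze_zero' ?_ ?_ hlim
  · filter_upwards [eventually_ge_atTop 1] with r hr
    refine div_nonneg (integral_nonneg fun x => by positivity) ?_
    exact le_trans (by positivity) (hlow r hr)
  · filter_upwards [eventually_ge_atTop 1] with r hr
    have hC0 : 0 ≤ C := integral_nonneg fun x => by positivity
    calc _ ≤ (Real.exp (-((r - 1) * δ)) * C) / (Real.exp (-((r - 1) * η)) * c) :=
          div_le_div₀ (by positivity) (hup r hr) (by positivity) (hlow r hr)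
      _ = Real.exp (-((r - 1) * (δ - η))) * (C / c) := by
          rw [mul_div_mul_comm, ← Real.exp_sub]
          congr 2; ring

/-- The behaviour of the Laplace transform at `∞` is governed by that of the function at `0`. -/
theorem tendsto_laplaceOn_div (hF : IntegrableOn (fun x => Real.exp (-(1 * x)) * F x) (Set.Ioi 0))
    (hF0 : ∀ x, 0 < x → 0 ≤ F x) (hFpos : ∀ᶠ x in 𝓝[>] 0, 0 < F x)
    (hG : IntegrableOn (fun x => Real.exp (-(1 * x)) * G x) (Set.Ioi 0)) {a : ℝ}
    (hGF : Tendsto (fun x => G x / F x) (𝓝[>] 0) (𝓝 a)) :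
    (∀ᶠ r in atTop, 0 < laplaceOn F r) ∧
      Tendsto (fun r => laplaceOn G r / laplaceOn F r) atTop (𝓝 a) := by
  have hLpos : ∀ r : ℝ, 1 ≤ r → 0 < laplaceOn F r := by
    intro r hr
    rw [laplaceOn, setIntegral_pos_iff_support_of_nonneg_ae]
    · obtain ⟨η, hη, hpos⟩ := mem_nhdsGT_iff_exists_Ioc_subset.1 hFpos
      have : Set.Ioc 0 η ⊆ Function.support (fun x => Real.exp (-(r * x)) * F x) ∩ Set.Ioi 0 :=
        fun x hx => ⟨(mul_pos (Real.exp_pos _) (hpos hx)).ne', hx.1⟩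
      refine lt_of_lt_of_le ?_ (measure_mono this)
      simpa using hη
    · filter_upwards [ae_restrict_mem measurableSet_Ioi] with x hx
      exact mul_nonneg (Real.exp_pos _).le (hF0 x hx)
    · exact integrableOn_exp_mul_of_le hr hF
  refine ⟨(eventually_ge_atTop 1).mono hLpos, ?_⟩
  -- Subtracting `a F` reduces the claim to limit `0`: near the origin `|H| ≤ (ε/2) F`, and the rest
  -- is an exponentially small tail.
  set H : ℝ → ℝ := fun x => G x - a * F x with hHdef
  have hHeq : ∀ r, (fun x => Real.exp (-(r * x)) * H x) = fun x =>
      Real.exp (-(r * x)) * G x - a * (Real.exp (-(r * x)) * F x) := fun r => by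
    ext x; simp only [hHdef]; ring
  have hH : IntegrableOn (fun x => Real.exp (-(1 * x)) * H x) (Set.Ioi 0) := by
    rw [hHeq]; exact hG.sub (hF.const_mul a)
  have hHF : Tendsto (fun x => H x / F x) (𝓝[>] 0) (𝓝 0) := by
    have h0 := hGF.sub_const a
    rw [sub_self] at h0
    refine h0.congr' ?_
    filter_upwards [hFpos] with x hx
    simp only [hHdef]
    field_simp
  have hmain : Tendsto (fun r => laplaceOn H r / laplaceOn F r) atTop (𝓝 0) := by
    rw [Metric.tendsto_nhds]
    intro ε hε
    have hev := hHF.eventually (Metric.ball_mem_nhds 0 (half_pos hε))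
    obtain ⟨δ, hδ, hsmall⟩ := mem_nhdsGT_iff_exists_Ioc_subset.1 (hev.and hFpos)
    have hδ' : (0 : ℝ) < δ := hδ
    filter_upwards [eventually_ge_atTop 1,
      (tendsto_laplace_tail_div hF hF0 hFpos hH hδ').eventually (gt_mem_nhds (half_pos hε))]
      with r hr htail
    have hL := hLpos r hr
    have hiH : IntegrableOn (fun x => Real.exp (-(r * x)) * |H x|) (Set.Ioi 0) :=
      integrableOn_exp_mul_abs (integrableOn_exp_mul_of_le hr hH)
    have hiF := integrableOn_exp_mul_of_le hr hF
    have h1 : |laplaceOn H r| ≤ ∫ x in Set.Ioi (0 : ℝ), Real.exp (-(r * x)) * |H x| := by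
      refine (abs_integral_le_integral_abs).trans_eq ?_
      simp only [abs_mul, Real.abs_exp]
    have h2 : (∫ x in Set.Ioi (0 : ℝ), Real.exp (-(r * x)) * |H x|) =
        (∫ x in Set.Ioc 0 δ, Real.exp (-(r * x)) * |H x|) +
          ∫ x in Set.Ioi δ, Real.exp (-(r * x)) * |H x| := by
      rw [← setIntegral_union (Set.Ioc_disjoint_Ioi le_rfl) measurableSet_Ioi
        (hiH.mono_set Set.Ioc_subset_Ioi_self) (hiH.mono_set (Set.Ioi_subset_Ioi hδ'.le)),
        Set.Ioc_union_Ioi_eq_Ioi hδ'.le]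
    have h3 : (∫ x in Set.Ioc 0 δ, Real.exp (-(r * x)) * |H x|) ≤ ε / 2 * laplaceOn F r := by
      rw [laplaceOn, ← integral_const_mul]
      refine le_trans ?_ (setIntegral_mono_set (hiF.const_mul (ε / 2)) ?_
        (LE.le.eventuallyLE (Set.Ioc_subset_Ioi_self : Set.Ioc 0 δ ⊆ Set.Ioi 0)))
      · refine setIntegral_mono_on (hiH.mono_set Set.Ioc_subset_Ioi_self)
          ((hiF.mono_set Set.Ioc_subset_Ioi_self).const_mul _) measurableSet_Ioc fun x hx => ?_
        obtain ⟨h4, h5⟩ := hsmall hx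
        rw [Real.dist_eq, sub_zero, abs_div, abs_of_pos h5, div_lt_iff₀ h5] at h4
        calc Real.exp (-(r * x)) * |H x| ≤ Real.exp (-(r * x)) * (ε / 2 * F x) := by gcongr
          _ = _ := by ring
      · filter_upwards [ae_restrict_mem measurableSet_Ioi] with x hx
        exact mul_nonneg (half_pos hε).le (mul_nonneg (Real.exp_pos _).le (hF0 x hx))
    rw [Real.dist_eq, sub_zero, abs_div, abs_of_pos hL, div_lt_iff₀ hL]
    rw [div_lt_iff₀ hL] at htail
    linarith
  rw [← zero_add a]
  refine (hmain.add_const a).congr' ?_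
  filter_upwards [eventually_ge_atTop 1] with r hr
  have hL := (hLpos r hr).ne'
  have : laplaceOn H r = laplaceOn G r - a * laplaceOn F r := by
    rw [laplaceOn, hHeq, integral_sub (integrableOn_exp_mul_of_le hr hG)
      ((integrableOn_exp_mul_of_le hr hF).const_mul a), integral_const_mul]
    rfl
  rw [this]
  field_simp
  ring

end LaplaceComparison

/-! ### `ψ` as the Laplace transform of a tail. -/

section Tail

/-- The tail of the image of `ν` under `y ↦ 1 - exp (-y)`. -/
def multTail (ν : Measure ℝ) (x : ℝ) : ℝ := ν.real {y | x ≤ 1 - Real.exp (-y)}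

variable {ν : Measure ℝ}

theorem multTail_nonneg (ν : Measure ℝ) (x : ℝ) : 0 ≤ multTail ν x := measureReal_nonneg

theorem IsLevyMeasure.measure_multTail_ne_top (hν : IsLevyMeasure ν) {x : ℝ} (hx : 0 < x) :
    ν {y | x ≤ 1 - Real.exp (-y)} ≠ ∞ := by
  have h := (hν.integrable_one_sub_exp zero_le_one).measure_ge_lt_top hx
  simp only [one_mul] at h
  exact h.ne

theorem IsLevyMeasure.measure_Ici_ne_top (hν : IsLevyMeasure ν) {x : ℝ} (hx : 0 < x) :
    ν (Set.Ici x) ≠ ∞ := by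
  have h0 : 0 < 1 - Real.exp (-x) := by
    rw [sub_pos, Real.exp_lt_one_iff]; linarith
  refine ne_top_of_le_ne_top (hν.measure_multTail_ne_top h0) (measure_mono fun y hy => ?_)
  have : Real.exp (-y) ≤ Real.exp (-x) := Real.exp_le_exp.2 (neg_le_neg hy)
  simp only [Set.mem_ofPred_eq]
  linarith

theorem IsLevyMeasure.multTail_antitoneOn (hν : IsLevyMeasure ν) :
    AntitoneOn (multTail ν) (Set.Ioi 0) := fun _ hx _ _ hxy =>
  measureReal_mono (fun _ hz => le_trans hxy hz) (hν.measure_multTail_ne_top hx)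

theorem integral_mul_exp_neg (r z : ℝ) :
    ∫ t in (0 : ℝ)..z, r * Real.exp (-(r * t)) = 1 - Real.exp (-(r * z)) := by
  have h : ∀ t ∈ Set.uIcc 0 z,
      HasDerivAt (fun t => -Real.exp (-(r * t))) (r * Real.exp (-(r * t))) t := fun t _ => by
    have h1 : HasDerivAt (fun t => -(r * t)) (-(r * 1)) t := ((hasDerivAt_id t).const_mul r).neg
    convert! h1.exp.neg using 1
    ring
  rw [intervalIntegral.integral_eq_sub_of_hasDerivAt h
    (Continuous.intervalIntegrable (by fun_prop) _ _)]
  simp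
  ring

/-- The layer cake formula for `1 - e^{-y}`, with `1 - e^{-rz}` as the primitive of `r e^{-rt}`. -/
theorem IsLevyMeasure.psi_eq_lintegral_multTail (hν : IsLevyMeasure ν) {r : ℝ} (hr : 0 ≤ r) :
    psi ν r = ∫⁻ x in Set.Ioi (0 : ℝ),
      ENNReal.ofReal (r * (Real.exp (-(r * x)) * multTail ν x)) := by
  have h := lintegral_comp_eq_lintegral_meas_le_mul ν (f := fun y => 1 - Real.exp (-y))
    (g := fun t => r * Real.exp (-(r * t)))
    (hν.ae_pos.mono fun y hy => one_sub_exp_nonneg hy.le) (by fun_prop)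
    (fun t _ => Continuous.intervalIntegrable (by fun_prop) _ _)
    (Eventually.of_forall fun t => by positivity)
  simp only [integral_mul_exp_neg] at h
  rw [psi]
  refine h.trans (setLIntegral_congr_fun measurableSet_Ioi fun x hx => ?_)
  rw [← ENNReal.ofReal_toReal (hν.measure_multTail_ne_top hx),
    ← ENNReal.ofReal_mul ENNReal.toReal_nonneg]
  congr 1
  rw [multTail, Measure.real]
  ring

theorem IsLevyMeasure.realPsi_eq_laplaceOn (hν : IsLevyMeasure ν) {r : ℝ} (hr : 0 < r) :
    IntegrableOn (fun x => Real.exp (-(r * x)) * multTail ν x) (Set.Ioi 0) ∧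
      realPsi ν r = r * laplaceOn (multTail ν) r := by
  have hm : AEMeasurable (multTail ν) (volume.restrict (Set.Ioi 0)) :=
    aemeasurable_restrict_of_antitoneOn measurableSet_Ioi hν.multTail_antitoneOn
  have h0 : ∀ x, 0 ≤ r * (Real.exp (-(r * x)) * multTail ν x) := fun x =>
    mul_nonneg hr.le (mul_nonneg (Real.exp_pos _).le (multTail_nonneg ν x))
  have hint : IntegrableOn (fun x => r * (Real.exp (-(r * x)) * multTail ν x)) (Set.Ioi 0) := by
    refine ⟨AEMeasurable.aestronglyMeasurable (by fun_prop), ?_⟩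
    rw [hasFiniteIntegral_iff_ofReal (Eventually.of_forall h0),
      ← hν.psi_eq_lintegral_multTail hr.le]
    exact (hν.psi_ne_top hr.le).lt_top
  refine ⟨?_, ?_⟩
  · refine (integrable_congr (Eventually.of_forall fun x => ?_)).1 (hint.const_mul r⁻¹)
    field_simp
  · rw [realPsi, hν.psi_eq_lintegral_multTail hr.le, laplaceOn, ← integral_const_mul,
      ← ofReal_integral_eq_lintegral_ofReal hint (Eventually.of_forall h0),
      ENNReal.toReal_ofReal (integral_nonneg h0)]

end Tail

/-! ### Behaviour of the tails at `0`. -/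

section VariationAtZero

theorem tendsto_const_mul_nhdsGT_zero {c : ℝ} (hc : 0 < c) :
    Tendsto (fun y => c * y) (𝓝[>] 0) (𝓝[>] 0) := by
  refine tendsto_nhdsWithin_iff.2 ⟨?_, ?_⟩
  · have : Tendsto (fun y => c * y) (𝓝 0) (𝓝 (c * 0)) := tendsto_id.const_mul c
    rw [mul_zero] at this
    exact this.mono_left nhdsWithin_le_nhds
  · filter_upwards [self_mem_nhdsWithin] with y hy
    exact mul_pos hc hy

variable {ℓ : ℝ → ℝ} {α : ℝ} {f : ℝ → ℝ}

theorem tendsto_one_div_nhdsGT_zero : Tendsto (fun y : ℝ => 1 / y) (𝓝[>] 0) atTop := by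
  simpa using tendsto_inv_nhdsGT_zero (𝕜 := ℝ)

theorem IsSlowlyVarying.eventually_pos_at_zero (hℓ : IsSlowlyVarying ℓ) (α : ℝ) :
    ∀ᶠ y in 𝓝[>] 0, 0 < ℓ (1 / y) * y ^ (-α) := by
  filter_upwards [tendsto_one_div_nhdsGT_zero.eventually hℓ.eventually_pos, self_mem_nhdsWithin]
    with y h1 h2
  exact mul_pos h1 (Real.rpow_pos_of_pos h2 _)

theorem IsSlowlyVarying.eventually_pos_of_tendsto_div (hℓ : IsSlowlyVarying ℓ)
    (hf : Tendsto (fun y => f y / (ℓ (1 / y) * y ^ (-α))) (𝓝[>] 0) (𝓝 1)) :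
    ∀ᶠ y in 𝓝[>] 0, 0 < f y := by
  filter_upwards [hℓ.eventually_pos_at_zero α, hf.eventually (lt_mem_nhds zero_lt_one)] with y h1 h2
  exact (div_pos_iff_of_pos_right h1).1 h2

theorem IsSlowlyVarying.tendsto_comp_mul_div (hℓ : IsSlowlyVarying ℓ)
    (hf : Tendsto (fun y => f y / (ℓ (1 / y) * y ^ (-α))) (𝓝[>] 0) (𝓝 1)) {c : ℝ} (hc : 0 < c) :
    Tendsto (fun y => f (c * y) / f y) (𝓝[>] 0) (𝓝 (c ^ (-α))) := by
  have hcs := tendsto_const_mul_nhdsGT_zero hc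
  have h1 := (hf.comp hcs).div hf one_ne_zero
  have h2 := ((hℓ.tendsto_ratio c⁻¹ (inv_pos.2 hc)).comp tendsto_one_div_nhdsGT_zero).mul_const
    (c ^ (-α))
  have h3 := h1.mul h2
  rw [div_one, one_mul, one_mul] at h3
  refine h3.congr' ?_
  filter_upwards [self_mem_nhdsWithin, hℓ.eventually_pos_at_zero α,
    hcs.eventually (hℓ.eventually_pos_at_zero α), hℓ.eventually_pos_of_tendsto_div hf,
    tendsto_one_div_nhdsGT_zero.eventually hℓ.eventually_pos] with y hy h4 h5 h6 h7
  have hy' : (0 : ℝ) < y := hy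
  have e1 : c⁻¹ * (1 / y) = 1 / (c * y) := by field_simp
  have e2 : (c * y) ^ (-α) = c ^ (-α) * y ^ (-α) := Real.mul_rpow hc.le hy'.le
  have h8 := Real.rpow_pos_of_pos hy' (-α)
  have h9 := Real.rpow_pos_of_pos hc (-α)
  simp only [Pi.div_apply, Function.comp_apply]
  have h10 : ℓ (1 / (c * y)) ≠ 0 := left_ne_zero_of_mul h5.ne'
  rw [e1, e2]
  field_simp

/-- With `N(y) = ν[y, ∞)`, one has `N(cx) ≤ multTail ν x ≤ N(x)` for every `c > 1` and small `x`.
Regular variation gives `N(cx)/N(x) → c^{-α}`, which is near `1` for `c` near `1`. -/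
theorem IsLevyMeasure.tendsto_multTail_div {ν : Measure ℝ} (hν : IsLevyMeasure ν)
    (hℓ : IsSlowlyVarying ℓ)
    (h : (fun y : ℝ => ν.real (Set.Ici y)) ~[𝓝[>] 0] fun y : ℝ => ℓ (1 / y) * y ^ (-α)) :
    Tendsto (fun x => multTail ν x / (ℓ (1 / x) * x ^ (-α))) (𝓝[>] 0) (𝓝 1) := by
  have hN : Tendsto (fun y => ν.real (Set.Ici y) / (ℓ (1 / y) * y ^ (-α))) (𝓝[>] 0) (𝓝 1) :=
    (isEquivalent_iff_tendsto_one ((hℓ.eventually_pos_at_zero α).mono fun y hy => hy.ne')).1 h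
  have hNpos := hℓ.eventually_pos_of_tendsto_div hN
  suffices hF : Tendsto (fun x => multTail ν x / ν.real (Set.Ici x)) (𝓝[>] 0) (𝓝 1) by
    have := hF.mul hN
    rw [one_mul] at this
    refine this.congr' ?_
    filter_upwards [hNpos] with x hx
    field_simp
  have hle : ∀ x : ℝ, 0 < x → multTail ν x ≤ ν.real (Set.Ici x) := fun x hx =>
    measureReal_mono (fun y hy => by
      have h1 : x ≤ 1 - Real.exp (-y) := hy
      have h2 := Real.add_one_le_exp (-y)
      exact Set.mem_Ici.2 (by linarith)) (hν.measure_Ici_ne_top hx)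
  have hge : ∀ c : ℝ, 1 < c → ∀ᶠ x in 𝓝[>] 0, ν.real (Set.Ici (c * x)) ≤ multTail ν x := by
    intro c hc
    -- If `y ≥ cx` then `1 - e^{-y} ≥ 1 - 1/(1 + cx)`, and this is at least `x` exactly when `cx ≤ c
    -- - 1`.
    have h0 : 0 < (c - 1) / c := div_pos (sub_pos.2 hc) (by linarith)
    filter_upwards [Ioo_mem_nhdsGT h0] with x hx
    refine measureReal_mono (fun y hy => ?_) (hν.measure_multTail_ne_top hx.1)
    have hx2 := hx.2
    rw [lt_div_iff₀ (by linarith)] at hx2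
    have hpos : 0 < 1 + c * x := by nlinarith [hx.1]
    have h1 : Real.exp (-y) ≤ (1 + c * x)⁻¹ := by
      rw [Real.exp_neg]
      refine inv_anti₀ hpos ?_
      have := Real.add_one_le_exp y
      have h2 : c * x ≤ y := hy
      linarith
    have h3 : (1 + c * x)⁻¹ ≤ 1 - x := by
      rw [inv_le_iff_one_le_mul₀ hpos]
      nlinarith [mul_pos hx.1 (sub_pos.2 hx2)]
    simp only [Set.mem_ofPred_eq]
    linarith
  refine tendsto_order.2 ⟨fun a ha => ?_, fun a ha => ?_⟩
  · have hcont : Tendsto (fun c : ℝ => c ^ (-α)) (𝓝[>] 1) (𝓝 1) := by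
      have : ContinuousAt (fun c : ℝ => c ^ (-α)) 1 :=
        Real.continuousAt_rpow_const 1 (-α) (Or.inl one_ne_zero)
      have h1 := this.tendsto
      rw [Real.one_rpow] at h1
      exact h1.mono_left nhdsWithin_le_nhds
    obtain ⟨c, hca, hc⟩ := ((hcont.eventually (lt_mem_nhds ha)).and self_mem_nhdsWithin).exists
    have hc1 : (1 : ℝ) < c := hc
    filter_upwards [(hℓ.tendsto_comp_mul_div hN (zero_lt_one.trans hc1)).eventually
      (lt_mem_nhds hca), hge c hc1, hNpos] with x h1 h2 h3
    exact h1.trans_le (div_le_div_of_nonneg_right h2 h3.le)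
  · filter_upwards [hNpos, self_mem_nhdsWithin] with x h1 h2
    exact ((div_le_one h1).2 (hle x h2)).trans_lt ha

theorem ne_zero_of_isEquivalent {ν : Measure ℝ} (hℓ : IsSlowlyVarying ℓ)
    (h : (fun y : ℝ => ν.real (Set.Ici y)) ~[𝓝[>] 0] fun y : ℝ => ℓ (1 / y) * y ^ (-α)) :
    ν ≠ 0 := by
  rintro rfl
  have hN := (isEquivalent_iff_tendsto_one
    ((hℓ.eventually_pos_at_zero α).mono fun y hy => hy.ne')).1 h
  obtain ⟨y, hy⟩ := (hℓ.eventually_pos_of_tendsto_div hN).exists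
  simp at hy

end VariationAtZero

/-! ### Regular variation of `ψ`. -/

section RegularVariationOfPsi

theorem laplaceOn_comp_mul (F : ℝ → ℝ) {c : ℝ} (hc : 0 < c) (r : ℝ) :
    laplaceOn (fun x => F (c * x)) r = c⁻¹ * laplaceOn F (c⁻¹ * r) := by
  have h := integral_comp_mul_left_Ioi (fun x => Real.exp (-(c⁻¹ * r * x)) * F x) 0 hc
  rw [mul_zero, smul_eq_mul] at h
  rw [laplaceOn, laplaceOn, ← h]
  refine integral_congr_ae (Eventually.of_forall fun x => ?_)
  simp only
  congr 2
  field_simp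

variable {ν : Measure ℝ} {ℓ : ℝ → ℝ} {α : ℝ}

/-- The comparison theorem is applied to the tail and its own dilation. This covers `α = 1` as well,
so slow variation of `ℓ*` never has to be proved separately. -/
theorem IsLevyMeasure.isRegularlyVarying_realPsi (hν : IsLevyMeasure ν) (hℓ : IsSlowlyVarying ℓ)
    (h : (fun y : ℝ => ν.real (Set.Ici y)) ~[𝓝[>] 0] fun y : ℝ => ℓ (1 / y) * y ^ (-α)) :
    IsRegularlyVarying (realPsi ν) α := by
  have hF := hν.tendsto_multTail_div hℓ h
  have hFpos := hℓ.eventually_pos_of_tendsto_div hF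
  have hint := fun {r : ℝ} (hr : 0 < r) => (hν.realPsi_eq_laplaceOn hr).1
  have key : ∀ c : ℝ, 0 < c → (∀ᶠ r in atTop, 0 < laplaceOn (multTail ν) r) ∧
      Tendsto (fun r => laplaceOn (fun x => multTail ν (c⁻¹ * x)) r / laplaceOn (multTail ν) r)
        atTop (𝓝 (c ^ α)) := by
    intro c hc
    have hc' := inv_pos.2 hc
    have hlim := hℓ.tendsto_comp_mul_div hF hc'
    rw [Real.inv_rpow hc.le, Real.rpow_neg hc.le, inv_inv] at hlim
    refine tendsto_laplaceOn_div (hint one_pos) (fun x _ => multTail_nonneg ν x) hFpos ?_ hlim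
    have h1 := (integrableOn_Ioi_comp_mul_left_iff
      (fun x => Real.exp (-(c * x)) * multTail ν x) 0 hc').2 (by rw [mul_zero]; exact hint hc)
    refine (integrable_congr (Eventually.of_forall fun x => ?_)).1 h1
    congr 2
    field_simp
  refine ⟨?_, fun c hc => ?_⟩
  · filter_upwards [(key 1 one_pos).1, eventually_gt_atTop 0] with r h1 h2
    rw [(hν.realPsi_eq_laplaceOn h2).2]
    exact mul_pos h2 h1
  · refine (key c hc).2.congr' ?_
    filter_upwards [(key 1 one_pos).1, eventually_gt_atTop 0] with r h1 h2
    rw [(hν.realPsi_eq_laplaceOn h2).2, (hν.realPsi_eq_laplaceOn (mul_pos hc h2)).2,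
      laplaceOn_comp_mul _ (inv_pos.2 hc), inv_inv]
    field_simp

end RegularVariationOfPsi

/-! ### The constant `Γ(1 - α)` for `α < 1`. -/

section GammaAsymptotics

variable {F : ℝ → ℝ} {ν : Measure ℝ} {ℓ : ℝ → ℝ} {α : ℝ}

/-- A Potter-type bound at `0` for antitone functions. -/
theorem exists_le_rpow_neg_mul {a γ : ℝ} (hγ : 0 ≤ γ) (hF : AntitoneOn F (Set.Ioi 0))
    (hFpos : ∀ᶠ x in 𝓝[>] 0, 0 < F x) (ha : a < 2 ^ γ)
    (h : Tendsto (fun x => F ((1 / 2) * x) / F x) (𝓝[>] 0) (𝓝 a)) :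
    ∀ᶠ x in 𝓝[>] 0, ∀ z, 0 < z → z ≤ 1 → F (z * x) ≤ 2 ^ γ * z ^ (-γ) * F x := by
  obtain ⟨δ, hδ, hsub⟩ := mem_nhdsGT_iff_exists_Ioc_subset.1
    ((h.eventually (gt_mem_nhds ha)).and hFpos)
  have hstep : ∀ n : ℕ, ∀ x ∈ Set.Ioc 0 δ, F ((1 / 2) ^ n * x) ≤ (2 ^ γ) ^ n * F x := by
    intro n
    induction n with
    | zero => intro x _; simp
    | succ n ih =>
      intro x hx
      have h1 : (1 / 2 : ℝ) ^ n * x ∈ Set.Ioc 0 δ :=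
        ⟨mul_pos (by positivity) hx.1,
          (mul_le_of_le_one_left hx.1.le (pow_le_one₀ (by norm_num) (by norm_num))).trans hx.2⟩
      obtain ⟨h2, h3⟩ := hsub h1
      have h4 := ((div_lt_iff₀ h3).1 h2).le
      rw [← mul_assoc, ← pow_succ'] at h4
      calc _ ≤ _ := h4
        _ ≤ 2 ^ γ * ((2 ^ γ) ^ n * F x) := by gcongr; exact ih x hx
        _ = _ := by ring
  filter_upwards [Ioc_mem_nhdsGT hδ] with x hx z hz hz1
  -- Here `(1/2)^{n+1} < z ≤ (1/2)^n`; rounding `z` down to a power of `1/2` costs the factor `2^γ`.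
  obtain ⟨n, hn1, hn2⟩ := exists_nat_pow_near_of_lt_one hz hz1 (y := (1 / 2 : ℝ))
    (by norm_num) (by norm_num)
  have hFx : 0 < F x := (hsub hx).2
  have h1 : F (z * x) ≤ F ((1 / 2) ^ (n + 1) * x) :=
    hF (Set.mem_Ioi.2 (mul_pos (by positivity) hx.1)) (Set.mem_Ioi.2 (mul_pos hz hx.1))
      (mul_le_mul_of_nonneg_right hn1.le hx.1.le)
  refine h1.trans ((hstep _ x hx).trans (mul_le_mul_of_nonneg_right ?_ hFx.le))
  rw [pow_succ']
  refine mul_le_mul_of_nonneg_left ?_ (by positivity)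
  have h2 : ((2 : ℝ) ^ γ) ^ n = ((1 / 2 : ℝ) ^ n) ^ (-γ) := by
    rw [← Real.rpow_natCast, ← Real.rpow_natCast, ← Real.rpow_mul two_pos.le,
      ← Real.rpow_mul (by norm_num), one_div, Real.inv_rpow two_pos.le,
      ← Real.rpow_neg two_pos.le]
    congr 1; ring
  rw [h2]
  exact Real.rpow_le_rpow_of_nonpos hz hn2 (by linarith)

/-- With `x = u/r` the quotient is `∫ e^{-u} F(u/r)/F(1/r) du`, whose integrand tends to `e^{-u}
u^{-α}`. Domination comes from the Potter bound for `u ≤ 1` and from monotonicity for `u ≥ 1`. -/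
theorem tendsto_mul_laplaceOn_div (hα1 : α < 1) (hα0 : 0 ≤ α) (hF : AntitoneOn F (Set.Ioi 0))
    (hF0 : ∀ x, 0 < x → 0 ≤ F x) (hFpos : ∀ᶠ x in 𝓝[>] 0, 0 < F x)
    (h : ∀ c, 0 < c → Tendsto (fun x => F (c * x) / F x) (𝓝[>] 0) (𝓝 (c ^ (-α)))) :
    Tendsto (fun r => r * laplaceOn F r / F (1 / r)) atTop (𝓝 (Real.Gamma (1 - α))) := by
  -- `γ > α` is needed for the Potter bound, and `γ < 1` for integrability of `u^{-γ}` at `0`.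
  obtain ⟨γ, hαγ, hγ1⟩ := exists_between hα1
  have hγ0 : 0 ≤ γ := hα0.trans hαγ.le
  have hinv : Tendsto (fun r : ℝ => 1 / r) atTop (𝓝[>] 0) := by
    simpa using tendsto_inv_atTop_nhdsGT_zero (𝕜 := ℝ)
  have h2 : ((1 / 2 : ℝ)) ^ (-α) < 2 ^ γ := by
    rw [one_div, Real.inv_rpow two_pos.le, Real.rpow_neg two_pos.le, inv_inv]
    exact Real.rpow_lt_rpow_of_exponent_lt one_lt_two hαγ
  have hpotter := hinv.eventually
    (exists_le_rpow_neg_mul hγ0 hF hFpos h2 (h (1 / 2) (by norm_num)))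
  have hpos := hinv.eventually hFpos
  have hΓ : Real.Gamma (1 - α) = ∫ u in Set.Ioi (0 : ℝ), Real.exp (-u) * u ^ (-α) := by
    rw [Real.Gamma_eq_integral (by linarith)]
    congr! 4
    ring
  rw [hΓ]
  have hbound : IntegrableOn (fun u : ℝ => 2 ^ γ * (Real.exp (-u) * u ^ (-γ)) + Real.exp (-u))
      (Set.Ioi 0) := by
    have h3 := Real.GammaIntegral_convergent (s := 1 - γ) (by linarith)
    have h4 := Real.GammaIntegral_convergent (s := 1) one_pos
    simp only [sub_sub_cancel_left, sub_self, Real.rpow_zero, mul_one] at h3 h4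
    exact (h3.const_mul _).add h4
  have hdct := tendsto_integral_filter_of_dominated_convergence
    (μ := volume.restrict (Set.Ioi (0 : ℝ))) (l := atTop)
    (F := fun r u => Real.exp (-u) * (F (u * (1 / r)) / F (1 / r)))
    (f := fun u => Real.exp (-u) * u ^ (-α)) _ ?_ ?_ hbound ?_
  · refine hdct.congr' ?_
    filter_upwards [eventually_gt_atTop 0] with r hr
    have h3 := laplaceOn_comp_mul F (inv_pos.2 hr) 1
    rw [inv_inv, mul_one] at h3
    rw [← h3, laplaceOn, ← integral_div]
    refine integral_congr_ae (Eventually.of_forall fun u => ?_)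
    simp only [one_mul, one_div, mul_div_assoc, mul_comm u]
  · filter_upwards [eventually_gt_atTop 0] with r hr
    have hanti : AntitoneOn (fun u => F (u * (1 / r))) (Set.Ioi 0) := fun u hu v hv huv =>
      hF (mul_pos hu (one_div_pos.2 hr)) (mul_pos hv (one_div_pos.2 hr))
        (mul_le_mul_of_nonneg_right huv (one_div_pos.2 hr).le)
    have := aemeasurable_restrict_of_antitoneOn (μ := volume) measurableSet_Ioi hanti
    exact AEMeasurable.aestronglyMeasurable
      (AEMeasurable.mul (by fun_prop) (this.div_const _))
  · filter_upwards [hpotter, hpos, eventually_gt_atTop 0] with r h3 h4 hr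
    filter_upwards [ae_restrict_mem measurableSet_Ioi] with u hu
    have hu' : (0 : ℝ) < u := hu
    have hr' : 0 < 1 / r := one_div_pos.2 hr
    rw [Real.norm_of_nonneg (mul_nonneg (Real.exp_pos _).le
      (div_nonneg (hF0 _ (mul_pos hu' hr')) h4.le))]
    have h5 : F (u * (1 / r)) / F (1 / r) ≤ 2 ^ γ * u ^ (-γ) + 1 := by
      rw [div_le_iff₀ h4]
      rcases le_total u 1 with hu1 | hu1
      · linarith [h3 u hu' hu1]
      · have h6 : F (u * (1 / r)) ≤ F (1 / r) :=
          hF hr' (mul_pos hu' hr') (le_mul_of_one_le_left hr'.le hu1)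
        have : 0 ≤ 2 ^ γ * u ^ (-γ) * F (1 / r) := by positivity
        linarith
    calc _ ≤ Real.exp (-u) * (2 ^ γ * u ^ (-γ) + 1) :=
          mul_le_mul_of_nonneg_left h5 (Real.exp_pos _).le
      _ = _ := by ring
  · filter_upwards [ae_restrict_mem measurableSet_Ioi] with u hu
    exact ((h u hu).comp hinv).const_mul _

theorem IsLevyMeasure.tendsto_realPsi_div_of_lt_one (hν : IsLevyMeasure ν)
    (hℓ : IsSlowlyVarying ℓ) (hα0 : 0 ≤ α) (hα1 : α < 1)
    (h : (fun y : ℝ => ν.real (Set.Ici y)) ~[𝓝[>] 0] fun y : ℝ => ℓ (1 / y) * y ^ (-α)) :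
    Tendsto (fun r => realPsi ν r / (r ^ α * ℓ r)) atTop (𝓝 (Real.Gamma (1 - α))) := by
  have hinv : Tendsto (fun r : ℝ => 1 / r) atTop (𝓝[>] 0) := by
    simpa using tendsto_inv_atTop_nhdsGT_zero (𝕜 := ℝ)
  have hF := hν.tendsto_multTail_div hℓ h
  have hFpos := hℓ.eventually_pos_of_tendsto_div hF
  have h1 := tendsto_mul_laplaceOn_div hα1 hα0 hν.multTail_antitoneOn
    (fun x _ => multTail_nonneg ν x) hFpos fun c hc => hℓ.tendsto_comp_mul_div hF hc
  have h2 := h1.mul (hF.comp hinv)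
  rw [mul_one] at h2
  refine h2.congr' ?_
  filter_upwards [eventually_gt_atTop 0, hinv.eventually hFpos] with r hr h3
  rw [(hν.realPsi_eq_laplaceOn hr).2, Function.comp_apply, one_div_one_div, Real.rpow_neg
    (one_div_pos.2 hr).le, one_div, Real.inv_rpow hr.le, inv_inv, mul_comm (ℓ r)]
  have h4 := h3.ne'
  rw [one_div] at h4
  field_simp

end GammaAsymptotics

/-! ### The function `ℓ*` and the case `α = 1`. -/

section SlowStar

variable {ℓ : ℝ → ℝ} {ν : Measure ℝ}

theorem hasDerivWithinAt_inv_mul {t x : ℝ} (ht : 0 < t) (hx : 0 < x) (s : Set ℝ) :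
    HasDerivWithinAt (fun x => (t * x)⁻¹) (-(t * x ^ 2)⁻¹) s x := by
  have h1 : HasDerivAt (fun x => t * x) (t * 1) x := (hasDerivAt_id x).const_mul t
  have h2 := (h1.inv (mul_pos ht hx).ne').hasDerivWithinAt (s := s)
  convert! h2 using 1
  field_simp

theorem injOn_inv_mul {t : ℝ} (ht : 0 < t) (s : Set ℝ) :
    Set.InjOn (fun x => (t * x)⁻¹) s := fun _ _ _ _ hxy =>
  mul_left_cancel₀ ht.ne' (inv_injective hxy)

/-- The substitution `y = 1/(tx)` turns `ℓ*(t)` into the Laplace transform at `t` of `ℓ(1/x)/x`, the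
function equivalent to the tail. The range `(0, 1]` of `y` corresponds to `[1/t, ∞)`. -/
theorem abs_deriv_smul_starIntegrand {t x : ℝ} (ht : 0 < t) (hx : 0 < x) :
    |-(t * x ^ 2)⁻¹| • starIntegrand ℓ t (t * x)⁻¹ =
      Real.exp (-(t * x)) * (ℓ (1 / x) * x ^ (-1 : ℝ)) := by
  have h1 : t * (t * x)⁻¹ = 1 / x := by field_simp
  rw [abs_neg, abs_of_pos (by positivity), smul_eq_mul, starIntegrand, h1, Real.rpow_neg_one,
    neg_div, one_div (t * x)⁻¹, inv_inv]
  field_simp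

theorem integrableOn_starIntegrand_iff {t : ℝ} (ht : 0 < t) {s : Set ℝ} (hs : MeasurableSet s)
    (hs0 : s ⊆ Set.Ioi 0) :
    IntegrableOn (starIntegrand ℓ t) ((fun x => (t * x)⁻¹) '' s) ↔
      IntegrableOn (fun x => Real.exp (-(t * x)) * (ℓ (1 / x) * x ^ (-1 : ℝ))) s := by
  rw [integrableOn_image_iff_integrableOn_abs_deriv_smul hs
    (fun x hx => hasDerivWithinAt_inv_mul ht (hs0 hx) s) (injOn_inv_mul ht s)]
  exact integrableOn_congr_fun (fun x hx => abs_deriv_smul_starIntegrand ht (hs0 hx)) hs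

theorem image_inv_mul_Ioi {t : ℝ} (ht : 0 < t) :
    (fun x => (t * x)⁻¹) '' Set.Ioi 0 = Set.Ioi 0 := by
  ext y
  refine ⟨?_, fun hy => ⟨(t * y)⁻¹, ?_, ?_⟩⟩
  · rintro ⟨x, hx, rfl⟩
    exact inv_pos.2 (mul_pos ht hx)
  · exact inv_pos.2 (mul_pos ht hy)
  · have hy' : (0 : ℝ) < y := hy
    simp only
    field_simp

theorem image_inv_mul_Ici {t : ℝ} (ht : 0 < t) :
    (fun x => (t * x)⁻¹) '' Set.Ici t⁻¹ = Set.Ioc 0 1 := by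
  have ht' := inv_pos.2 ht
  ext y
  refine ⟨?_, fun hy => ⟨(t * y)⁻¹, ?_, ?_⟩⟩
  · rintro ⟨x, hx, rfl⟩
    have hx0 : 0 < x := ht'.trans_le hx
    refine ⟨inv_pos.2 (mul_pos ht hx0), inv_le_one_of_one_le₀ ?_⟩
    have := mul_le_mul_of_nonneg_left (Set.mem_Ici.1 hx) ht.le
    rwa [mul_inv_cancel₀ ht.ne'] at this
  · exact inv_anti₀ (mul_pos ht hy.1) (mul_le_of_le_one_right ht.le hy.2)
  · have hy' : (0 : ℝ) < y := hy.1
    simp only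
    field_simp

theorem slowStar_eq_laplaceOn {t : ℝ} (ht : 0 < t) :
    slowStar ℓ t = laplaceOn (fun x => ℓ (1 / x) * x ^ (-1 : ℝ)) t := by
  rw [slowStar, laplaceOn, ← image_inv_mul_Ioi ht,
    integral_image_eq_integral_abs_deriv_smul measurableSet_Ioi
      (fun x hx => hasDerivWithinAt_inv_mul ht hx _) (injOn_inv_mul ht _), image_inv_mul_Ioi ht]
  exact setIntegral_congr_fun measurableSet_Ioi fun x hx => abs_deriv_smul_starIntegrand ht hx

variable {F : ℝ → ℝ}

/-- Near `0` the function is at most `2F`; on `[1/t, ∞)` integrability is the hypothesis `hstar` at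
`t`. -/
theorem integrableOn_exp_mul_of_tail (hℓ : IsSlowlyVarying ℓ)
    (hF : ∀ r : ℝ, 0 < r → IntegrableOn (fun x => Real.exp (-(r * x)) * F x) (Set.Ioi 0))
    (h : Tendsto (fun x => F x / (ℓ (1 / x) * x ^ (-1 : ℝ))) (𝓝[>] 0) (𝓝 1))
    (hstar : ∀ t : ℝ, 0 < t → IntegrableOn (starIntegrand ℓ t) (Set.Ioc 0 1)) {t : ℝ}
    (ht : 0 < t) :
    IntegrableOn (fun x => Real.exp (-(t * x)) * (ℓ (1 / x) * x ^ (-1 : ℝ))) (Set.Ioi 0) := by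
  have hm := hℓ.measurable
  have hfar : ∀ s : ℝ, 0 < s →
      IntegrableOn (fun x => Real.exp (-(s * x)) * (ℓ (1 / x) * x ^ (-1 : ℝ))) (Set.Ici s⁻¹) := by
    intro s hs
    rw [← integrableOn_starIntegrand_iff hs measurableSet_Ici
      (Set.Ici_subset_Ioi.2 (inv_pos.2 hs)), image_inv_mul_Ici hs]
    exact hstar s hs
  obtain ⟨δ, hδ, hsub⟩ := mem_nhdsGT_iff_exists_Ioc_subset.1
    ((h.eventually (lt_mem_nhds (show (1 / 2 : ℝ) < 1 by norm_num))).and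
      (hℓ.eventually_pos_at_zero 1))
  have hδ' : (0 : ℝ) < δ := hδ
  have hnear : IntegrableOn (fun x => Real.exp (-(t * x)) * (ℓ (1 / x) * x ^ (-1 : ℝ)))
      (Set.Ioc 0 δ) := by
    refine Integrable.mono' (((hF t ht).mono_set Set.Ioc_subset_Ioi_self).const_mul 2)
      (Measurable.aestronglyMeasurable (by fun_prop)) ?_
    filter_upwards [ae_restrict_mem measurableSet_Ioc] with x hx
    obtain ⟨h1, h2⟩ := hsub hx
    rw [lt_div_iff₀ h2] at h1
    rw [Real.norm_of_nonneg (mul_nonneg (Real.exp_pos _).le h2.le)]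
    calc _ ≤ Real.exp (-(t * x)) * (2 * F x) := 
          mul_le_mul_of_nonneg_left (by linarith) (Real.exp_pos _).le
      _ = _ := by ring
  -- Here `hstar` is used at `δ⁻¹`, which reaches down to `x = δ`; on a bounded range the
  -- exponentials with rates `t` and `δ⁻¹` are comparable. The interval may be empty.
  have hmid : IntegrableOn (fun x => Real.exp (-(t * x)) * (ℓ (1 / x) * x ^ (-1 : ℝ)))
      (Set.Icc δ t⁻¹) := by
    have h1 := hfar δ⁻¹ (inv_pos.2 hδ')
    rw [inv_inv] at h1
    have h2 : (fun x => Real.exp (-(t * x)) * (ℓ (1 / x) * x ^ (-1 : ℝ))) = fun x =>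
        Real.exp ((δ⁻¹ - t) * x) * (Real.exp (-(δ⁻¹ * x)) * (ℓ (1 / x) * x ^ (-1 : ℝ))) := by
      ext x
      rw [← mul_assoc (Real.exp _) (Real.exp _), ← Real.exp_add]
      congr 2; ring
    rw [h2]
    refine Integrable.bdd_mul (c := Real.exp (|δ⁻¹ - t| * t⁻¹)) (h1.mono_set Set.Icc_subset_Ici_self)
      (by fun_prop) ?_
    filter_upwards [ae_restrict_mem measurableSet_Icc] with x hx
    rw [Real.norm_of_nonneg (Real.exp_pos _).le]
    refine Real.exp_le_exp.2 ?_
    have hx0 : 0 ≤ x := hδ'.le.trans hx.1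
    calc _ ≤ |δ⁻¹ - t| * x := mul_le_mul_of_nonneg_right (le_abs_self _) hx0
      _ ≤ _ := mul_le_mul_of_nonneg_left hx.2 (abs_nonneg _)
  refine ((hnear.union hmid).union (hfar t ht)).mono_set fun x hx => ?_
  simp only [Set.mem_union, Set.mem_Ioc, Set.mem_Icc, Set.mem_Ici]
  have hx' : 0 < x := hx
  rcases le_total x δ with h1 | h1
  · exact Or.inl (Or.inl ⟨hx', h1⟩)
  · rcases le_total x t⁻¹ with h2 | h2
    · exact Or.inl (Or.inr ⟨h1, h2⟩)
    · exact Or.inr h2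

theorem IsLevyMeasure.integrableOn_starIntegrand (hν : IsLevyMeasure ν) (hℓ : IsSlowlyVarying ℓ)
    (h : (fun y : ℝ => ν.real (Set.Ici y)) ~[𝓝[>] 0] fun y : ℝ => ℓ (1 / y) * y ^ (-1 : ℝ))
    (hstar : ∀ t : ℝ, 0 < t → IntegrableOn (starIntegrand ℓ t) (Set.Ioc 0 1)) {t : ℝ}
    (ht : 0 < t) : IntegrableOn (starIntegrand ℓ t) (Set.Ioi 0) := by
  rw [← image_inv_mul_Ioi ht, integrableOn_starIntegrand_iff ht measurableSet_Ioi subset_rfl]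
  exact integrableOn_exp_mul_of_tail hℓ (fun r hr => (hν.realPsi_eq_laplaceOn hr).1)
    (hν.tendsto_multTail_div hℓ h) hstar ht

/-- The comparison theorem with the tail as reference function, since it is nonnegative everywhere
whereas `ℓ` may have any sign on bounded sets; the resulting limit is then inverted. -/
theorem IsLevyMeasure.tendsto_realPsi_div_of_eq_one (hν : IsLevyMeasure ν)
    (hℓ : IsSlowlyVarying ℓ)
    (h : (fun y : ℝ => ν.real (Set.Ici y)) ~[𝓝[>] 0] fun y : ℝ => ℓ (1 / y) * y ^ (-1 : ℝ))
    (hstar : ∀ t : ℝ, 0 < t → IntegrableOn (starIntegrand ℓ t) (Set.Ioc 0 1)) :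
    Tendsto (fun r => realPsi ν r / (r ^ (1 : ℝ) * slowStar ℓ r)) atTop (𝓝 1) := by
  have hF := hν.tendsto_multTail_div hℓ h
  have hFpos := hℓ.eventually_pos_of_tendsto_div hF
  have hint := fun (r : ℝ) (hr : 0 < r) => (hν.realPsi_eq_laplaceOn hr).1
  have h1 := hF.inv₀ one_ne_zero
  simp only [inv_one, inv_div] at h1
  obtain ⟨h2, h3⟩ := tendsto_laplaceOn_div (hint 1 one_pos) (fun x _ => multTail_nonneg ν x) hFpos
    (integrableOn_exp_mul_of_tail hℓ hint hF hstar one_pos) h1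
  have h4 := h3.inv₀ one_ne_zero
  simp only [inv_one, inv_div] at h4
  refine h4.congr' ?_
  filter_upwards [eventually_gt_atTop 0] with r hr
  rw [(hν.realPsi_eq_laplaceOn hr).2, slowStar_eq_laplaceOn hr, Real.rpow_one,
    mul_div_mul_left _ _ hr.ne']

end SlowStar

/-! ### Factorial moments and the final equivalence. -/

section FactorialMoments

variable {Ω : Type*} [MeasurableSpace Ω] {P : Measure Ω} [IsProbabilityMeasure P]
  {ν : Measure ℝ} {S : ℝ≥0 → Ω → ℝ} {X : ℝ → Ω → Set ℝ}

theorem IsSubordinator.binomMoment_eq_lintegral (hS : IsSubordinator S ν P) (hν : ν ≠ 0) {r : ℝ}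
    (hr : 0 < r) {Y : Ω → Set ℝ}
    (hY : IsPoissonProcess Y (ENNReal.ofReal r • volume.restrict (Set.Icc (0 : ℝ) 1)) P)
    (hSY : IndepOfProcess S Y P) (m : ℕ) :
    AEMeasurable (fun ω => ((compositionLength S Y ω).choose m : ℝ≥0∞)) P ∧
      Tendsto (fun n => walkMoment (stepLaw S P (dyadicStep n)) m r) atTop
        (𝓝 (binomMoment S P m r)) ∧
      binomMoment S P m r = ∫⁻ ω, ((compositionLength S Y ω).choose m : ℝ≥0∞) ∂P := by
  obtain ⟨h1, h2⟩ := hS.tendsto_walkMoment hν hr hY hSY dyadicStep_pos tendsto_dyadicStep m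
  have h3 : binomMoment S P m r = _ := h2.limsup_eq
  exact ⟨h1, h3 ▸ h2, h3⟩

theorem IsSubordinator.factorialMoment_eq (hS : IsSubordinator S ν P) (hν : ν ≠ 0) {r : ℝ}
    (hr : 0 < r) {Y : Ω → Set ℝ}
    (hY : IsPoissonProcess Y (ENNReal.ofReal r • volume.restrict (Set.Icc (0 : ℝ) 1)) P)
    (hSY : IndepOfProcess S Y P) (m : ℕ) :
    Integrable (fun ω => ((compositionLength S Y ω).descFactorial m : ℝ)) P ∧
      factorialMoment (compositionLength S Y) m P = m.factorial * realMoment S P m r := by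
  obtain ⟨h1, -, h3⟩ := hS.binomMoment_eq_lintegral hν hr hY hSY m
  have htop := hS.binomMoment_ne_top m hr.le
  rw [h3] at htop
  have heq : (fun ω => ((compositionLength S Y ω).descFactorial m : ℝ)) = fun ω =>
      (m.factorial : ℝ) * ((compositionLength S Y ω).choose m : ℝ≥0∞).toReal := by
    ext ω
    rw [Nat.descFactorial_eq_factorial_mul_choose]
    simp
  refine ⟨?_, ?_⟩
  · rw [heq]
    exact (integrable_toReal_of_lintegral_ne_top h1 htop).const_mul _
  · rw [factorialMoment, heq, integral_const_mul, integral_toReal h1 (by simp), realMoment, h3]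

/-- Serves both regimes: `κ = Γ(1 - α)` and `b ρ = ρ^α ℓ(ρ)` for `α < 1`, `κ = 1` and `b ρ = ρ
ℓ*(ρ)` for `α = 1`. Samples of every intensity are needed, because the recursion evaluates the
moments at all `ρ e^{-S_t}`. -/
theorem isEquivalent_factorialMoment {α : ℝ} (hα0 : 0 < α) (hα1 : α ≤ 1) (hS : IsSubordinator S ν P)
    (hX : ∀ ρ : ℝ, 0 < ρ →
      IsPoissonProcess (X ρ) (ENNReal.ofReal ρ • volume.restrict (Set.Icc (0 : ℝ) 1)) P)
    (hSX : ∀ ρ : ℝ, 0 < ρ → IndepOfProcess S (X ρ) P) (hν : ν ≠ 0)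
    (hψ : IsRegularlyVarying (realPsi ν) α) {b : ℝ → ℝ} {κ : ℝ} (hκ : 0 < κ)
    (hb : Tendsto (fun r => realPsi ν r / b r) atTop (𝓝 κ)) (m : ℕ) :
    (fun ρ : ℝ => factorialMoment (compositionLength S (X ρ)) m P) ~[atTop]
      fun ρ : ℝ => (∏ j ∈ Finset.Icc 1 m, (j * κ / laplaceExponent ν (α * j))) * b ρ ^ m := by
  have hc : SkeletonConverges S P := fun m r hr =>
    (hS.binomMoment_eq_lintegral hν hr (hX r hr) (hSX r hr) m).2.1
  have h1 := hS.tendsto_realMoment_div hν hc hα0 hα1 hψ m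
  have hΦ : ∀ j ∈ Finset.Icc 1 m, 0 < laplaceExponent ν (α * j) := fun j hj =>
    hS.levy.laplaceExponent_pos hν (mul_pos hα0 (by
      exact_mod_cast (Finset.mem_Icc.1 hj).1))
  have hC : (∏ j ∈ Finset.Icc 1 m, (j * κ / laplaceExponent ν (α * j))) =
      m.factorial * κ ^ m * ∏ j ∈ Finset.Icc 1 m, 1 / laplaceExponent ν (α * j) := by
    have hfac : (m.factorial : ℝ) = ∏ j ∈ Finset.Icc 1 m, (j : ℝ) := by
      clear * -
      induction m with
      | zero => simp
      | succ m ih =>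
        rw [Finset.prod_Icc_succ_top (Nat.le_add_left 1 m), ← ih, Nat.factorial_succ, mul_comm,
          Nat.cast_mul]
    have hpow : κ ^ m = ∏ _j ∈ Finset.Icc 1 m, κ := by simp
    rw [hfac, hpow, ← Finset.prod_mul_distrib, ← Finset.prod_mul_distrib]
    exact Finset.prod_congr rfl fun j _ => by rw [mul_one_div]
  rw [hC]
  set A := ∏ j ∈ Finset.Icc 1 m, 1 / laplaceExponent ν (α * j)
  have hA : 0 < A := Finset.prod_pos fun j hj => one_div_pos.2 (hΦ j hj)
  have hfac : (0 : ℝ) < m.factorial := by exact_mod_cast m.factorial_pos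
  have h2 := ((h1.mul (hb.pow m)).const_mul (m.factorial : ℝ)).div_const
    (m.factorial * κ ^ m * A)
  have h3 : (m.factorial : ℝ) * (A * κ ^ m) / (m.factorial * κ ^ m * A) = 1 := by
    field_simp
  rw [h3] at h2
  refine isEquivalent_of_tendsto_one (h2.congr' ?_)
  filter_upwards [eventually_gt_atTop 0, hψ.eventually_pos] with r hr hpos
  have hpos' := hpos.ne'
  rw [Pi.div_apply, (hS.factorialMoment_eq hν hr (hX r hr) (hSX r hr) m).2, div_pow,
    div_mul_div_cancel₀ (pow_ne_zero m hpos'), mul_div_assoc', div_div, mul_comm (b r ^ m)]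

end FactorialMoments

end RegenerativeComposition

end

theorem proposition6p2 {Ω : Type*} [MeasurableSpace Ω] (P : Measure Ω) [IsProbabilityMeasure P]
    (ν : Measure ℝ) (S : ℝ≥0 → Ω → ℝ) (hS : IsSubordinator S ν P)
    (X : ℝ → Ω → Set ℝ)
    (hX : ∀ ρ : ℝ, 0 < ρ →
      IsPoissonProcess (X ρ) (ENNReal.ofReal ρ • volume.restrict (Set.Icc (0 : ℝ) 1)) P)
    (hSX : ∀ ρ : ℝ, 0 < ρ → IndepOfProcess S (X ρ) P)
    (α : ℝ) (hα0 : 0 < α) (hα1 : α ≤ 1) (ℓ : ℝ → ℝ) (hℓ : IsSlowlyVarying ℓ)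
    (hν : (fun y : ℝ => ν.real (Set.Ici y)) ~[𝓝[>] 0] fun y : ℝ => ℓ (1 / y) * y ^ (-α))
    (m : ℕ) :
    (∀ ρ : ℝ, 0 < ρ →
      Integrable (fun ω => ((compositionLength S (X ρ) ω).descFactorial m : ℝ)) P) ∧
    (α < 1 →
      (fun ρ : ℝ => factorialMoment (compositionLength S (X ρ)) m P) ~[atTop]
        fun ρ : ℝ =>
          (∏ j ∈ Finset.Icc 1 m, (j * Real.Gamma (1 - α) / laplaceExponent ν (α * j))) *
            (ρ ^ α * ℓ ρ) ^ m) ∧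
    (α = 1 →
      (∀ t : ℝ, 0 < t → IntegrableOn (starIntegrand ℓ t) (Set.Ioc 0 1)) →
      (∀ t : ℝ, 0 < t → IntegrableOn (starIntegrand ℓ t) (Set.Ioi 0)) ∧
      (fun ρ : ℝ => factorialMoment (compositionLength S (X ρ)) m P) ~[atTop]
        fun ρ : ℝ =>
          (∏ j ∈ Finset.Icc 1 m, (j / laplaceExponent ν (α * j))) *
            (ρ ^ α * slowStar ℓ ρ) ^ m) := by
  have h0 := ne_zero_of_isEquivalent hℓ hν
  have hψ := hS.levy.isRegularlyVarying_realPsi hℓ hν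
  refine ⟨fun ρ hρ => (hS.factorialMoment_eq h0 hρ (hX ρ hρ) (hSX ρ hρ) m).1, fun hα => ?_,
    fun hα hstar => ?_⟩
  · exact isEquivalent_factorialMoment hα0 hα1 hS hX hSX h0 hψ (Real.Gamma_pos_of_pos (by linarith))
      (hS.levy.tendsto_realPsi_div_of_lt_one hℓ hα0.le hα hν) m
  · subst hα
    refine ⟨fun t ht => hS.levy.integrableOn_starIntegrand hℓ hν hstar ht, ?_⟩
    have h := isEquivalent_factorialMoment hα0 hα1 hS hX hSX h0 hψ one_pos
      (hS.levy.tendsto_realPsi_div_of_eq_one hℓ hν hstar) m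
    simpa only [mul_one] using h
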